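/- **Setting.** Let $G=(V,E)$ be a finite simple graph with $V=\{1,\dots,n\}$ and maximum degree $d^*$, let $\Sigma$ be a finite nonempty set, and let $\phi_v:\Sigma\to\mathbb R_{\ge 0}$ ($v\in V$) and $\psi_{uv}:\Sigma^2\to\mathbb R_{\ge0}$ ($(u,v)\in E$) be the potentials of a pairwise Markov random field on $G$. Let $$Z=\sum_{x\in\Sigma^n}\exp\Big(\sum_{v\in V}\phi_v(x_v)+\sum_{(u,v)\in E}\psi_{uv}(x_u,x_v)\Big).$$ Minors are taken in the usual sense (deletion of vertices and edges, contraction of edges). **Minor-e$(G,r,\Lambda)$.** Start with $\mathcal B=\emptyset$. In each of $r$ iterations do the following for the current graph $G_i=(V,E\setminus\mathcal B)$: in every connected component $S$ of $G_i$ pick an arbitrary node $\rho\in S$, draw a number $L$ uniformly from $\{0,\dots,\Lambda-1\}$, independently of all other draws, and select all edges of $S$ at the levels $L,\Lambda+L,2\Lambda+L,\dots$ of the breadth-first search of $S$ from $\rho$, where the level of an edge is the distance in $G_i$ from $\rho$ to its endpoint closer to $\rho$. Add the selected edges of all components to $\mathcal B$. The output is the final set $\mathcal B$. **Log Partition.**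 Given $\mathcal B\subset E$, let $S_1,\dots,S_K$ be the connected components of $(V,E\setminus\mathcal B)$ and let $Z_j$ be the partition function restricted to $S_j$, with the potentials of the vertices of $S_j$ and of the edges of $E\setminus\mathcal B$ inside $S_j$. With $\psi^L_{uv}=\min\psi_{uv}$ and $\psi^U_{uv}=\max\psi_{uv}$, the output is $$\log\hat Z_{LB}=\sum_{j}\log Z_j+\sum_{(u,v)\in\mathcal B}\psi^L_{uv},\qquad \log\hat Z_{UB}=\sum_{j}\log Z_j+\sum_{(u,v)\in\mathcal B}\psi^U_{uv}.$$ **Theorem.** Let $r\in\mathbb N$, suppose that $G$ excludes $K_{r,r}$ as a minor, let $\varepsilon>0$, and use Log Partition with Minor-e$(G,r,\Lambda)$, where $\Lambda=\lceil r(d^*+1)/\varepsilon\rceil$. 1. However the nodes are picked (by any rule that chooses a node of each component from the iteration index and the current graph), for every outcome of the random numbers $$\log\hat Z_{LB}\le\log Z\le\log\hat Z_{UB},$$ and $\mathbb E\big[\log\hat Z_{UB}-\log\hat Z_{LB}\big]\le\varepsilon\log Z$. 2. Consider random access machines with unit-cost arithmetic on natural numbers and unit-cost real arithmetic (including $\exp$,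 $\log$ and comparisons) that read a stream of uniform random numbers from $\{0,\dots,\Lambda-1\}$ at unit cost per number. There is one program which, given any such input (the graph as adjacency lists, the potentials as tables, and $r$, $\Lambda$), implements the algorithm with some valid choice of the picked nodes, and for which the following holds. For each $r$ there is a constant $C$ depending only on $r$ such that for all $n\ge1$, $G$, $\Sigma$, potentials and $\varepsilon>0$ as above and every outcome of the random numbers, the number of steps is at most $$C\,n\,D\,|\Sigma|^{2D^{C\Lambda}},\qquad D=\max(d^*,1);$$ for $d^*\ge2$ this is $O\big(n\,d^*\,|\Sigma|^{{d^*}^{O(\Lambda)}}\big)$. 3. For the same program, with $r$ and $\Sigma$ fixed: along every sequence of such inputs with $n\to\infty$ and $\varepsilon^{-1}d^*\log d^*=o(\log\log n)$, the number of steps is $o(n^{1+\delta})$ for every $\delta>0$. -/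

import Mathlib

open scoped NNReal BigOperators
open Filter Asymptotics

/-! ## Graph minors -/

/-- `H` is a minor of `G`: there are pairwise disjoint, nonempty, connected vertex sets of `G`
(the branch sets), one for each vertex of `H`, such that adjacent vertices of `H` have branch sets
that are joined by an edge of `G`.  Equivalently, `H` arises from `G` by deleting edges and
vertices and contracting edges. -/
def IsMinor {W V : Type*} (H : SimpleGraph W) (G : SimpleGraph V) : Prop :=
  ∃ B : W → Set V,
    (∀ w, (G.induce (B w)).Connected) ∧
    (∀ w w', w ≠ w' → Disjoint (B w) (B w')) ∧
    (∀ w w', H.Adj w w' → ∃ x ∈ B w, ∃ y ∈ B w', G.Adj x y)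

/-- `G` excludes the complete bipartite graph `K_{r,r}` as a minor. -/
def ExcludesKrr {V : Type*} (r : ℕ) (G : SimpleGraph V) : Prop :=
  ¬ IsMinor (completeBipartiteGraph (Fin r) (Fin r)) G

/-! ## Pairwise Markov random fields -/

/-- A pairwise Markov random field on the vertices `0, …, n-1` with alphabet `{0, …, q-1}` and
nonnegative potentials.  An undirected edge `{u, v}` with `u < v` carries the potential
`ψ u v : Σ × Σ → ℝ≥0` (first argument the label of `u`, second the label of `v`); the values of
`ψ u v` at the other pairs are never used. -/
structure PairwiseMRF (n q : ℕ) where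
  graph : SimpleGraph (Fin n)
  φ : Fin n → Fin q → ℝ≥0
  ψ : Fin n → Fin n → Fin q → Fin q → ℝ≥0

namespace PairwiseMRF

variable {n q : ℕ} (M : PairwiseMRF n q)

open scoped Classical in
/-- The maximum vertex degree `d*`. -/
noncomputable def maxDeg : ℕ := M.graph.maxDegree

open scoped Classical in
/-- The exponent `∑_v φ_v(x_v) + ∑_{(u,v) ∈ E} ψ_{uv}(x_u, x_v)`. -/
noncomputable def energy (x : Fin n → Fin q) : ℝ :=
  (∑ v, (M.φ v (x v) : ℝ)) +
    ∑ u, ∑ v, if u < v ∧ M.graph.Adj u v then (M.ψ u v (x u) (x v) : ℝ) else 0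

/-- The partition function `Z`. -/
noncomputable def Z : ℝ := ∑ x : Fin n → Fin q, Real.exp (M.energy x)

open scoped Classical in
/-- The partition function restricted to the vertex set `S`, where only the edges of `H` between
vertices of `S` are present. -/
noncomputable def ZOn (H : SimpleGraph (Fin n)) (S : Set (Fin n)) : ℝ :=
  ∑ x : S → Fin q, Real.exp ((∑ v : S, (M.φ v (x v) : ℝ)) +
    ∑ u : S, ∑ v : S, if u < v ∧ H.Adj u v then (M.ψ u v (x u) (x v) : ℝ) else 0)

/-- `ψ^L_{uv}`, the least value of `ψ_{uv}`. -/
noncomputable def ψL (u v : Fin n) : ℝ := ⨅ p : Fin q × Fin q, (M.ψ u v p.1 p.2 : ℝ)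

/-- `ψ^U_{uv}`, the greatest value of `ψ_{uv}`. -/
noncomputable def ψU (u v : Fin n) : ℝ := ⨆ p : Fin q × Fin q, (M.ψ u v p.1 p.2 : ℝ)

/-! ## The algorithm Log Partition, for a given set `B` of removed edges -/

open scoped Classical in
/-- The sum of the `log Z_j` over the connected components `S_j` of `(V, E \ B)`. -/
noncomputable def sumLogZ (B : Set (Sym2 (Fin n))) : ℝ :=
  ∑ c : (M.graph.deleteEdges B).ConnectedComponent,
    Real.log (M.ZOn (M.graph.deleteEdges B) c.supp)

open scoped Classical in
/-- The lower bound that Log Partition outputs. -/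
noncomputable def logLB (B : Set (Sym2 (Fin n))) : ℝ :=
  M.sumLogZ B + ∑ u, ∑ v, if u < v ∧ s(u, v) ∈ B then M.ψL u v else 0

open scoped Classical in
/-- The upper bound that Log Partition outputs. -/
noncomputable def logUB (B : Set (Sym2 (Fin n))) : ℝ :=
  M.sumLogZ B + ∑ u, ∑ v, if u < v ∧ s(u, v) ∈ B then M.ψU u v else 0

end PairwiseMRF

/-! ## The decomposition Minor-e -/

/-- The edges at level `ℓ` of the breadth-first search from the node `ρ` of the component `c` of
`H`: the edges of `c` whose endpoint closer to `ρ` is at distance `ℓ` from `ρ`. -/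
def levelEdges {V : Type*} (H : SimpleGraph V) (c : H.ConnectedComponent) (ρ : V) (ℓ : ℕ) :
    Set (Sym2 V) :=
  {e | ∃ u v, e = s(u, v) ∧ H.Adj u v ∧ H.connectedComponentMk u = c ∧
    min (H.dist ρ u) (H.dist ρ v) = ℓ}

/-- The edges selected in one iteration: in every component `c` of `H`, those at the levels
`L, Λ + L, 2Λ + L, …` of the search from `root c`, where `L` is the number drawn for `c`.  The
numbers are indexed by vertices; the one used for `c` sits at `root c`. -/
def cutEdges {V : Type*} (Λ : ℕ) (H : SimpleGraph V) (root : H.ConnectedComponent → V)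
    (L : V → ℕ) : Set (Sym2 V) :=
  {e | ∃ c k, e ∈ levelEdges H c (root c) (k * Λ + L (root c))}

/-- A rule that picks, in iteration `i` and in each component of the current graph `H`, a node. -/
abbrev RootRule (V : Type*) : Type _ := ℕ → (H : SimpleGraph V) → H.ConnectedComponent → V

/-- The picked node lies in the component for which it is picked. -/
def RootRule.Valid {V : Type*} (root : RootRule V) : Prop :=
  ∀ i (H : SimpleGraph V) (c : H.ConnectedComponent), H.connectedComponentMk (root i H c) = c

/-- The set of edges selected in the first `i` iterations of Minor-e. -/
def minorEIter {V : Type*} (G : SimpleGraph V) (Λ : ℕ) (root : RootRule V) (L : ℕ → V → ℕ) :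
    ℕ → Set (Sym2 V)
  | 0 => ∅
  | i + 1 => minorEIter G Λ root L i ∪
      cutEdges Λ (G.deleteEdges (minorEIter G Λ root L i))
        (root i (G.deleteEdges (minorEIter G Λ root L i))) (L i)

/-- The sample space of Minor-e with the uniform distribution: independent, uniformly distributed
numbers from `{0, …, Λ-1}`, one for each iteration and each vertex. -/
abbrev Draws (n r Λ : ℕ) : Type := Fin r → Fin n → Fin Λ

/-- The output of Minor-e(`G`, `r`, `Λ`) for the random numbers `L`. -/
def minorE {n : ℕ} (G : SimpleGraph (Fin n)) (r Λ : ℕ) (root : RootRule (Fin n))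
    (L : Draws n r Λ) : Set (Sym2 (Fin n)) :=
  minorEIter G Λ root (fun i v => if h : i < r then (L ⟨i, h⟩ v : ℕ) else 0) r

/-- `Λ = ⌈r (d* + 1) / ε⌉`. -/
noncomputable def levelParam {n q : ℕ} (M : PairwiseMRF n q) (r : ℕ) (ε : ℝ) : ℕ :=
  ⌈(r : ℝ) * ((M.maxDeg : ℝ) + 1) / ε⌉₊

/-! ## A randomized random access machine with real arithmetic -/

namespace RAM

/-- The memory: arrays of natural numbers, arrays of real numbers (array `a`, cell `i`), and the
unread part of the stream of random numbers. -/
structure State where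
  nat : ℕ → ℕ → ℕ
  real : ℕ → ℕ → ℝ
  coins : ℕ → ℕ

/-- Expressions with natural values. -/
inductive NExp where
  | lit (k : ℕ)
  | get (a : ℕ) (i : NExp)
  | add (e f : NExp)
  | sub (e f : NExp)
  | mul (e f : NExp)

/-- Expressions with real values. -/
inductive RExp where
  | cast (e : NExp)
  | get (a : ℕ) (i : NExp)
  | add (e f : RExp)
  | sub (e f : RExp)
  | mul (e f : RExp)
  | div (e f : RExp)
  | exp (e : RExp)
  | log (e : RExp)

/-- Tests. -/
inductive Test where
  | natLt (e f : NExp)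
  | natEq (e f : NExp)
  | realLt (e f : RExp)

/-- Programs. `draw a i` writes the next random number into cell `i` of array `a`. -/
inductive Prog where
  | skip
  | setNat (a : ℕ) (i : NExp) (e : NExp)
  | setReal (a : ℕ) (i : NExp) (e : RExp)
  | draw (a : ℕ) (i : NExp)
  | seq (p p' : Prog)
  | cond (b : Test) (p p' : Prog)
  | loop (b : Test) (p : Prog)

def NExp.val (σ : State) : NExp → ℕ
  | lit k => k
  | get a i => σ.nat a (i.val σ)
  | add e f => e.val σ + f.val σ
  | sub e f => e.val σ - f.val σ
  | mul e f => e.val σ * f.val σ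

noncomputable def RExp.val (σ : State) : RExp → ℝ
  | cast e => (e.val σ : ℝ)
  | get a i => σ.real a (i.val σ)
  | add e f => e.val σ + f.val σ
  | sub e f => e.val σ - f.val σ
  | mul e f => e.val σ * f.val σ
  | div e f => e.val σ / f.val σ
  | exp e => Real.exp (e.val σ)
  | log e => Real.log (e.val σ)

def Test.Holds (σ : State) : Test → Prop
  | natLt e f => e.val σ < f.val σ
  | natEq e f => e.val σ = f.val σ
  | realLt e f => e.val σ < f.val σ

def State.writeNat (σ : State) (a i x : ℕ) : State :=
  { σ with nat := Function.update σ.nat a (Function.update (σ.nat a) i x) }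

noncomputable def State.writeReal (σ : State) (a i : ℕ) (x : ℝ) : State :=
  { σ with real := Function.update σ.real a (Function.update (σ.real a) i x) }

def State.nextCoin (σ : State) : State :=
  { σ with coins := fun k => σ.coins (k + 1) }

/-- `Exec p σ σ' t`: the program `p`, started in the state `σ`, halts in the state `σ'` after `t`
steps.  Every executed basic instruction and every evaluated test is one step.  (The expressions
occurring in a program have a size that does not depend on the input, so that counting their
arithmetic operations and memory accesses separately changes `t` by at most a constant factor
that depends only on the program.) -/
inductive Exec : Prog → State → State → ℕ → Prop
  | skip (σ : State) : Exec .skip σ σ 1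
  | setNat (a : ℕ) (i e : NExp) (σ : State) :
      Exec (.setNat a i e) σ (σ.writeNat a (i.val σ) (e.val σ)) 1
  | setReal (a : ℕ) (i : NExp) (e : RExp) (σ : State) :
      Exec (.setReal a i e) σ (σ.writeReal a (i.val σ) (e.val σ)) 1
  | draw (a : ℕ) (i : NExp) (σ : State) :
      Exec (.draw a i) σ ((σ.writeNat a (i.val σ) (σ.coins 0)).nextCoin) 1
  | seq {p p' : Prog} {σ σ' σ'' : State} {t t' : ℕ} :
      Exec p σ σ' t → Exec p' σ' σ'' t' → Exec (.seq p p') σ σ'' (t + t')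
  | condTrue {b : Test} {p p' : Prog} {σ σ' : State} {t : ℕ} :
      b.Holds σ → Exec p σ σ' t → Exec (.cond b p p') σ σ' (t + 1)
  | condFalse {b : Test} {p p' : Prog} {σ σ' : State} {t : ℕ} :
      ¬ b.Holds σ → Exec p' σ σ' t → Exec (.cond b p p') σ σ' (t + 1)
  | loopTrue {b : Test} {p : Prog} {σ σ' σ'' : State} {t t' : ℕ} :
      b.Holds σ → Exec p σ σ' t → Exec (.loop b p) σ' σ'' t' →
      Exec (.loop b p) σ σ'' (t + t' + 1)
  | loopFalse {b : Test} {p : Prog} {σ : State} :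
      ¬ b.Holds σ → Exec (.loop b p) σ σ 1

/-- The initial state `σ` is an encoding of the input `M`, `r`, `Λ`, with the random numbers `L` on
the stream.  The graph is given by adjacency lists: the list of `v` occupies the cells
`off v, …, off (v+1) - 1` of array 2 of natural numbers, where `off` is array 1, and the potential
of the edge from `v` to the neighbour in cell `s` is stored as a `q × q` table, number `s`, in
array 1 of real numbers.  Array 0 of real numbers holds the vertex potentials.  All other memory
is zero. -/
structure Encodes {n q : ℕ} (M : PairwiseMRF n q) (r Λ : ℕ) (L : Draws n r Λ)
    (σ : State) : Prop where
  size_n : σ.nat 0 0 = n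
  size_q : σ.nat 0 1 = q
  param_r : σ.nat 0 2 = r
  param_Λ : σ.nat 0 3 = Λ
  off_zero : σ.nat 1 0 = 0
  off_succ : ∀ v : Fin n,
    σ.nat 1 ((v : ℕ) + 1) = σ.nat 1 (v : ℕ) + (M.graph.neighborSet v).ncard
  neighbours : ∀ v u : Fin n, M.graph.Adj v u ↔
    ∃ s, σ.nat 1 (v : ℕ) ≤ s ∧ s < σ.nat 1 ((v : ℕ) + 1) ∧ σ.nat 2 s = (u : ℕ)
  vertex_pot : ∀ (v : Fin n) (a : Fin q), σ.real 0 ((v : ℕ) * q + (a : ℕ)) = (M.φ v a : ℝ)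
  edge_pot : ∀ (v u : Fin n) (s : ℕ), σ.nat 1 (v : ℕ) ≤ s → s < σ.nat 1 ((v : ℕ) + 1) →
    σ.nat 2 s = (u : ℕ) → ∀ a b : Fin q,
      σ.real 1 ((s * q + (a : ℕ)) * q + (b : ℕ)) =
        if v < u then (M.ψ v u a b : ℝ) else (M.ψ u v b a : ℝ)
  random : ∀ (i : Fin r) (v : Fin n), σ.coins ((i : ℕ) * n + (v : ℕ)) = (L i v : ℕ)
  registers_zero : ∀ i, 4 ≤ i → σ.nat 0 i = 0
  nat_zero : ∀ a, 3 ≤ a → ∀ i, σ.nat a i = 0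
  real_zero : ∀ a, 2 ≤ a → ∀ i, σ.real a i = 0

end RAM

/-! Bounds. Every assignment gives a removed edge a potential between `ψL` and `ψU`, and after
deleting these edges the sum over assignments factors over the components. This sandwiches `log Z`,
and the gap is the sum of `ψU - ψL` over the removed edges. An edge is selected in a given iteration
only if the number drawn at the root of its component equals its level modulo `Λ`. The graph and the
root are determined by the earlier iterations, so this has probability at most `1/Λ`, and the edge
is removed with probability at most `r/Λ`. It remains to bound the total of `ψU - ψL` over all edges
by `(d* + 1) log Z`. By Vizing's theorem the edges split into `d* + 1` matchings. On a matching one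
assignment attains all the maxima at once, and as potentials are nonnegative its energy, hence `log
Z`, is at least the sum of these maxima. Now `r (d* + 1) / Λ ≤ ε`. Vizing's theorem is proved by
adding vertices one at a time, with the Berge–Fournier extension lemma
(`exists_colouring_with_distinct_missing`).

Component sizes. This is the theorem of Klein, Plotkin and Rao. If two vertices of a final component
were at distance more than `20 r² Λ` in `G`, then `r` mutually distant vertices of the component
could be connected, stage by stage and backwards in time, by geodesics to the roots of the `r`
searches. Initial pieces of these geodesics near each root form one side of a `K_{r,r}` minor, the
remaining pieces the other side (`BandChain.model_step`). Hence components lie in balls of radius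
`20 r² Λ` and have at most `2 D ^ (40 r² Λ)` vertices.

Running time. The program finds components by breadth-first search, which also makes every component
a contiguous segment of the queue, and then enumerates the assignments of each component like an
odometer in base `q`. The cost is `q ^ s` times the number of vertices and adjacency cells, where `s
≥ 2` bounds the component sizes. Correctness and step counts are proved together in a small Hoare
logic (`Runs`), with potentials for the amortised cost of the search. For the almost linear bound
the number of cells is bounded by a multiple of `n` alone, using Mader's theorem that graphs without
a fixed minor are sparse. This is needed because `d*` may be large when `ε` is large. If `ε⁻¹ d* log
d* = o(log log n)`, then `s` is eventually at most `2 √(log n)`, and `q ^ s` is smaller than any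
power of `n`. -/

section EdgeColouring

/-! ### Edge colourings: Kempe exchanges, the Berge–Fournier lemma, Vizing's theorem -/

set_option linter.unusedSectionVars false

open scoped Classical

variable {V : Type*} [Fintype V]

/-- A connected set with `m` vertices that is closed under adjacency has degree sum at least
`2 (m - 1)`. -/
theorem two_mul_card_le_sum_degree (H : SimpleGraph V) (S : Set V) (hS : (H.induce S).Connected)
    (hcl : ∀ v ∈ S, H.neighborSet v ⊆ S) :
    2 * S.toFinset.card ≤ (∑ v ∈ S.toFinset, H.degree v) + 2 := by
  have h1 := hS.card_vert_le_card_edgeSet_add_one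
  have h2 := (H.induce S).sum_degrees_eq_twice_card_edges
  have h3 : ∑ v, (H.induce S).degree v = ∑ v ∈ S.toFinset, H.degree v := by
    refine Finset.sum_bij (fun v _ => v.1) (fun v _ => by simp)
      (fun v _ w _ h => Subtype.ext h) (fun w hw => ⟨⟨w, Set.mem_toFinset.1 hw⟩, by simp, rfl⟩)
      fun v _ => ?_
    exact SimpleGraph.degree_induce_of_neighborSet_subset (hcl v.1 v.2)
  have h4 : Nat.card (H.induce S).edgeSet = (H.induce S).edgeFinset.card := by
    rw [Nat.card_eq_fintype_card, SimpleGraph.edgeFinset_card]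
  have h5 : Nat.card S = S.toFinset.card := by
    rw [Set.toFinset_card, ← Nat.card_eq_fintype_card]
  omega

theorem two_mul_card_supp_le_sum_degree (H : SimpleGraph V) (C : H.ConnectedComponent) :
    2 * C.supp.toFinset.card ≤ (∑ v ∈ C.supp.toFinset, H.degree v) + 2 := by
  have := two_mul_card_le_sum_degree H C.supp C.connected_toSimpleGraph
    fun v hv w hw => (C.mem_supp_congr_adj hw).1 hv
  convert this

/-- In a graph of maximum degree at most two, a connected component has at most two vertices
of degree at most one. -/
theorem card_degree_le_one_le_two (H : SimpleGraph V) (h2 : ∀ v, H.degree v ≤ 2)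
    (C : H.ConnectedComponent) (X : Finset V) (hX : ∀ v ∈ X, v ∈ C.supp ∧ H.degree v ≤ 1) :
    X.card ≤ 2 := by
  have h := two_mul_card_supp_le_sum_degree H C
  have hs : X ⊆ C.supp.toFinset := fun v hv => by simpa using (hX v hv).1
  have e := Finset.sum_sdiff (f := fun v => H.degree v) hs
  have c := Finset.card_sdiff_add_card_eq_card hs
  have a1 : ∑ v ∈ X, H.degree v ≤ X.card * 1 := Finset.sum_le_card_nsmul _ _ _ fun v hv => (hX v hv).2
  have a2 : ∑ v ∈ C.supp.toFinset \ X, H.degree v ≤ (C.supp.toFinset \ X).card * 2 :=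
    Finset.sum_le_card_nsmul _ _ _ fun v _ => h2 v
  omega

/-- `c` is a proper edge colouring of `G` with colours from `K`. -/
structure IsEdgeColouring (G : SimpleGraph V) (K : Finset ℕ) (c : V → V → ℕ) : Prop where
  symm : ∀ u v, G.Adj u v → c u v = c v u
  mem : ∀ u v, G.Adj u v → c u v ∈ K
  inj : ∀ u v w, G.Adj u v → G.Adj u w → c u v = c u w → v = w

/-- The colours of `K` that `c` does not use at `w`. -/
noncomputable def missingColours (G : SimpleGraph V) (K : Finset ℕ) (c : V → V → ℕ) (w : V) :
    Finset ℕ :=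
  K.filter fun i => ∀ x, G.Adj w x → c w x ≠ i

theorem mem_missingColours {G : SimpleGraph V} {K : Finset ℕ} {c : V → V → ℕ} {w : V} {i : ℕ} :
    i ∈ missingColours G K c w ↔ i ∈ K ∧ ∀ x, G.Adj w x → c w x ≠ i := by
  simp [missingColours]

theorem card_missingColours {G : SimpleGraph V} {K : Finset ℕ} {c : V → V → ℕ}
    (hc : IsEdgeColouring G K c) (w : V) :
    (missingColours G K c w).card + G.degree w = K.card := by
  have h1 : ((G.neighborFinset w).image (c w)).card = G.degree w := by
    rw [Finset.card_image_of_injOn, SimpleGraph.card_neighborFinset_eq_degree]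
    intro x hx y hy hxy
    exact hc.inj w x y (by simpa using hx) (by simpa using hy) hxy
  have h2 : missingColours G K c w = K \ ((G.neighborFinset w).image (c w)) := by
    ext i; simp [missingColours]
  rw [h2, ← h1, Finset.card_sdiff_add_card_eq_card]
  intro i hi
  simp only [Finset.mem_image, SimpleGraph.mem_neighborFinset] at hi
  obtain ⟨x, hx, rfl⟩ := hi
  exact hc.mem w x hx

/-- Exchange of the colours `i` and `j` on the vertex set `C`. -/
noncomputable def kempe (i j : ℕ) (C : Set V) (c : V → V → ℕ) : V → V → ℕ :=
  fun x y => if x ∈ C then Equiv.swap i j (c x y) else c x y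

/-- The edges with the colours `i` and `j`. -/
def twoColourGraph (G : SimpleGraph V) (c : V → V → ℕ) (i j : ℕ) : SimpleGraph V where
  Adj x y := G.Adj x y ∧ (c x y = i ∨ c x y = j) ∧ (c y x = i ∨ c y x = j)
  symm := ⟨fun _ _ h => ⟨h.1.symm, h.2.2, h.2.1⟩⟩
  loopless := ⟨fun _ h => h.1.ne rfl⟩

theorem twoColourGraph_adj {G : SimpleGraph V} {K : Finset ℕ} {c : V → V → ℕ}
    (hc : IsEdgeColouring G K c) {i j : ℕ} {x y : V} :
    (twoColourGraph G c i j).Adj x y ↔ G.Adj x y ∧ (c x y = i ∨ c x y = j) := by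
  refine ⟨fun h => ⟨h.1, h.2.1⟩, fun h => ⟨h.1, h.2, ?_⟩⟩
  rw [← hc.symm x y h.1]; exact h.2

/-- A vertex sees at most one edge of each colour, so its degree is at most the number of colours
among `i`, `j` that occur at it: two in general, at most one if either is missing. -/
theorem degree_twoColourGraph_le {G : SimpleGraph V} {K : Finset ℕ} {c : V → V → ℕ}
    (hc : IsEdgeColouring G K c) (i j : ℕ) (x : V) :
    (twoColourGraph G c i j).degree x ≤ (({i, j} : Finset ℕ) \ missingColours G {i, j} c x).card := by
  rw [← SimpleGraph.card_neighborFinset_eq_degree]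
  refine Finset.card_le_card_of_injOn (c x) ?_ ?_
  · intro y hy
    have hy' := (twoColourGraph_adj hc).1 (by simpa using hy)
    simp only [Finset.coe_sdiff, Set.mem_sdiff, Finset.mem_coe, Finset.mem_insert,
      Finset.mem_singleton, mem_missingColours]
    exact ⟨hy'.2, fun h => h.2 y hy'.1 rfl⟩
  · intro y hy z hz hyz
    exact hc.inj x y z ((twoColourGraph_adj hc).1 (by simpa using hy)).1
      ((twoColourGraph_adj hc).1 (by simpa using hz)).1 hyz

/-- An edge of colour `i` or `j` has both ends in the component or neither, and every other colour
is fixed by the transposition. Hence the two ends agree about the new colour. -/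
theorem kempe_isEdgeColouring {G : SimpleGraph V} {K : Finset ℕ} {c : V → V → ℕ}
    (hc : IsEdgeColouring G K c) {i j : ℕ} (hi : i ∈ K) (hj : j ∈ K)
    (C : (twoColourGraph G c i j).ConnectedComponent) :
    IsEdgeColouring G K (kempe i j C.supp c) := by
  refine ⟨fun u v huv => ?_, fun u v huv => ?_, fun u v w huv huw h => ?_⟩
  · by_cases hcol : c u v = i ∨ c u v = j
    · have := C.mem_supp_congr_adj ((twoColourGraph_adj hc).2 ⟨huv, hcol⟩)
      simp only [kempe, this, hc.symm u v huv]
      split_ifs <;> rfl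
    · have hcol' := hcol
      rw [not_or] at hcol
      have e : Equiv.swap i j (c u v) = c u v := Equiv.swap_apply_of_ne_of_ne hcol.1 hcol.2
      simp only [kempe, ← hc.symm u v huv, e, ite_self]
  · unfold kempe
    have := hc.mem u v huv
    split_ifs
    · rw [Equiv.swap_apply_def]; split_ifs <;> assumption
    · exact this
  · refine hc.inj u v w huv huw ?_
    unfold kempe at h
    split_ifs at h
    · exact (Equiv.swap i j).injective h
    · exact h

theorem mem_missingColours_kempe {G : SimpleGraph V} {K : Finset ℕ} {c : V → V → ℕ}
    {i j : ℕ} (hi : i ∈ K) (hj : j ∈ K) {C : Set V} {w : V} {F : Finset ℕ}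
    (hF : F ⊆ missingColours G K c w) :
    (if w ∈ C then F.image (Equiv.swap i j) else F) ⊆ missingColours G K (kempe i j C c) w := by
  intro l hl
  rw [mem_missingColours]
  by_cases hw : w ∈ C
  · simp only [hw, if_true, Finset.mem_image] at hl
    obtain ⟨m, hm, rfl⟩ := hl
    have := mem_missingColours.1 (hF hm)
    refine ⟨?_, fun x hx h => this.2 x hx ?_⟩
    · rw [Equiv.swap_apply_def]; split_ifs <;> first | assumption | exact this.1
    · simp only [kempe, hw, if_true] at h
      exact (Equiv.swap i j).injective h
  · simp only [hw, if_false] at hl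
    have := mem_missingColours.1 (hF hl)
    simpa [kempe, hw] using this

/-- If the sum of the sizes is odd and too small for sizes at least two, and no size is one, then
some size is zero and some size is at least three. -/
theorem exists_zero_and_three_le {K : Finset ℕ} {x : ℕ → ℕ} (hodd : Odd (∑ i ∈ K, x i))
    (hlt : ∑ i ∈ K, x i < 2 * K.card) (h1 : ∀ i ∈ K, x i ≠ 1) :
    (∃ i ∈ K, x i = 0) ∧ ∃ j ∈ K, 3 ≤ x j := by
  constructor
  · by_contra! h
    have : K.card • 2 ≤ ∑ i ∈ K, x i := Finset.card_nsmul_le_sum _ _ _ fun i hi => by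
      have := h i hi; have := h1 i hi; omega
    simp only [smul_eq_mul] at this
    omega
  · by_contra! h
    have : Even (∑ i ∈ K, x i) := Finset.even_sum _ fun i hi => by
      have := h i hi; have := h1 i hi
      interval_cases x i <;> simp_all
    exact (Nat.not_even_iff_odd.2 hodd) this

/-- The vertices of `N` whose set of reserved colours contains `i`. -/
noncomputable def reservedFor (N : Finset V) (F : V → Finset ℕ) (i : ℕ) : Finset V :=
  N.filter fun w => i ∈ F w

theorem sum_card_reservedFor {N : Finset V} {F : V → Finset ℕ} {K : Finset ℕ}
    (h : ∀ w ∈ N, F w ⊆ K) : ∑ i ∈ K, (reservedFor N F i).card = ∑ w ∈ N, (F w).card := by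
  simp_rw [reservedFor, Finset.card_filter]
  rw [Finset.sum_comm]
  refine Finset.sum_congr rfl fun w hw => ?_
  rw [← Finset.card_filter, Finset.filter_mem_eq_inter, Finset.inter_eq_right.2 (h w hw)]

/-- Exchange `i` and `j` on the two-colour component of one vertex that reserves `j`. At most two
vertices of it miss `j`, so one or two reservations move from `j` to the unreserved `i`, and at
least one of the three or more stays. With `a, b ≥ 1` one has `a² + b² < (a + b)²`. -/
theorem kempe_decreases {G : SimpleGraph V} {K : Finset ℕ} {c : V → V → ℕ}
    (hc : IsEdgeColouring G K c) {N : Finset V} {F : V → Finset ℕ}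
    (hF : ∀ w ∈ N, F w ⊆ missingColours G K c w) {i j : ℕ} (hi : i ∈ K) (hj : j ∈ K)
    (h0 : (reservedFor N F i).card = 0) (h3 : 3 ≤ (reservedFor N F j).card) :
    ∃ c' F', IsEdgeColouring G K c' ∧ (∀ w ∈ N, F' w ⊆ missingColours G K c' w) ∧
      (∀ w, (F' w).card = (F w).card) ∧
      ∑ l ∈ K, (reservedFor N F' l).card ^ 2 < ∑ l ∈ K, (reservedFor N F l).card ^ 2 := by
  obtain ⟨u, hu⟩ : (reservedFor N F j).Nonempty := Finset.card_pos.1 (by omega)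
  set C := (twoColourGraph G c i j).connectedComponentMk u with hC
  have hij : i ≠ j := by rintro rfl; omega
  set F' : V → Finset ℕ := fun w => if w ∈ C.supp then (F w).image (Equiv.swap i j) else F w with hF'
  have hni : ∀ w ∈ N, i ∉ F w := by
    intro w hw h
    rw [Finset.card_eq_zero] at h0
    have : w ∈ reservedFor N F i := by simp [reservedFor, hw, h]
    simp [h0] at this
  refine ⟨kempe i j C.supp c, F', kempe_isEdgeColouring hc hi hj C,
    fun w hw => ?_, fun w => ?_, ?_⟩
  · convert mem_missingColours_kempe (C := C.supp) hi hj (hF w hw)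
  · simp only [hF']
    split_ifs
    · exact Finset.card_image_of_injective _ (Equiv.swap i j).injective
    · rfl
  set A := (reservedFor N F j).filter (fun w => w ∈ C.supp) with hA
  set B := (reservedFor N F j).filter (fun w => w ∉ C.supp) with hB
  have hAB : A.card + B.card = (reservedFor N F j).card :=
    Finset.card_filter_add_card_filter_not _
  have hApos : 0 < A.card := Finset.card_pos.2 ⟨u, by simp [hA, hu, hC]⟩
  have hmem : ∀ w ∈ N, ∀ l, l ∈ F' w ↔ if w ∈ C.supp then Equiv.swap i j l ∈ F w else l ∈ F w := by
    intro w _ l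
    simp only [hF']
    split_ifs
    · simp only [Finset.mem_image]
      constructor
      · rintro ⟨m, hm, rfl⟩; simpa using hm
      · intro h; exact ⟨_, h, by simp⟩
    · rfl
  have hAi : reservedFor N F' i = A := by
    ext w
    simp only [reservedFor, hA, Finset.mem_filter]
    constructor
    · rintro ⟨hw, h⟩
      rw [hmem w hw] at h
      split_ifs at h with hwC
      · rw [Equiv.swap_apply_left] at h; exact ⟨⟨hw, h⟩, hwC⟩
      · exact absurd h (hni w hw)
    · rintro ⟨⟨hw, h⟩, hwC⟩
      refine ⟨hw, ?_⟩
      rw [hmem w hw, if_pos hwC, Equiv.swap_apply_left]; exact h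
  have hBj : reservedFor N F' j = B := by
    ext w
    simp only [reservedFor, hB, Finset.mem_filter]
    constructor
    · rintro ⟨hw, h⟩
      rw [hmem w hw] at h
      split_ifs at h with hwC
      · rw [Equiv.swap_apply_right] at h; exact absurd h (hni w hw)
      · exact ⟨⟨hw, h⟩, hwC⟩
    · rintro ⟨⟨hw, h⟩, hwC⟩
      refine ⟨hw, ?_⟩
      rw [hmem w hw, if_neg hwC]; exact h
  have hother : ∀ l, l ≠ i → l ≠ j → reservedFor N F' l = reservedFor N F l := by
    intro l hli hlj
    ext w
    simp only [reservedFor, Finset.mem_filter]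
    refine and_congr_right fun hw => ?_
    rw [hmem w hw, Equiv.swap_apply_of_ne_of_ne hli hlj, ite_self]
  -- The vertices of `A` miss `j`, so they are ends of paths (or isolated) in the two-colour graph.
  have hA2 : A.card ≤ 2 := by
    refine card_degree_le_one_le_two (twoColourGraph G c i j) (fun v => ?_) C A fun w hw => ?_
    · refine (degree_twoColourGraph_le hc i j v).trans ?_
      exact (Finset.card_le_card Finset.sdiff_subset).trans Finset.card_le_two
    · simp only [hA, reservedFor, Finset.mem_filter] at hw
      refine ⟨hw.2, (degree_twoColourGraph_le hc i j w).trans ?_⟩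
      have hjm : ({i, j} : Finset ℕ) \ missingColours G {i, j} c w ⊆ {i} := by
        intro l hl
        simp only [Finset.mem_sdiff, Finset.mem_insert, Finset.mem_singleton,
          mem_missingColours] at hl ⊢
        rcases hl.1 with h | h
        · exact h
        · exfalso
          apply hl.2
          refine ⟨Or.inr h, ?_⟩
          rw [h]
          exact (mem_missingColours.1 (hF w hw.1.1 hw.1.2)).2
      exact (Finset.card_le_card hjm).trans (by simp)
  rw [← Finset.add_sum_erase K _ hi, ← Finset.add_sum_erase (K.erase i) _ (Finset.mem_erase.2 ⟨hij.symm, hj⟩),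
    ← Finset.add_sum_erase K (fun l => (reservedFor N F l).card ^ 2) hi,
    ← Finset.add_sum_erase (K.erase i) (fun l => (reservedFor N F l).card ^ 2)
      (Finset.mem_erase.2 ⟨hij.symm, hj⟩)]
  have hrest : ∑ l ∈ (K.erase i).erase j, (reservedFor N F' l).card ^ 2
      = ∑ l ∈ (K.erase i).erase j, (reservedFor N F l).card ^ 2 := by
    refine Finset.sum_congr rfl fun l hl => ?_
    simp only [Finset.mem_erase] at hl
    rw [hother l hl.2.1 hl.1]
  rw [hrest, hAi, hBj, h0, ← hAB]
  nlinarith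

/-- Removing the colour `i` from a coloured graph. -/
def eraseColour (G : SimpleGraph V) (c : V → V → ℕ) (i : ℕ) : SimpleGraph V where
  Adj x y := G.Adj x y ∧ c x y ≠ i ∧ c y x ≠ i
  symm := ⟨fun _ _ h => ⟨h.1.symm, h.2.2, h.2.1⟩⟩
  loopless := ⟨fun _ h => h.1.ne rfl⟩

theorem eraseColour_adj {G : SimpleGraph V} {K : Finset ℕ} {c : V → V → ℕ}
    (hc : IsEdgeColouring G K c) {i : ℕ} {x y : V} :
    (eraseColour G c i).Adj x y ↔ G.Adj x y ∧ c x y ≠ i := by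
  refine ⟨fun h => ⟨h.1, h.2.1⟩, fun h => ⟨h.1, h.2, ?_⟩⟩
  rw [← hc.symm x y h.1]; exact h.2

theorem IsEdgeColouring.eraseColour {G : SimpleGraph V} {K : Finset ℕ} {c : V → V → ℕ}
    (hc : IsEdgeColouring G K c) (i : ℕ) : IsEdgeColouring (eraseColour G c i) (K.erase i) c :=
  ⟨fun u v h => hc.symm u v h.1, fun u v h => Finset.mem_erase.2 ⟨h.2.1, hc.mem u v h.1⟩,
    fun u v w h h' => hc.inj u v w h.1 h'.1⟩

theorem degree_eraseColour_le {G : SimpleGraph V} {c : V → V → ℕ} {i : ℕ} (w : V) :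
    (_root_.eraseColour G c i).degree w ≤ G.degree w :=
  SimpleGraph.degree_le_of_le fun _ _ h => h.1

theorem degree_eraseColour_lt {G : SimpleGraph V} {K : Finset ℕ} {c : V → V → ℕ} {i : ℕ} (hi : i ∈ K) {w : V}
    (hw : i ∉ missingColours G K c w) :
    (_root_.eraseColour G c i).degree w + 1 ≤ G.degree w := by
  rw [mem_missingColours] at hw
  push Not at hw
  obtain ⟨x, hx, hcx⟩ := hw hi
  rw [← SimpleGraph.card_neighborFinset_eq_degree, ← SimpleGraph.card_neighborFinset_eq_degree]
  refine Finset.card_lt_card ((Finset.ssubset_iff_of_subset ?_).2 ⟨x, by simpa using hx, ?_⟩)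
  · intro y hy
    have : (_root_.eraseColour G c i).Adj w y := by simpa using hy
    simpa using this.1
  · intro h
    have : (_root_.eraseColour G c i).Adj w x := by simpa using h
    exact this.2.1 hcx

/-- There is a proper colouring together with disjointly reserved colours in which some colour is
reserved for exactly one vertex. -/
theorem exists_colour_reserved_once {G : SimpleGraph V} {K : Finset ℕ} {c : V → V → ℕ}
    (hc : IsEdgeColouring G K c) {N : Finset V} (hN : N.card ≤ K.card)
    (hdeg : ∀ w ∈ N, G.degree w + 1 ≤ K.card) {s : V} (hsN : s ∈ N)
    (hs : ∀ w ∈ N, w ≠ s → G.degree w + 2 ≤ K.card) :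
    ∃ c' F, IsEdgeColouring G K c' ∧ (∀ w ∈ N, F w ⊆ missingColours G K c' w) ∧
      (∀ w, (F w).card = if w = s then 1 else 2) ∧
      ∃ i ∈ K, (reservedFor N F i).card = 1 := by
  have hFex : ∀ w, ∃ F : Finset ℕ, (w ∈ N → F ⊆ missingColours G K c w) ∧
      F.card = if w = s then 1 else 2 := by
    intro w
    by_cases hw : w ∈ N
    · have h1 := card_missingColours hc w
      have h2 := hdeg w hw
      have h3 := hs w hw
      obtain ⟨F, hF, hFc⟩ := Finset.exists_subset_card_eq
        (s := missingColours G K c w) (n := if w = s then 1 else 2) (by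
          split_ifs with h
          · omega
          · have := h3 h; omega)
      exact ⟨F, fun _ => hF, hFc⟩
    · exact ⟨Finset.range (if w = s then 1 else 2), fun h => absurd h hw, by simp⟩
  choose F0 hF0 hF0c using hFex
  -- Among all colourings with reservations of these sizes, the one that minimises the sum of
  -- squares is taken: the most evenly spread one.
  let Good : ℕ → Prop := fun m => ∃ c' F, IsEdgeColouring G K c' ∧
    (∀ w ∈ N, F w ⊆ missingColours G K c' w) ∧ (∀ w, (F w).card = if w = s then 1 else 2) ∧
    ∑ l ∈ K, (reservedFor N F l).card ^ 2 = m
  have hex : ∃ m, Good m := ⟨_, c, F0, hc, fun w hw => hF0 w hw, hF0c, rfl⟩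
  obtain ⟨c', F, hc', hF, hFc, hm⟩ := Nat.find_spec hex
  refine ⟨c', F, hc', hF, hFc, ?_⟩
  by_contra! h1
  -- Total number of reservations: `2 |N| - 1`, because `s` reserves only one colour. It is odd and
  -- less than `2 |K|`, so if no colour is reserved exactly once, one is reserved by nobody and
  -- another at least three times, and an exchange contradicts minimality.
  have hsum : ∑ i ∈ K, (reservedFor N F i).card + 1 = 2 * N.card := by
    rw [sum_card_reservedFor fun w hw => (hF w hw).trans (Finset.filter_subset _ _),
      ← Finset.add_sum_erase N _ hsN, hFc s, if_pos rfl,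
      Finset.sum_congr rfl (g := fun _ => 2) (fun w hw => by
        rw [hFc w, if_neg (Finset.ne_of_mem_erase hw)])]
    have := Finset.card_erase_add_one hsN
    simp only [Finset.sum_const, smul_eq_mul]
    omega
  obtain ⟨⟨i, hi, hi0⟩, j, hj, hj3⟩ := exists_zero_and_three_le (K := K)
    (x := fun i => (reservedFor N F i).card) ⟨N.card - 1, by omega⟩ (by omega) h1
  obtain ⟨c2, F2, hc2, hF2, hF2c, hlt⟩ := kempe_decreases hc' hF hi hj hi0 hj3
  rw [hm] at hlt
  exact Nat.find_min hex hlt ⟨c2, F2, hc2, hF2, fun w => (hF2c w).trans (hFc w), rfl⟩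

/-- The extension lemma of Berge and Fournier: an edge colouring can be changed so that a new
vertex with the neighbours `N` can be added. -/
theorem exists_colouring_with_distinct_missing (k : ℕ) : ∀ (G : SimpleGraph V) (K : Finset ℕ)
    (c : V → V → ℕ) (N : Finset V) (s : V), K.card = k → IsEdgeColouring G K c → N.card ≤ K.card →
    (∀ w ∈ N, G.degree w + 1 ≤ K.card) → (∀ w ∈ N, w ≠ s → G.degree w + 2 ≤ K.card) →
    ∃ c' e, IsEdgeColouring G K c' ∧ Set.InjOn e N ∧ ∀ w ∈ N, e w ∈ missingColours G K c' w := by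
  induction k with
  | zero =>
    intro G K c N s hK hc hN _ _
    have : N = ∅ := Finset.card_eq_zero.1 (by omega)
    subst this
    exact ⟨c, fun _ => 0, hc, by simp, by simp⟩
  | succ k ih =>
    intro G K c N s hK hc hN hdeg hs
    rcases N.eq_empty_or_nonempty with rfl | ⟨s0, hs0⟩
    · exact ⟨c, fun _ => 0, hc, by simp, by simp⟩
    -- If the exceptional vertex is not in `N`, any vertex of `N` can take its role.
    obtain ⟨s, hsN, hs⟩ : ∃ s ∈ N, ∀ w ∈ N, w ≠ s → G.degree w + 2 ≤ K.card := by
      by_cases h : s ∈ N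
      · exact ⟨s, h, hs⟩
      · exact ⟨s0, hs0, fun w hw _ => hs w hw fun e => h (e ▸ hw)⟩
    obtain ⟨c, F, hc, hF, hFc, i, hi, hi1⟩ := exists_colour_reserved_once hc hN hdeg hsN hs
    obtain ⟨u, hu⟩ := Finset.card_eq_one.1 hi1
    have huN : u ∈ N ∧ i ∈ F u := by
      have : u ∈ reservedFor N F i := by simp [hu]
      simpa [reservedFor] using this
    have honly : ∀ w ∈ N, w ≠ u → i ∉ F w := by
      intro w hw hwu h
      have : w ∈ reservedFor N F i := by simp [reservedFor, hw, h]
      rw [hu, Finset.mem_singleton] at this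
      exact hwu this
    have hKc := Finset.card_erase_add_one hi
    -- The colour `i` goes to `u` and its class is deleted. A vertex `w ≠ u` can afford this: either
    -- `i` was missing at `w` but not among its reserved colours, so those are still available, or
    -- `w` loses an edge of colour `i`.
    have hmiss : ∀ w ∈ N, w ≠ u →
        (if w = s then 1 else 2) + (eraseColour G c i).degree w ≤ (K.erase i).card := by
      intro w hw hwu
      have hm := card_missingColours hc w
      by_cases hiw : i ∈ missingColours G K c w
      · have h1 : F w ⊆ (missingColours G K c w).erase i := fun l hl =>
          Finset.mem_erase.2 ⟨fun e => honly w hw hwu (e ▸ hl), hF w hw hl⟩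
        have h2 := Finset.card_le_card h1
        have h3 := Finset.card_erase_add_one hiw
        have h4 := degree_eraseColour_le (G := G) (c := c) (i := i) w
        rw [hFc w] at h2
        omega
      · have h4 := degree_eraseColour_lt hi hiw
        have h5 := hdeg w hw
        have h6 := hs w hw
        split_ifs with hws
        · omega
        · have := h6 hws; omega
    obtain ⟨c2, e2, hc2, he2, hm2⟩ := ih (eraseColour G c i) (K.erase i) c (N.erase u) s (by omega)
      (hc.eraseColour i) (by have := Finset.card_erase_add_one huN.1; omega)
      (fun w hw => by
        have := hmiss w (Finset.mem_of_mem_erase hw) (Finset.ne_of_mem_erase hw)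
        split_ifs at this <;> omega)
      (fun w hw hws => by
        have := hmiss w (Finset.mem_of_mem_erase hw) (Finset.ne_of_mem_erase hw)
        rw [if_neg hws] at this; omega)
    have hmem2 : ∀ x y, G.Adj x y → c x y ≠ i → c2 x y ∈ K ∧ c2 x y ≠ i := fun x y h h' =>
      (Finset.mem_erase.1 (hc2.mem x y ((eraseColour_adj hc).2 ⟨h, h'⟩))).symm
    -- The deleted class keeps the colour `i`, which the recolouring of the rest does not use.
    refine ⟨fun x y => if c x y = i then i else c2 x y, fun w => if w = u then i else e2 w,
      ⟨fun x y h => ?_, fun x y h => ?_, fun x y z hy hz h => ?_⟩, fun x hx y hy h => ?_,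
      fun w hw => ?_⟩
    · rw [hc.symm x y h]
      split_ifs with hcol
      · rfl
      · exact hc2.symm x y ((eraseColour_adj hc).2 ⟨h, by rwa [hc.symm x y h]⟩)
    · split_ifs with hcol
      · exact hi
      · exact (hmem2 x y h hcol).1
    · split_ifs at h with h1 h2 h2
      · exact hc.inj x y z hy hz (h1.trans h2.symm)
      · exact absurd h.symm (hmem2 x z hz h2).2
      · exact absurd h (hmem2 x y hy h1).2
      · exact hc2.inj x y z ((eraseColour_adj hc).2 ⟨hy, h1⟩) ((eraseColour_adj hc).2 ⟨hz, h2⟩) h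
    · have hne : ∀ w ∈ N, w ≠ u → e2 w ≠ i := fun w hw hwu =>
        Finset.ne_of_mem_erase
          (mem_missingColours.1 (hm2 w (Finset.mem_erase.2 ⟨hwu, hw⟩))).1
      dsimp only at h
      split_ifs at h with h1 h2 h2
      · exact h1.trans h2.symm
      · exact absurd h.symm (hne y hy h2)
      · exact absurd h (hne x hx h1)
      · exact he2 (by simp only [Finset.coe_erase]; exact ⟨hx, h1⟩)
          (by simp only [Finset.coe_erase]; exact ⟨hy, h2⟩) h
    · rw [mem_missingColours]
      dsimp only
      split_ifs with hwu
      · subst hwu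
        refine ⟨hi, fun x hx h => ?_⟩
        split_ifs at h with h1
        · exact (mem_missingColours.1 (hF w huN.1 huN.2)).2 x hx h1
        · exact (hmem2 w x hx h1).2 h
      · have := mem_missingColours.1 (hm2 w (Finset.mem_erase.2 ⟨hwu, hw⟩))
        refine ⟨Finset.mem_of_mem_erase this.1, fun x hx h => ?_⟩
        split_ifs at h with h1
        · exact Finset.ne_of_mem_erase this.1 h.symm
        · exact this.2 x ((eraseColour_adj hc).2 ⟨hx, h1⟩) h

/-- The edges of `G` inside `S`. -/
def edgesInside (G : SimpleGraph V) (S : Finset V) : SimpleGraph V where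
  Adj x y := G.Adj x y ∧ x ∈ S ∧ y ∈ S
  symm := ⟨fun _ _ h => ⟨h.1.symm, h.2.2, h.2.1⟩⟩
  loopless := ⟨fun _ h => h.1.ne rfl⟩

/-- Vizing's theorem. -/
theorem exists_edgeColouring_maxDegree_add_one (G : SimpleGraph V) {d : ℕ}
    (hd : ∀ v, G.degree v ≤ d) : ∃ c, IsEdgeColouring G (Finset.range (d + 1)) c := by
  suffices h : ∀ S : Finset V, ∃ c, IsEdgeColouring (edgesInside G S) (Finset.range (d + 1)) c by
    obtain ⟨c, hc⟩ := h Finset.univ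
    refine ⟨c, ?_⟩
    have : edgesInside G Finset.univ = G := by ext; simp [edgesInside]
    rwa [this] at hc
  intro S
  induction S using Finset.induction_on with
  | empty => exact ⟨fun _ _ => 0, fun _ _ h => by simp [edgesInside] at h,
      fun _ _ h => by simp [edgesInside] at h, fun _ _ _ h => by simp [edgesInside] at h⟩
  | insert v S hv ih =>
    obtain ⟨c, hc⟩ := ih
    set N := S.filter (G.Adj v) with hN
    -- The edge from `w` to the new vertex `v` is not inside `S`, so `w` has degree at most `d - 1`
    -- there and misses two of the `d + 1` colours. No vertex of `N` needs to be exceptional.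
    have hdeg : ∀ w ∈ N, (edgesInside G S).degree w + 2 ≤ (Finset.range (d + 1)).card := by
      intro w hw
      have hw' : w ∈ S ∧ G.Adj v w := by simpa [hN] using hw
      have : (edgesInside G S).degree w < G.degree w := by
        rw [← SimpleGraph.card_neighborFinset_eq_degree,
          ← SimpleGraph.card_neighborFinset_eq_degree]
        refine Finset.card_lt_card ((Finset.ssubset_iff_of_subset ?_).2
          ⟨v, by simpa using hw'.2.symm, ?_⟩)
        · intro y hy
          have : (edgesInside G S).Adj w y := by simpa using hy
          simpa using this.1
        · intro h
          have : (edgesInside G S).Adj w v := by simpa using h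
          exact hv this.2.2
      have := hd w
      simp only [Finset.card_range]
      omega
    have hNc : N.card ≤ (Finset.range (d + 1)).card := by
      have : N ⊆ G.neighborFinset v := fun w hw => by
        have hw' : w ∈ S ∧ G.Adj v w := by simpa [hN] using hw
        simpa using hw'.2
      have := Finset.card_le_card this
      rw [SimpleGraph.card_neighborFinset_eq_degree] at this
      have := hd v
      simp only [Finset.card_range]
      omega
    obtain ⟨c, e, hc, he, hm⟩ := exists_colouring_with_distinct_missing _ (edgesInside G S)
      (Finset.range (d + 1)) c N v rfl hc hNc (fun w hw => by have := hdeg w hw; omega)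
      (fun w hw _ => hdeg w hw)
    have hcase : ∀ x y, (edgesInside G (insert v S)).Adj x y →
        (x = v ∧ y ≠ v ∧ y ∈ N) ∨ (y = v ∧ x ≠ v ∧ x ∈ N) ∨
          (x ≠ v ∧ y ≠ v ∧ (edgesInside G S).Adj x y) := by
      intro x y ⟨h, hx, hy⟩
      rw [Finset.mem_insert] at hx hy
      have hne := h.ne
      rcases hx with rfl | hx <;> rcases hy with rfl | hy
      · exact absurd rfl hne
      · exact Or.inl ⟨rfl, hne.symm, by simp [hN, hy, h]⟩
      · exact Or.inr (Or.inl ⟨rfl, hne, by simp [hN, hx, h.symm]⟩)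
      · exact Or.inr (Or.inr ⟨fun e => hv (e ▸ hx), fun e => hv (e ▸ hy), h, hx, hy⟩)
    refine ⟨fun x y => if x = v then e y else if y = v then e x else c x y,
      fun x y h => ?_, fun x y h => ?_, fun x y z hy hz h => ?_⟩
    · rcases hcase x y h with ⟨rfl, h1, h2⟩ | ⟨rfl, h1, h2⟩ | ⟨h1, h2, h3⟩
      · simp [h1]
      · simp [h1]
      · simp [h1, h2, hc.symm x y h3]
    · rcases hcase x y h with ⟨rfl, h1, h2⟩ | ⟨rfl, h1, h2⟩ | ⟨h1, h2, h3⟩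
      · simpa using (mem_missingColours.1 (hm y h2)).1
      · simpa [h1] using (mem_missingColours.1 (hm x h2)).1
      · simpa [h1, h2] using hc.mem x y h3
    · rcases hcase x y hy with ⟨rfl, h1, h2⟩ | ⟨rfl, h1, h2⟩ | ⟨h1, h2, h3⟩ <;>
        rcases hcase x z hz with ⟨h1', h4, h5⟩ | ⟨h4', h4, h5⟩ | ⟨h4, h5, h6⟩
      · simp only [if_true] at h; exact he h2 h5 h
      · exact absurd rfl h4
      · exact absurd rfl h4
      · exact absurd h1' h1
      · exact h4'.symm
      · simp only [h1, h5, if_true, if_false] at h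
        exact absurd h.symm ((mem_missingColours.1 (hm x h2)).2 z h6)
      · exact absurd h1' h1
      · subst h4'
        simp only [h1, h2, if_true, if_false] at h
        exact absurd h ((mem_missingColours.1 (hm x h5)).2 y h3)
      · simp only [h1, h2, h5, if_false] at h
        exact hc.inj x y z h3 h6 h

end EdgeColouring

/-! ## The bounds of Log Partition -/

namespace PairwiseMRF

open scoped Classical

variable {n q : ℕ} (M : PairwiseMRF n q)

/-- The exponent restricted to the edges of `H`. -/
noncomputable def energyOn (H : SimpleGraph (Fin n)) (x : Fin n → Fin q) : ℝ :=
  (∑ v, (M.φ v (x v) : ℝ)) +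
    ∑ u, ∑ v, if u < v ∧ H.Adj u v then (M.ψ u v (x u) (x v) : ℝ) else 0

/-- Restricting an assignment to the connected components. -/
def assignmentEquiv (H : SimpleGraph (Fin n)) (α : Type*) :
    (Fin n → α) ≃ ((c : H.ConnectedComponent) → c.supp → α) where
  toFun x _ v := x v
  invFun y v := y (H.connectedComponentMk v) ⟨v, rfl⟩
  left_inv _ := rfl
  right_inv y := by
    funext c ⟨v, hv⟩
    obtain rfl : H.connectedComponentMk v = c := hv
    rfl

theorem sum_eq_sum_components (H : SimpleGraph (Fin n)) (f : Fin n → ℝ) :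
    ∑ v, f v = ∑ c : H.ConnectedComponent, ∑ v : c.supp, f v := by
  rw [← Fintype.sum_sigma']
  symm
  refine Fintype.sum_bijective (fun p : (c : H.ConnectedComponent) × c.supp => (p.2 : Fin n))
    ⟨?_, fun v => ⟨⟨H.connectedComponentMk v, ⟨v, rfl⟩⟩, rfl⟩⟩ _ _ fun _ => rfl
  rintro ⟨c, v, hv⟩ ⟨c', v', hv'⟩ h
  obtain rfl : H.connectedComponentMk v = c := hv
  obtain rfl : H.connectedComponentMk v' = c' := hv'
  obtain rfl : v = v' := h
  rfl

/-- No edge of `H` joins two components, so the exponent is a sum over components of terms that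
depend only on the restrictions. Expanding the product of sums then gives a sum over families of
restrictions, that is, over assignments. -/
theorem sum_exp_energyOn (H : SimpleGraph (Fin n)) :
    ∑ x, Real.exp (M.energyOn H x) = ∏ c : H.ConnectedComponent, M.ZOn H c.supp := by
  unfold ZOn
  rw [Finset.prod_univ_sum]
  refine Finset.sum_equiv (assignmentEquiv H (Fin q)) (by simp) fun x _ => ?_
  rw [← Real.exp_sum]
  congr 1
  rw [energyOn, Finset.sum_add_distrib, sum_eq_sum_components H (fun v => (M.φ v (x v) : ℝ)),
    sum_eq_sum_components H (fun u => ∑ v, if u < v ∧ H.Adj u v then (M.ψ u v (x u) (x v) : ℝ) else 0)]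
  congr 1
  · exact Finset.sum_congr rfl fun c _ =>
      Finset.sum_congr (Finset.ext fun _ => by simp) fun u _ => rfl
  refine Finset.sum_congr rfl fun c _ => Finset.sum_congr (Finset.ext fun _ => by simp) fun u _ => ?_
  symm
  have key := Fintype.sum_of_injective (fun v : c.supp => (v : Fin n)) Subtype.val_injective
    (fun v : c.supp => if u < v ∧ H.Adj u v then (M.ψ u v (x u) (x v) : ℝ) else 0)
    (fun v : Fin n => if (u : Fin n) < v ∧ H.Adj u v then (M.ψ u v (x u) (x v) : ℝ) else 0)
    (fun v hv => by
      rw [if_neg]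
      rintro ⟨-, h⟩
      exact hv ⟨⟨v, (c.mem_supp_congr_adj h).1 u.2⟩, rfl⟩) fun v => rfl
  rw [← key]
  exact Finset.sum_congr (Finset.ext fun _ => by simp) fun v _ => rfl

theorem energy_eq_energyOn_add (B : Set (Sym2 (Fin n))) (x : Fin n → Fin q) :
    M.energy x = M.energyOn (M.graph.deleteEdges B) x +
      ∑ u, ∑ v, if u < v ∧ M.graph.Adj u v ∧ s(u, v) ∈ B then (M.ψ u v (x u) (x v) : ℝ) else 0 := by
  rw [energy, energyOn, add_assoc]
  congr 1
  rw [← Finset.sum_add_distrib]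
  refine Finset.sum_congr rfl fun u _ => ?_
  rw [← Finset.sum_add_distrib]
  refine Finset.sum_congr rfl fun v _ => ?_
  simp only [SimpleGraph.deleteEdges_adj]
  by_cases h1 : u < v <;> by_cases h2 : M.graph.Adj u v <;> by_cases h3 : s(u, v) ∈ B <;>
    simp [h1, h2, h3]

theorem ψL_le (u v : Fin n) (a b : Fin q) : M.ψL u v ≤ M.ψ u v a b :=
  ciInf_le (f := fun p : Fin q × Fin q => (M.ψ u v p.1 p.2 : ℝ)) (Set.finite_range _).bddBelow (a, b)

theorem le_ψU (u v : Fin n) (a b : Fin q) : M.ψ u v a b ≤ M.ψU u v :=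
  le_ciSup (f := fun p : Fin q × Fin q => (M.ψ u v p.1 p.2 : ℝ)) (Set.finite_range _).bddAbove (a, b)

theorem ψL_nonneg (u v : Fin n) : 0 ≤ M.ψL u v := Real.iInf_nonneg fun _ => NNReal.coe_nonneg _

theorem ψL_le_ψU (hq : 0 < q) (u v : Fin n) : M.ψL u v ≤ M.ψU u v :=
  (M.ψL_le u v ⟨0, hq⟩ ⟨0, hq⟩).trans (M.le_ψU u v ⟨0, hq⟩ ⟨0, hq⟩)

theorem ZOn_pos (hq : 0 < q) (H : SimpleGraph (Fin n)) (S : Set (Fin n)) : 0 < M.ZOn H S := by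
  have : Nonempty (Fin q) := ⟨⟨0, hq⟩⟩
  exact Finset.sum_pos (fun _ _ => Real.exp_pos _) Finset.univ_nonempty

theorem exp_sumLogZ (hq : 0 < q) (B : Set (Sym2 (Fin n))) :
    Real.exp (M.sumLogZ B) = ∑ x, Real.exp (M.energyOn (M.graph.deleteEdges B) x) := by
  rw [sumLogZ, Real.exp_sum, sum_exp_energyOn]
  exact Finset.prod_congr (Finset.ext fun _ => by simp) fun c _ => Real.exp_log (M.ZOn_pos hq _ _)

theorem Z_pos (hq : 0 < q) : 0 < M.Z := by
  have : Nonempty (Fin q) := ⟨⟨0, hq⟩⟩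
  exact Finset.sum_pos (fun _ _ => Real.exp_pos _) Finset.univ_nonempty

/-- After exponentiation the comparison holds for each assignment separately: the removed edges
contribute at least their `ψL`. -/
theorem logLB_le_log_Z (hq : 0 < q) {B : Set (Sym2 (Fin n))} (hB : B ⊆ M.graph.edgeSet) :
    M.logLB B ≤ Real.log M.Z := by
  rw [Real.le_log_iff_exp_le (M.Z_pos hq), logLB, Real.exp_add, M.exp_sumLogZ hq, Finset.sum_mul, Z]
  refine Finset.sum_le_sum fun x _ => ?_
  rw [← Real.exp_add, Real.exp_le_exp, M.energy_eq_energyOn_add B]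
  gcongr with u _ v _
  by_cases h : u < v ∧ s(u, v) ∈ B
  · have : M.graph.Adj u v := hB h.2
    simpa [h, this] using M.ψL_le u v (x u) (x v)
  · rw [if_neg h, if_neg fun h' => h ⟨h'.1, h'.2.2⟩]

theorem log_Z_le_logUB (hq : 0 < q) {B : Set (Sym2 (Fin n))} (hB : B ⊆ M.graph.edgeSet) :
    Real.log M.Z ≤ M.logUB B := by
  rw [Real.log_le_iff_le_exp (M.Z_pos hq), logUB, Real.exp_add, M.exp_sumLogZ hq, Finset.sum_mul, Z]
  refine Finset.sum_le_sum fun x _ => ?_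
  rw [← Real.exp_add, Real.exp_le_exp, M.energy_eq_energyOn_add B]
  gcongr with u _ v _
  by_cases h : u < v ∧ s(u, v) ∈ B
  · have : M.graph.Adj u v := hB h.2
    simpa [h, this] using M.le_ψU u v (x u) (x v)
  · rw [if_neg h, if_neg fun h' => h ⟨h'.1, h'.2.2⟩]

theorem energy_le_log_Z (x : Fin n → Fin q) : M.energy x ≤ Real.log M.Z := by
  have h : Real.exp (M.energy x) ≤ M.Z :=
    Finset.single_le_sum (f := fun x => Real.exp (M.energy x))
      (fun _ _ => (Real.exp_pos _).le) (Finset.mem_univ x)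
  rwa [Real.le_log_iff_exp_le ((Real.exp_pos _).trans_le h)]

/-- A colour class is a matching, so the maximising pairs of labels of its edges can be chosen
simultaneously. The resulting assignment has energy at least the sum of these maxima, since all
other potentials are nonnegative. -/
theorem sum_ψU_colourClass_le (hq : 0 < q) {K : Finset ℕ} {c : Fin n → Fin n → ℕ}
    (hc : IsEdgeColouring M.graph K c) (i : ℕ) :
    (∑ u, ∑ v, if u < v ∧ M.graph.Adj u v ∧ c u v = i then M.ψU u v else 0) ≤ Real.log M.Z := by
  have : Nonempty (Fin q × Fin q) := ⟨(⟨0, hq⟩, ⟨0, hq⟩)⟩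
  have hmax : ∀ u v, ∃ p : Fin q × Fin q, (M.ψ u v p.1 p.2 : ℝ) = M.ψU u v := fun u v =>
    exists_eq_ciSup_of_finite (f := fun p : Fin q × Fin q => (M.ψ u v p.1 p.2 : ℝ))
  choose p hp using hmax
  -- Each vertex takes its half of the maximising pair of its edge of colour `i`. The pair is
  -- ordered by the smaller endpoint, hence the case distinction.
  let x : Fin n → Fin q := fun w =>
    if h : ∃ y, M.graph.Adj w y ∧ c w y = i then
      if w < h.choose then (p w h.choose).1 else (p h.choose w).2
    else ⟨0, hq⟩
  have hx : ∀ w y, M.graph.Adj w y → c w y = i →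
      x w = if w < y then (p w y).1 else (p y w).2 := by
    intro w y h1 h2
    have h : ∃ y, M.graph.Adj w y ∧ c w y = i := ⟨y, h1, h2⟩
    have e : h.choose = y := hc.inj w _ _ h.choose_spec.1 h1 (h.choose_spec.2.trans h2.symm)
    simp only [x, dif_pos h, e]
  refine le_trans ?_ (M.energy_le_log_Z x)
  unfold energy
  refine le_add_of_nonneg_of_le (Finset.sum_nonneg fun _ _ => NNReal.coe_nonneg _) ?_
  refine Finset.sum_le_sum fun u _ => Finset.sum_le_sum fun v _ => ?_
  by_cases h : u < v ∧ M.graph.Adj u v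
  · by_cases hcol : c u v = i
    · have e1 := hx u v h.2 hcol
      have e2 := hx v u h.2.symm ((hc.symm u v h.2) ▸ hcol)
      rw [if_pos h.1] at e1
      rw [if_neg h.1.not_gt] at e2
      simp [h, hcol, e1, e2, hp]
    · simp only [h, hcol, and_false, if_false, and_self, if_true]
      exact NNReal.coe_nonneg _
  · rw [if_neg h, if_neg fun h' => h ⟨h'.1, h'.2.1⟩]

/-- Split the edges into `d* + 1` matchings by Vizing's theorem and use `ψU - ψL ≤ ψU`. -/
theorem sum_gap_le (hq : 0 < q) :
    (∑ u, ∑ v, if u < v ∧ M.graph.Adj u v then M.ψU u v - M.ψL u v else 0) ≤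
      (M.maxDeg + 1) * Real.log M.Z := by
  obtain ⟨c, hc⟩ := exists_edgeColouring_maxDegree_add_one M.graph (d := M.maxDeg)
    fun v => M.graph.degree_le_maxDegree v
  calc _ ≤ ∑ u, ∑ v, ∑ i ∈ Finset.range (M.maxDeg + 1),
        (if u < v ∧ M.graph.Adj u v ∧ c u v = i then M.ψU u v else 0) := by
        refine Finset.sum_le_sum fun u _ => Finset.sum_le_sum fun v _ => ?_
        by_cases h : u < v ∧ M.graph.Adj u v
        · have := hc.mem u v h.2
          simp only [h, true_and, and_self, if_true, Finset.sum_ite_eq, this]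
          linarith [M.ψL_nonneg u v]
        · rw [if_neg h]
          refine Finset.sum_nonneg fun i _ => ?_
          rw [if_neg fun h' => h ⟨h'.1, h'.2.1⟩]
    _ = ∑ i ∈ Finset.range (M.maxDeg + 1), ∑ u, ∑ v,
        (if u < v ∧ M.graph.Adj u v ∧ c u v = i then M.ψU u v else 0) := by
        rw [Finset.sum_comm]
        refine (Finset.sum_congr rfl fun u _ => Finset.sum_comm).trans ?_
        rw [Finset.sum_comm]
        refine Finset.sum_congr rfl fun i _ => ?_
        rw [Finset.sum_comm]
    _ ≤ ∑ i ∈ Finset.range (M.maxDeg + 1), Real.log M.Z :=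
        Finset.sum_le_sum fun i _ => M.sum_ψU_colourClass_le hq hc i
    _ = _ := by simp

end PairwiseMRF

/-! ## The probability that an edge is selected -/

/-- Since `L < Λ`, the levels `L, Λ + L, …` are exactly those with residue `L`. The component of an
edge can be read off at either endpoint. -/
theorem mem_cutEdges {V : Type*} {Λ : ℕ} {H : SimpleGraph V} {root : H.ConnectedComponent → V}
    {L : V → ℕ} (hL : ∀ v, L v < Λ) {u v : V} :
    s(u, v) ∈ cutEdges Λ H root L ↔ H.Adj u v ∧
      min (H.dist (root (H.connectedComponentMk u)) u) (H.dist (root (H.connectedComponentMk u)) v) % Λ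
        = L (root (H.connectedComponentMk u)) := by
  have key : ∀ u v, H.Adj u v → H.connectedComponentMk u = H.connectedComponentMk v := fun u v h =>
    SimpleGraph.ConnectedComponent.eq.2 h.reachable
  constructor
  · rintro ⟨c, k, u', v', he, hadj, rfl, hmin⟩
    have hmod : (k * Λ + L (root (H.connectedComponentMk u'))) % Λ
        = L (root (H.connectedComponentMk u')) := by
      rw [Nat.mul_add_mod_self_right, Nat.mod_eq_of_lt (hL _)]
    rw [Sym2.eq_iff] at he
    rcases he with ⟨rfl, rfl⟩ | ⟨rfl, rfl⟩
    · exact ⟨hadj, by rw [hmin, hmod]⟩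
    · refine ⟨hadj.symm, ?_⟩
      rw [← key _ _ hadj, min_comm, hmin, hmod]
  · rintro ⟨hadj, hmod⟩
    refine ⟨H.connectedComponentMk u,
      min (H.dist (root (H.connectedComponentMk u)) u) (H.dist (root (H.connectedComponentMk u)) v) / Λ,
      u, v, rfl, hadj, rfl, ?_⟩
    rw [← hmod]
    exact (Nat.div_add_mod' _ Λ).symm

theorem cutEdges_subset {V : Type*} {Λ : ℕ} {H : SimpleGraph V} {root : H.ConnectedComponent → V}
    {L : V → ℕ} : cutEdges Λ H root L ⊆ H.edgeSet := by
  rintro e ⟨c, k, u, v, rfl, hadj, -⟩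
  exact hadj

theorem minorEIter_subset {V : Type*} {G : SimpleGraph V} {Λ : ℕ} {root : RootRule V}
    {L : ℕ → V → ℕ} (i : ℕ) : minorEIter G Λ root L i ⊆ G.edgeSet := by
  induction i with
  | zero => simp [minorEIter]
  | succ i ih =>
    refine Set.union_subset ih (cutEdges_subset.trans ?_)
    exact SimpleGraph.edgeSet_subset_edgeSet.2 (SimpleGraph.deleteEdges_le _)

/-- The graph at the beginning of iteration `i` depends only on earlier draws. This is what makes
the numbers drawn in iteration `i` independent of it. -/
theorem minorEIter_congr {V : Type*} {G : SimpleGraph V} {Λ : ℕ} {root : RootRule V}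
    {L L' : ℕ → V → ℕ} (i : ℕ) (h : ∀ j < i, L j = L' j) :
    minorEIter G Λ root L i = minorEIter G Λ root L' i := by
  induction i with
  | zero => rfl
  | succ i ih =>
    rw [minorEIter, minorEIter, ih fun j hj => h j (by omega), h i (by omega)]

/-- The numbers drawn, as a function on all natural numbers. -/
def extendDraws {n r Λ : ℕ} (L : Draws n r Λ) : ℕ → Fin n → ℕ :=
  fun i v => if h : i < r then (L ⟨i, h⟩ v : ℕ) else 0

theorem minorE_eq {n r Λ : ℕ} (G : SimpleGraph (Fin n)) (root : RootRule (Fin n))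
    (L : Draws n r Λ) : minorE G r Λ root L = minorEIter G Λ root (extendDraws L) r := rfl

theorem extendDraws_lt {n r Λ : ℕ} (hΛ : 0 < Λ) (L : Draws n r Λ) (i : ℕ) (v : Fin n) :
    extendDraws L i v < Λ := by
  unfold extendDraws
  split_ifs
  · exact Fin.is_lt _
  · exact hΛ

section Probability

open scoped Classical

variable {n r Λ : ℕ}

/-- The graph at the beginning of iteration `i`. -/
def iterGraph (G : SimpleGraph (Fin n)) (root : RootRule (Fin n)) (L : Draws n r Λ) (i : ℕ) :
    SimpleGraph (Fin n) :=
  G.deleteEdges (minorEIter G Λ root (extendDraws L) i)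

/-- The draws for which the edge `uv` is selected in iteration `i`. -/
noncomputable def selectingDraws (G : SimpleGraph (Fin n)) (root : RootRule (Fin n)) (u v : Fin n)
    (i : Fin r) : Finset (Draws n r Λ) :=
  Finset.univ.filter fun L => s(u, v) ∈ cutEdges Λ (iterGraph G root L i)
    (root i (iterGraph G root L i)) (extendDraws L i)

/-- The probability of selection in iteration `i` is at most `1/Λ`. In counting form: overwriting,
in a selecting outcome, the number drawn at the root by an arbitrary one is injective. The current
graph and root do not notice the change, and the old number is recovered as the level of the edge
modulo `Λ`. -/
theorem card_selectingDraws_mul_le (hΛ : 0 < Λ) (G : SimpleGraph (Fin n)) (root : RootRule (Fin n))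
    (u v : Fin n) (i : Fin r) :
    (selectingDraws (Λ := Λ) G root u v i).card * Λ ≤ Fintype.card (Draws n r Λ) := by
  let ρ : Draws n r Λ → Fin n := fun L =>
    root i (iterGraph G root L i) ((iterGraph G root L i).connectedComponentMk u)
  let upd : Draws n r Λ × Fin Λ → Draws n r Λ := fun p =>
    Function.update p.1 i (Function.update (p.1 i) (ρ p.1) p.2)
  have hgraph : ∀ p, iterGraph G root (upd p) i = iterGraph G root p.1 i := by
    intro p
    unfold iterGraph
    rw [minorEIter_congr]
    intro j hj
    funext w
    unfold extendDraws
    split_ifs with h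
    · have : (⟨j, h⟩ : Fin r) ≠ i := fun e => by rw [← e] at hj; exact lt_irrefl _ hj
      simp only [upd, Function.update_of_ne this]
    · rfl
  have hρ : ∀ p, ρ (upd p) = ρ p.1 := fun p =>
    congrArg (fun H => root i H (H.connectedComponentMk u)) (hgraph p)
  have hcard : (selectingDraws (Λ := Λ) G root u v i).card * Λ =
      ((selectingDraws (Λ := Λ) G root u v i) ×ˢ (Finset.univ : Finset (Fin Λ))).card := by
    rw [Finset.card_product, Finset.card_univ, Fintype.card_fin]
  rw [hcard, ← Finset.card_univ]
  refine Finset.card_le_card_of_injOn upd (fun _ _ => Finset.mem_coe.2 (Finset.mem_univ _)) ?_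
  rintro ⟨L, a⟩ hL ⟨L', a'⟩ hL' h
  have hL : L ∈ selectingDraws (Λ := Λ) G root u v i := by simpa using hL
  have hL' : L' ∈ selectingDraws (Λ := Λ) G root u v i := by simpa using hL'
  have hg : iterGraph G root L i = iterGraph G root L' i := by
    rw [← hgraph (L, a), ← hgraph (L', a'), h]
  have hρ' : ρ L = ρ L' :=
    congrArg (fun H => root i H (H.connectedComponentMk u)) hg
  have ha : a = a' := by
    have := congrFun (congrFun h i) (ρ L)
    simp only [upd, Function.update_self] at this
    rwa [hρ', Function.update_self] at this
  have hval : ∀ L ∈ selectingDraws (Λ := Λ) G root u v i, (L i (ρ L) : ℕ) =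
      min ((iterGraph G root L i).dist (ρ L) u) ((iterGraph G root L i).dist (ρ L) v) % Λ := by
    intro L hL
    have := ((mem_cutEdges (extendDraws_lt hΛ L i)).1 (Finset.mem_filter.1 hL).2).2
    rw [this]
    simp [extendDraws, ρ]
  have hcoin : L i (ρ L) = L' i (ρ L') := by
    refine Fin.ext ?_
    rw [hval L hL, hval L' hL', hg, hρ']
  have hLL : L = L' := by
    funext j w
    have hj := congrFun (congrFun h j) w
    by_cases hji : j = i
    · subst hji
      by_cases hw : w = ρ L
      · rw [hw, hcoin, hρ']
      · have hw' : w ≠ ρ L' := hρ' ▸ hw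
        simpa [upd, hw, hw'] using hj
    · simpa [upd, hji] using hj
  rw [hLL, ha]

theorem exists_selecting_iteration (G : SimpleGraph (Fin n)) (root : RootRule (Fin n))
    (L : Draws n r Λ) (e : Sym2 (Fin n)) (k : ℕ)
    (h : e ∈ minorEIter G Λ root (extendDraws L) k) :
    ∃ i < k, e ∈ cutEdges Λ (iterGraph G root L i) (root i (iterGraph G root L i))
      (extendDraws L i) := by
  induction k with
  | zero => simp [minorEIter] at h
  | succ k ih =>
    rcases h with h | h
    · obtain ⟨i, hi, h⟩ := ih h
      exact ⟨i, by omega, h⟩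
    · exact ⟨k, by omega, h⟩

/-- A union bound over the `r` iterations. -/
theorem card_draws_removing_mul_le (hΛ : 0 < Λ) (G : SimpleGraph (Fin n)) (root : RootRule (Fin n))
    (u v : Fin n) :
    (Finset.univ.filter fun L : Draws n r Λ => s(u, v) ∈ minorE G r Λ root L).card * Λ ≤
      r * Fintype.card (Draws n r Λ) := by
  have hsub : (Finset.univ.filter fun L : Draws n r Λ => s(u, v) ∈ minorE G r Λ root L) ⊆
      Finset.univ.biUnion fun i : Fin r => selectingDraws (Λ := Λ) G root u v i := by
    intro L hL
    obtain ⟨i, hi, h⟩ := exists_selecting_iteration G root L _ r (Finset.mem_filter.1 hL).2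
    simp only [Finset.mem_biUnion, Finset.mem_univ, true_and]
    exact ⟨⟨i, hi⟩, by simpa [selectingDraws] using h⟩
  calc _ ≤ (∑ i : Fin r, (selectingDraws (Λ := Λ) G root u v i).card) * Λ :=
        Nat.mul_le_mul_right _ ((Finset.card_le_card hsub).trans Finset.card_biUnion_le)
    _ = ∑ i : Fin r, (selectingDraws (Λ := Λ) G root u v i).card * Λ := Finset.sum_mul ..
    _ ≤ ∑ _i : Fin r, Fintype.card (Draws n r Λ) :=
        Finset.sum_le_sum fun i _ => card_selectingDraws_mul_le hΛ G root u v i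
    _ = _ := by simp

end Probability

/-- The graph `K_{0,0}` has no vertices and is a minor of every graph. -/
theorem r_pos_of_excludesKrr {V : Type*} {r : ℕ} {G : SimpleGraph V} (h : ExcludesKrr r G) :
    0 < r := by
  rcases Nat.eq_zero_or_pos r with rfl | h0
  · refine absurd ⟨fun _ => ∅, fun w => ?_, fun w => ?_, fun w => ?_⟩ h <;>
      exact (w.elim Fin.elim0 Fin.elim0)
  · exact h0

theorem levelParam_pos {n q r : ℕ} (M : PairwiseMRF n q) {ε : ℝ} (hr : 0 < r) (hε : 0 < ε) :
    0 < levelParam M r ε :=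
  Nat.ceil_pos.2 (by positivity)

/-- By linearity the expected gap is at most `r/Λ` times the total of `ψU - ψL` over all edges, thus
at most `r (d* + 1) / Λ` times `log Z`. The choice of `Λ` makes this factor at most `ε`. -/
theorem expect_gap_le {n q r : ℕ} (M : PairwiseMRF n q) (ε : ℝ) (root : RootRule (Fin n))
    (hq : 0 < q) (hε : 0 < ε) (hr : 0 < r) :
    (𝔼 L : Draws n r (levelParam M r ε),
      (M.logUB (minorE M.graph r (levelParam M r ε) root L) -
        M.logLB (minorE M.graph r (levelParam M r ε) root L))) ≤ ε * Real.log M.Z := by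
  classical
  set Λ := levelParam M r ε with hΛ
  have hΛ0 : 0 < Λ := levelParam_pos M hr hε
  have hΛR : (0 : ℝ) < Λ := by exact_mod_cast hΛ0
  set N : ℝ := (Fintype.card (Draws n r Λ) : ℝ) with hN
  have hNpos : 0 < N := by
    have : Nonempty (Draws n r Λ) := ⟨fun _ _ => ⟨0, hΛ0⟩⟩
    rw [hN]; exact_mod_cast Fintype.card_pos
  set w : Fin n → Fin n → ℝ := fun u v => M.ψU u v - M.ψL u v with hw
  have hw0 : ∀ u v, 0 ≤ w u v := fun u v => sub_nonneg.2 (M.ψL_le_ψU hq u v)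
  have hgap : ∀ B, M.logUB B - M.logLB B =
      ∑ u, ∑ v, if u < v ∧ s(u, v) ∈ B then w u v else 0 := by
    intro B
    rw [PairwiseMRF.logUB, PairwiseMRF.logLB, add_sub_add_left_eq_sub, ← Finset.sum_sub_distrib]
    refine Finset.sum_congr rfl fun u _ => ?_
    rw [← Finset.sum_sub_distrib]
    refine Finset.sum_congr rfl fun v _ => ?_
    split_ifs <;> simp [hw]
  simp_rw [hgap]
  rw [Fintype.expect_eq_sum_div_card, ← hN, div_le_iff₀ hNpos, Finset.sum_comm]
  have hterm : ∀ u v, ∑ L : Draws n r Λ,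
      (if u < v ∧ s(u, v) ∈ minorE M.graph r Λ root L then w u v else 0) ≤
        (r / Λ * N) * (if u < v ∧ M.graph.Adj u v then w u v else 0) := by
    intro u v
    by_cases h : u < v ∧ M.graph.Adj u v
    · rw [if_pos h]
      simp only [h.1, true_and]
      rw [← Finset.sum_filter, Finset.sum_const, nsmul_eq_mul]
      refine mul_le_mul_of_nonneg_right ?_ (hw0 u v)
      rw [div_mul_eq_mul_div, le_div_iff₀ hΛR]
      rw [hN]
      exact_mod_cast card_draws_removing_mul_le (r := r) hΛ0 M.graph root u v
    · rw [if_neg h, mul_zero]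
      refine (Finset.sum_eq_zero fun L _ => if_neg ?_).le
      rintro ⟨h1, h2⟩
      exact h ⟨h1, minorEIter_subset r h2⟩
  calc _ = ∑ u, ∑ v, ∑ L : Draws n r Λ,
        (if u < v ∧ s(u, v) ∈ minorE M.graph r Λ root L then w u v else 0) :=
        Finset.sum_congr rfl fun u _ => Finset.sum_comm
    _ ≤ ∑ u, ∑ v, (r / Λ * N) * (if u < v ∧ M.graph.Adj u v then w u v else 0) :=
        Finset.sum_le_sum fun u _ => Finset.sum_le_sum fun v _ => hterm u v
    _ = (r / Λ * N) * ∑ u, ∑ v, (if u < v ∧ M.graph.Adj u v then w u v else 0) := by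
        simp_rw [Finset.mul_sum]
    _ ≤ (r / Λ * N) * ((M.maxDeg + 1) * Real.log M.Z) :=
        mul_le_mul_of_nonneg_left (M.sum_gap_le hq) (by positivity)
    _ ≤ _ := ?_
  have hlog : 0 ≤ Real.log M.Z := by
    have h0 : (0 : ℝ) ≤ ∑ u, ∑ v, (if u < v ∧ M.graph.Adj u v then w u v else 0) :=
      Finset.sum_nonneg fun u _ => Finset.sum_nonneg fun v _ => by
        split_ifs; exacts [hw0 u v, le_rfl]
    exact nonneg_of_mul_nonneg_right (h0.trans (M.sum_gap_le hq)) (by positivity)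
  have hle : (r : ℝ) * (M.maxDeg + 1) ≤ ε * Λ := by
    have := Nat.le_ceil ((r : ℝ) * ((M.maxDeg : ℝ) + 1) / ε)
    rwa [div_le_iff₀ hε, mul_comm (_ : ℝ) ε] at this
  calc _ = (r * (M.maxDeg + 1)) / Λ * (Real.log M.Z * N) := by ring
    _ ≤ ε * (Real.log M.Z * N) := by
        refine mul_le_mul_of_nonneg_right ?_ (by positivity)
        rwa [div_le_iff₀ hΛR]
    _ = _ := by ring

/-! ## Components after `r` iterations have small diameter -/

section Geometry

variable {V : Type*}

/-- Along a shortest walk the position equals the distance from the start: the initial part bounds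
it from above, and the final part with the triangle inequality from below. -/
theorem exists_geodesic (H : SimpleGraph V) {ρ s : V} (h : H.Reachable ρ s) :
    ∃ g : ℕ → V, g 0 = ρ ∧ g (H.dist ρ s) = s ∧
      (∀ e < H.dist ρ s, H.Adj (g e) (g (e + 1))) ∧
      ∀ e ≤ H.dist ρ s, H.Reachable ρ (g e) ∧ H.dist ρ (g e) = e := by
  obtain ⟨w, hw⟩ := h.exists_walk_length_eq_dist
  have hadj : ∀ e < H.dist ρ s, H.Adj (w.getVert e) (w.getVert (e + 1)) := fun e he =>
    w.adj_getVert_succ (by omega)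
  refine ⟨w.getVert, by simp, by rw [← hw]; simp, hadj, fun e he => ?_⟩
  have h1 : H.dist ρ (w.getVert e) ≤ e := by
    have := SimpleGraph.dist_le (w.take e)
    rwa [SimpleGraph.Walk.take_length, min_eq_left (by omega)] at this
  have h2 : H.dist (w.getVert e) s ≤ H.dist ρ s - e := by
    have := SimpleGraph.dist_le (w.drop e)
    rwa [SimpleGraph.Walk.drop_length, hw] at this
  have hr : H.Reachable ρ (w.getVert e) := ⟨w.take e⟩
  have h3 := hr.dist_triangle_left s
  exact ⟨hr, by omega⟩

theorem connected_image_Icc {G : SimpleGraph V} {g : ℕ → V} {a b : ℕ} (hab : a ≤ b)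
    (h : ∀ e, a ≤ e → e < b → G.Adj (g e) (g (e + 1))) :
    (G.induce (g '' Set.Icc a b)).Connected := by
  induction b, hab using Nat.le_induction with
  | base =>
    rw [Set.Icc_self, Set.image_singleton]
    simp
  | succ b hab ih =>
    have e : g '' Set.Icc a (b + 1) = (g '' Set.Icc a b) ∪ {g b, g (b + 1)} := by
      ext z
      simp only [Set.mem_image, Set.mem_Icc, Set.mem_union, Set.mem_insert_iff,
        Set.mem_singleton_iff]
      constructor
      · rintro ⟨x, hx, rfl⟩
        rcases Nat.lt_or_ge b x with hbx | hbx
        · exact Or.inr (Or.inr (by rw [show x = b + 1 by omega]))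
        · exact Or.inl ⟨x, ⟨hx.1, hbx⟩, rfl⟩
      · rintro (⟨x, hx, rfl⟩ | rfl | rfl)
        · exact ⟨x, ⟨hx.1, by omega⟩, rfl⟩
        · exact ⟨b, ⟨hab, by omega⟩, rfl⟩
        · exact ⟨b + 1, ⟨by omega, le_rfl⟩, rfl⟩
    rw [e]
    refine SimpleGraph.induce_union_connected (ih fun e h1 h2 => h e h1 (by omega)).preconnected
      (SimpleGraph.induce_pair_connected_of_adj (h b hab (by omega))).preconnected ?_
    exact ⟨g b, ⟨b, ⟨hab, le_rfl⟩, rfl⟩, by simp⟩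

/-- A discrete intermediate value theorem: along a walk in the subgraph `H` the distance in `G` from
`x` grows by at most one per edge, so it skips no value. -/
theorem exists_reachable_dist_eq {G H : SimpleGraph V} (hle : H ≤ G) {x y : V}
    (h : H.Reachable x y) {t : ℕ} (ht : t ≤ G.dist x y) :
    ∃ z, H.Reachable x z ∧ G.dist x z = t := by
  rw [SimpleGraph.reachable_iff_reflTransGen] at h
  induction h with
  | refl => exact ⟨x, .rfl, by simp at ht ⊢; omega⟩
  | @tail b c hb hbc ih =>
    by_cases htb : t ≤ G.dist x b
    · exact ih htb
    · have hxb : H.Reachable x b := (SimpleGraph.reachable_iff_reflTransGen _ _).2 hb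
      have h1 := (hxb.mono hle).dist_triangle_left c
      rw [SimpleGraph.dist_eq_one_iff_adj.2 (hle hbc)] at h1
      exact ⟨c, hxb.trans hbc.reachable, by omega⟩

/-- A decreasing sequence of graphs in which the component of `x` at stage `i + 1` lies in a band of
`Λ` levels of a breadth-first search at stage `i`, and keeps all edges between consecutive levels
of the band. -/
structure BandChain (H : ℕ → SimpleGraph V) (r Λ : ℕ) (x : V) (ρ : ℕ → V) (ℓ : ℕ → ℕ) : Prop where
  mono : ∀ i < r, H (i + 1) ≤ H i
  root : ∀ i < r, (H i).Reachable x (ρ i)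
  le_dist : ∀ i < r, ∀ y, (H (i + 1)).Reachable x y → ℓ i ≤ (H i).dist (ρ i) y
  dist_lt : ∀ i < r, ∀ y, (H (i + 1)).Reachable x y → (H i).dist (ρ i) y < ℓ i + Λ
  keep : ∀ i < r, ∀ u v, (H (i + 1)).Reachable x v → (H i).Adj u v →
    (H i).dist (ρ i) v = (H i).dist (ρ i) u + 1 → ℓ i < (H i).dist (ρ i) v → (H (i + 1)).Adj u v

namespace BandChain

variable {H : ℕ → SimpleGraph V} {r Λ : ℕ} {x : V} {ρ : ℕ → V} {ℓ : ℕ → ℕ}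

theorem le_zero (h : BandChain H r Λ x ρ ℓ) {i : ℕ} (hi : i ≤ r) : H i ≤ H 0 := by
  induction i with
  | zero => exact le_rfl
  | succ i ih => exact (h.mono i (by omega)).trans (ih (by omega))

theorem le_of_le (h : BandChain H r Λ x ρ ℓ) {i j : ℕ} (hij : i ≤ j) (hj : j ≤ r) : H j ≤ H i := by
  induction j, hij using Nat.le_induction with
  | base => exact le_rfl
  | succ j hij ih => exact (h.mono j (by omega)).trans (ih (by omega))

/-- The partial minor model built from the stages `i, …, r - 1`. -/
structure Model (H : ℕ → SimpleGraph V) (r Λ : ℕ) (x : V) (v : Fin r → V) (i : ℕ)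
    (A : Fin r → Set V) (s : Fin r → V) (B : ℕ → Set V) : Prop where
  A_sub : ∀ j, ∀ z ∈ A j, (H i).Reachable x z
  s_mem : ∀ j, s j ∈ A j
  A_conn : ∀ j, ((H 0).induce (A j)).Connected
  A_dist : ∀ j, ∀ z ∈ A j, (H 0).dist (v j) z ≤ (r - i) * (3 * Λ)
  B_sub : ∀ m, i ≤ m → m < r → ∀ z ∈ B m, (H i).Reachable x z
  B_conn : ∀ m, i ≤ m → m < r → ((H 0).induce (B m)).Connected
  AB_disj : ∀ j m, i ≤ m → m < r → Disjoint (A j) (B m)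
  BB_disj : ∀ m m', i ≤ m → m < r → i ≤ m' → m' < r → m ≠ m' → Disjoint (B m) (B m')
  AB_adj : ∀ j m, i ≤ m → m < r → ∃ a ∈ A j, ∃ b ∈ B m, (H 0).Adj a b
  far : ∀ j m, i ≤ m → m < r → ∀ z ∈ B m, Λ < (H i).dist (s j) z

/-- The new branch set `B i` consists of the parts near `ρ i` of geodesics of `H i` from `ρ i` to
the points `s j`; the remaining parts extend the sets `A j`. The extension avoids a later `B m`:
below the band it has smaller level than `B m`, and inside the band it is a path of `H (i + 1)` of
length less than `Λ` from `s j` (by `keep`), while `far` puts `B m` at distance more than `Λ`. The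
new points `s j` are chosen midway between level `a` and the band, to restore `far`. -/
theorem model_step (h : BandChain H r Λ x ρ ℓ) {v : Fin r → V} {i : ℕ} (hi : i < r)
    (hv : ∀ j, (H r).Reachable x (v j))
    (hℓ : 2 * Λ + 2 ≤ ℓ i) {A : Fin r → Set V} {s : Fin r → V} {B : ℕ → Set V}
    (hM : Model H r Λ x v (i + 1) A s B) : ∃ A' s' B', Model H r Λ x v i A' s' B' := by
  -- The geodesics are cut between the levels `a` and `a + 1`. The `2 Λ + 1` levels strictly between
  -- `a` and the band leave room for a middle level at distance `Λ + 1` from both.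
  obtain ⟨a, ha⟩ : ∃ a, ℓ i = a + 2 * Λ + 2 := ⟨ℓ i - (2 * Λ + 2), by omega⟩
  have hs : ∀ j, (H (i + 1)).Reachable x (s j) := fun j => hM.A_sub j _ (hM.s_mem j)
  have hmono := h.mono i hi
  have h0 : H i ≤ H 0 := h.le_zero hi.le
  have hρs : ∀ j, (H i).Reachable (ρ i) (s j) := fun j =>
    (h.root i hi).symm.trans ((hs j).mono hmono)
  choose g g0 gs gadj gd using fun j => exists_geodesic (H i) (hρs j)
  have hD1 : ∀ j, ℓ i ≤ (H i).dist (ρ i) (s j) := fun j => h.le_dist i hi _ (hs j)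
  have hD2 : ∀ j, (H i).dist (ρ i) (s j) < ℓ i + Λ := fun j => h.dist_lt i hi _ (hs j)
  have greach : ∀ j, ∀ e ≤ (H i).dist (ρ i) (s j), (H i).Reachable x (g j e) := fun j e he =>
    (h.root i hi).trans (gd j e he).1
  -- the part of the geodesic inside the band
  have hband : ∀ j, ∀ k, ℓ i + k ≤ (H i).dist (ρ i) (s j) →
      (H (i + 1)).Reachable x (g j ((H i).dist (ρ i) (s j) - k)) ∧
      (H (i + 1)).dist (s j) (g j ((H i).dist (ρ i) (s j) - k)) ≤ k := by
    intro j k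
    induction k with
    | zero => intro _; simp only [Nat.sub_zero, gs]; exact ⟨hs j, by simp⟩
    | succ k ih =>
      intro hk
      obtain ⟨ih1, ih2⟩ := ih (by omega)
      set e := (H i).dist (ρ i) (s j) - (k + 1) with he
      have he1 : (H i).dist (ρ i) (s j) - k = e + 1 := by omega
      rw [he1] at ih1 ih2
      have hadj : (H (i + 1)).Adj (g j e) (g j (e + 1)) := by
        refine h.keep i hi _ _ ih1 (gadj j e (by omega)) ?_ ?_
        · rw [(gd j e (by omega)).2, (gd j (e + 1) (by omega)).2]
        · rw [(gd j (e + 1) (by omega)).2]; omega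
      refine ⟨ih1.trans hadj.symm.reachable, ?_⟩
      have h1 := ((hs j).symm.trans ih1).dist_triangle_left (g j e)
      rw [SimpleGraph.dist_eq_one_iff_adj.2 hadj.symm] at h1
      omega
  have hlevB : ∀ m, i + 1 ≤ m → m < r → ∀ z ∈ B m, ℓ i ≤ (H i).dist (ρ i) z :=
    fun m h1 h2 z hz => h.le_dist i hi z (hM.B_sub m h1 h2 z hz)
  set A' : Fin r → Set V := fun j =>
    A j ∪ g j '' Set.Icc (a + 1) ((H i).dist (ρ i) (s j)) with hA'
  set Bi : Set V := ⋃ j, g j '' Set.Icc 0 a with hBi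
  set B' : ℕ → Set V := fun m => if m = i then Bi else B m with hB'
  have hlevBi : ∀ z ∈ Bi, (H i).Reachable x z ∧ (H i).Reachable (ρ i) z ∧
      (H i).dist (ρ i) z ≤ a := by
    intro z hz
    obtain ⟨j, e, he, rfl⟩ := Set.mem_iUnion.1 hz
    have he2 : e ≤ a := he.2
    have hj := hD1 j
    exact ⟨greach j e (by omega), (gd j e (by omega)).1, by rw [(gd j e (by omega)).2]; exact he2⟩
  have hlevA' : ∀ j, ∀ z ∈ A' j, a + 1 ≤ (H i).dist (ρ i) z := by
    rintro j z (hz | ⟨e, he, rfl⟩)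
    · have := h.le_dist i hi z (hM.A_sub j z hz); omega
    · rw [(gd j e he.2).2]; exact he.1
  have hB'i : B' i = Bi := by simp [hB']
  have hB'm : ∀ m, i + 1 ≤ m → B' m = B m := fun m hm => by
    simp only [hB']; rw [if_neg (by omega)]
  have hsplit : ∀ m, i ≤ m → m = i ∨ i + 1 ≤ m := fun m hm => by omega
  -- The level `a + Λ + 1` exceeds the levels of `B i` by at least `Λ + 1`, and it is `Λ + 1` below
  -- the band, where the later `B m` lie.
  refine ⟨A', fun j => g j (a + Λ + 1), B', ⟨?_, ?_, ?_, ?_, ?_, ?_, ?_, ?_, ?_, ?_⟩⟩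
  · rintro j z (hz | ⟨e, he, rfl⟩)
    · exact (hM.A_sub j z hz).mono hmono
    · exact greach j e he.2
  · intro j
    have hj := hD1 j
    exact Or.inr ⟨a + Λ + 1, ⟨by omega, by omega⟩, rfl⟩
  · intro j
    have hj := hD1 j
    refine SimpleGraph.induce_union_connected (hM.A_conn j).preconnected
      (connected_image_Icc (by omega) fun e _ he => h0 (gadj j e he)).preconnected ?_
    exact ⟨s j, hM.s_mem j, _, ⟨by omega, le_rfl⟩, gs j⟩
  -- The added piece runs from level `a + 1 = ℓ i - 2 Λ - 1` to a level below `ℓ i + Λ`, so its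
  -- length is at most `3 Λ`.
  · have hr1 : r - i = (r - (i + 1)) + 1 := by omega
    rintro j z (hz | ⟨e, he, rfl⟩)
    · refine (hM.A_dist j z hz).trans (Nat.mul_le_mul_right _ (by omega))
    · have h1 := hM.A_dist j _ (hM.s_mem j)
      have hvs : (H 0).Reachable (v j) (s j) :=
        ((hv j).mono (h.le_zero le_rfl)).symm.trans ((hs j).mono (h.le_zero hi))
      have h2 := hvs.dist_triangle_left (g j e)
      have h3 : ∀ k, e + k ≤ (H i).dist (ρ i) (s j) → (H 0).dist (g j e) (g j (e + k)) ≤ k := by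
        intro k
        induction k with
        | zero => intro _; simp
        | succ k ih =>
          intro hk
          have hre : (H 0).Reachable (g j e) (g j (e + k)) :=
            ((greach j e he.2).symm.trans (greach j (e + k) (by omega))).mono h0
          have h4 := hre.dist_triangle_left (g j (e + k + 1))
          rw [SimpleGraph.dist_eq_one_iff_adj.2 (h0 (gadj j (e + k) (by omega)))] at h4
          have := ih (by omega)
          rw [← add_assoc]; omega
      have h5 := h3 ((H i).dist (ρ i) (s j) - e) (by have := he.2; omega)
      rw [Nat.add_sub_cancel' he.2, gs, SimpleGraph.dist_comm] at h5
      have := he.1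
      have := hD2 j
      rw [hr1, add_mul, one_mul]
      omega
  · intro m hm hmr z hz
    rcases hsplit m hm with rfl | hm'
    · rw [hB'i] at hz; exact (hlevBi z hz).1
    · rw [hB'm m hm'] at hz; exact (hM.B_sub m hm' hmr z hz).mono hmono
  · intro m hm hmr
    rcases hsplit m hm with rfl | hm'
    · rw [hB'i]
      -- All initial parts start at the root, which makes their union connected.
      have hmem : ∀ j, ρ m ∈ g j '' Set.Icc 0 a := fun j => ⟨0, ⟨le_rfl, by omega⟩, g0 j⟩
      refine SimpleGraph.induce_connected_of_patches (ρ m)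
        (Set.mem_iUnion.2 ⟨⟨0, by omega⟩, hmem _⟩) fun {z} hz => ?_
      obtain ⟨j, hz⟩ := Set.mem_iUnion.1 hz
      have hj := hD1 j
      refine ⟨g j '' Set.Icc 0 a, Set.subset_iUnion (fun j => g j '' Set.Icc 0 a) j, hmem j, hz, ?_⟩
      exact (connected_image_Icc (by omega) fun e _ he => h0 (gadj j e (by omega))).preconnected _ _
    · rw [hB'm m hm']; exact hM.B_conn m hm' hmr
  · intro j m hm hmr
    rw [Set.disjoint_left]
    intro z hzA hzB
    rcases hsplit m hm with rfl | hm'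
    · rw [hB'i] at hzB
      have h1 := hlevA' j z hzA
      have h2 := (hlevBi z hzB).2.2
      omega
    · rw [hB'm m hm'] at hzB
      rcases hzA with hzA | ⟨e, he, rfl⟩
      · exact Set.disjoint_left.1 (hM.AB_disj j m hm' hmr) hzA hzB
      · have h1 := hlevB m hm' hmr _ hzB
        rw [(gd j e he.2).2] at h1
        have he2 : e ≤ (H i).dist (ρ i) (s j) := he.2
        have h2 := (hband j ((H i).dist (ρ i) (s j) - e) (by omega)).2
        rw [Nat.sub_sub_self he.2] at h2
        have h3 := hM.far j m hm' hmr _ hzB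
        have := hD2 j
        omega
  · intro m m' hm hmr hm' hmr' hne
    have key : ∀ m, i + 1 ≤ m → m < r → Disjoint Bi (B m) := by
      intro m hm hmr
      rw [Set.disjoint_left]
      intro z hz hz'
      have h1 := (hlevBi z hz).2.2
      have h2 := hlevB m hm hmr z hz'
      omega
    rcases hsplit m hm with rfl | h1 <;> rcases hsplit m' hm' with h2 | h2
    · exact absurd h2.symm hne
    · rw [hB'i, hB'm m' h2]; exact key m' h2 hmr'
    · rw [h2, hB'i, hB'm m h1]; exact (key m h1 hmr).symm
    · rw [hB'm m h1, hB'm m' h2]; exact hM.BB_disj m m' h1 hmr h2 hmr' hne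
  · intro j m hm hmr
    rcases hsplit m hm with rfl | hm'
    · have hj := hD1 j
      refine ⟨g j (a + 1), Or.inr ⟨a + 1, ⟨le_rfl, by omega⟩, rfl⟩, g j a, ?_,
        (h0 (gadj j a (by omega))).symm⟩
      rw [hB'i]
      exact Set.mem_iUnion.2 ⟨j, a, ⟨by omega, le_rfl⟩, rfl⟩
    · obtain ⟨p, hp, b, hb, hpb⟩ := hM.AB_adj j m hm' hmr
      exact ⟨p, Or.inl hp, b, by rwa [hB'm m hm'], hpb⟩
  · intro j m hm hmr z hz
    have hj := hD1 j
    have hs' := gd j (a + Λ + 1) (by omega)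
    rcases hsplit m hm with rfl | hm'
    · rw [hB'i] at hz
      have h1 := hlevBi z hz
      have h2 := h1.2.1.dist_triangle_left (g j (a + Λ + 1))
      rw [SimpleGraph.dist_comm (u := z)] at h2
      omega
    · rw [hB'm m hm'] at hz
      have h1 := hlevB m hm' hmr z hz
      have h2 := hs'.1.dist_triangle_left z
      omega

/-- Backward induction over the stages. At stage `r` the sets `A j` are single vertices and there
are no branch sets `B m` yet. -/
theorem model_zero (h : BandChain H r Λ x ρ ℓ) {v : Fin r → V}
    (hv : ∀ j, (H r).Reachable x (v j)) (hℓ : ∀ i < r, 2 * Λ + 2 ≤ ℓ i) :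
    ∃ A s B, Model H r Λ x v 0 A s B := by
  have key : ∀ k ≤ r, ∃ A s B, Model H r Λ x v (r - k) A s B := by
    intro k
    induction k with
    | zero =>
      intro _
      refine ⟨fun j => {v j}, v, fun _ => ∅, ?_, ?_, ?_, ?_, ?_, ?_, ?_, ?_, ?_, ?_⟩
      · rintro j z rfl; exact hv j
      · intro j; rfl
      · intro j; simp
      · rintro j z rfl; simp
      all_goals intros; omega
    | succ k ih =>
      intro hk
      obtain ⟨A, s, B, hM⟩ := ih (by omega)
      rw [show r - k = (r - (k + 1)) + 1 by omega] at hM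
      exact h.model_step (by omega) hv (hℓ _ (by omega)) hM
  have := key r le_rfl
  rwa [Nat.sub_self] at this

/-- The theorem of Klein, Plotkin and Rao. -/
theorem dist_le (h : BandChain H r Λ x ρ ℓ) (hr : 0 < r) (hΛ : 0 < Λ)
    (hG : ExcludesKrr r (H 0)) {y : V} (hxy : (H r).Reachable x y) :
    (H 0).dist x y ≤ 20 * r ^ 2 * Λ := by
  by_contra! hfar
  have hr2 : r ≤ r ^ 2 := Nat.le_self_pow (by norm_num) r
  have hb1 : r * (6 * r * Λ + 1) ≤ 7 * (r ^ 2 * Λ) := by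
    have h1 : r * 1 ≤ r ^ 2 * Λ := Nat.mul_le_mul hr2 hΛ
    have h2 : r * (6 * r * Λ + 1) = 6 * (r ^ 2 * Λ) + r := by ring
    omega
  have hb2 : Λ ≤ r ^ 2 * Λ := Nat.le_mul_of_pos_left _ (by positivity)
  have hb3 : 20 * r ^ 2 * Λ = 20 * (r ^ 2 * Λ) := by ring
  -- Otherwise the whole final component would be within distance `3 Λ` of the root `ρ i`, and `x`,
  -- `y` within `6 Λ` of each other.
  have hℓ : ∀ i < r, 2 * Λ + 2 ≤ ℓ i := by
    intro i hi
    by_contra! hlt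
    have hle := h.le_of_le (i := i + 1) hi le_rfl
    have h1 := h.dist_lt i hi x .rfl
    have h2 := h.dist_lt i hi y (hxy.mono hle)
    have h3 := (h.root i hi).dist_triangle_left y
    rw [SimpleGraph.dist_comm (u := x) (v := ρ i)] at h3
    have h4 : (H 0).dist x y ≤ (H i).dist x y :=
      SimpleGraph.Reachable.dist_anti (h.le_zero hi.le) (hxy.mono (h.le_of_le hi.le le_rfl))
    omega
  -- Vertices at distances `j (6 r Λ + 1)` from `x` are pairwise more than `6 r Λ` apart, twice the
  -- bound `3 r Λ` for the radius of the sets `A j`. This is why these sets will be disjoint.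
  have hex : ∀ j : Fin r, ∃ z, (H r).Reachable x z ∧ (H 0).dist x z = j * (6 * r * Λ + 1) := by
    intro j
    refine exists_reachable_dist_eq (h.le_zero le_rfl) hxy ?_
    have : (j : ℕ) * (6 * r * Λ + 1) ≤ r * (6 * r * Λ + 1) := Nat.mul_le_mul_right _ j.2.le
    omega
  choose v hv hvd using hex
  obtain ⟨A, s, B, hM⟩ := h.model_zero hv hℓ
  have hAA : ∀ j k : Fin r, (j : ℕ) < k → Disjoint (A j) (A k) := by
    intro j k hjk
    rw [Set.disjoint_left]
    intro z hz hz'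
    have h1 := hM.A_dist j z hz
    have h2 := hM.A_dist k z hz'
    have hvz : (H 0).Reachable (v j) z :=
      ((hv j).mono (h.le_zero le_rfl)).symm.trans (hM.A_sub j z hz)
    have h3 := hvz.dist_triangle_left (v k)
    have h4 := ((hv j).mono (h.le_zero le_rfl)).dist_triangle_left (v k)
    rw [hvd, hvd] at h4
    rw [SimpleGraph.dist_comm (u := z)] at h3
    have h5 : (j + 1 : ℕ) * (6 * r * Λ + 1) ≤ k * (6 * r * Λ + 1) := Nat.mul_le_mul_right _ hjk
    have h6 : (r - 0) * (3 * Λ) + (r - 0) * (3 * Λ) = 6 * r * Λ := by rw [Nat.sub_zero]; ring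
    rw [add_mul, one_mul] at h5
    omega
  refine hG ⟨Sum.elim A fun m => B m, ?_, ?_, ?_⟩
  · rintro (j | m)
    · exact hM.A_conn j
    · exact hM.B_conn m (Nat.zero_le _) m.2
  · rintro (j | m) (k | m') hne
    · have hne' : (j : ℕ) ≠ k := fun e => hne (by rw [Fin.ext e])
      rcases lt_or_gt_of_ne hne' with hlt | hlt
      · exact hAA j k hlt
      · exact (hAA k j hlt).symm
    · exact hM.AB_disj j m' (Nat.zero_le _) m'.2
    · exact (hM.AB_disj k m (Nat.zero_le _) m.2).symm
    · exact hM.BB_disj m m' (Nat.zero_le _) m.2 (Nat.zero_le _) m'.2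
        fun e => hne (by rw [Fin.ext e])
  · rintro (j | m) (k | m') hadj
    · simp at hadj
    · exact hM.AB_adj j m' (Nat.zero_le _) m'.2
    · obtain ⟨p, hp, b, hb, hpb⟩ := hM.AB_adj k m (Nat.zero_le _) m.2
      exact ⟨b, hb, p, hp, hpb.symm⟩
    · simp at hadj

end BandChain

end Geometry

/-! ### The graphs of Minor-e form a chain of bands -/

section MinorE

variable {V : Type*}

/-- With the shift `Λ - 1 - L`, the index of the band of level `m` changes from `m` to `m + 1` only
if `m` has residue `L`, that is, only across selected edges. -/
theorem succ_div_eq_of_mod_ne {m Λ L : ℕ} (hL : L < Λ) (h : m % Λ ≠ L) :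
    (m + 1 + (Λ - 1 - L)) / Λ = (m + (Λ - 1 - L)) / Λ := by
  have e : m + 1 + (Λ - 1 - L) = m + (Λ - 1 - L) + 1 := by omega
  rw [e, Nat.succ_div, if_neg, add_zero]
  rintro ⟨c, hc⟩
  apply h
  have h1 : m + Λ = L + Λ * c := by omega
  have h2 := congrArg (· % Λ) h1
  simp only [Nat.add_mod_right, Nat.add_mul_mod_self_left] at h2
  rw [h2, Nat.mod_eq_of_lt hL]

/-- The component after the removal of the selected edges lies in a band of levels. -/
theorem exists_bandChain {G : SimpleGraph V} {Λ : ℕ} {root : RootRule V} (hroot : root.Valid)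
    {L : ℕ → V → ℕ} (hL : ∀ i v, L i v < Λ) (r : ℕ) (x : V) :
    ∃ ρ ℓ, BandChain (fun i => G.deleteEdges (minorEIter G Λ root L i)) r Λ x ρ ℓ := by
  set H : ℕ → SimpleGraph V := fun i => G.deleteEdges (minorEIter G Λ root L i) with hH
  set ρ : ℕ → V := fun i => root i (H i) ((H i).connectedComponentMk x) with hρ
  -- The index of the band of levels that contains `y`. A surviving edge cannot change it, so it is
  -- constant on the component of `x` after the removal.
  set b : ℕ → V → ℕ := fun i y => ((H i).dist (ρ i) y + (Λ - 1 - L i (ρ i))) / Λ with hb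
  have hadj : ∀ i u v, (H (i + 1)).Adj u v ↔ (H i).Adj u v ∧
      s(u, v) ∉ cutEdges Λ (H i) (root i (H i)) (L i) := by
    intro i u v
    simp only [hH, SimpleGraph.deleteEdges_adj, minorEIter, Set.mem_union, not_or, and_assoc]
    exact Iff.rfl
  have hmono : ∀ i, H (i + 1) ≤ H i := fun i u v h => ((hadj i u v).1 h).1
  have hreach : ∀ i, (H i).Reachable x (ρ i) := fun i =>
    (SimpleGraph.ConnectedComponent.eq.1 (hroot i (H i) ((H i).connectedComponentMk x))).symm
  have hρeq : ∀ i y, (H i).Reachable x y → root i (H i) ((H i).connectedComponentMk y) = ρ i := by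
    intro i y hy
    simp only [hρ]
    rw [SimpleGraph.ConnectedComponent.eq.2 hy]
  have hcut : ∀ i u v, (H i).Reachable x u → (H i).Adj u v → (H i).dist (ρ i) v = (H i).dist (ρ i) u + 1 →
      ((H (i + 1)).Adj u v ↔ (H i).dist (ρ i) u % Λ ≠ L i (ρ i)) := by
    intro i u v hu huv hd
    rw [hadj, mem_cutEdges (hL i), hρeq i u hu, hd]
    simp [huv]
  have hbconst : ∀ i y, (H (i + 1)).Reachable x y → b i y = b i x := by
    intro i y hy
    rw [SimpleGraph.reachable_iff_reflTransGen] at hy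
    induction hy with
    | refl => rfl
    | @tail u v hu huv ih =>
      have hxu : (H i).Reachable x u :=
        ((SimpleGraph.reachable_iff_reflTransGen _ _).2 hu).mono (hmono i)
      have huv' := hmono i huv
      have hxv := hxu.trans huv'.reachable
      rw [← ih]
      have h1 := ((hreach i).symm.trans hxu).dist_triangle_left v
      have h2 := ((hreach i).symm.trans hxv).dist_triangle_left u
      rw [SimpleGraph.dist_eq_one_iff_adj.2 huv'] at h1
      rw [SimpleGraph.dist_eq_one_iff_adj.2 huv'.symm] at h2
      rcases (by omega : (H i).dist (ρ i) v = (H i).dist (ρ i) u ∨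
        (H i).dist (ρ i) v = (H i).dist (ρ i) u + 1 ∨
        (H i).dist (ρ i) u = (H i).dist (ρ i) v + 1) with h | h | h
      · simp only [hb, h]
      · simp only [hb, h]
        exact succ_div_eq_of_mod_ne (hL _ _) ((hcut i u v hxu huv' h).1 huv)
      · simp only [hb, h]
        exact (succ_div_eq_of_mod_ne (hL _ _) ((hcut i v u hxv huv'.symm h).1 huv.symm)).symm
  have hband : ∀ i y, (H (i + 1)).Reachable x y →
      b i x * Λ ≤ (H i).dist (ρ i) y + (Λ - 1 - L i (ρ i)) ∧
      (H i).dist (ρ i) y + (Λ - 1 - L i (ρ i)) < b i x * Λ + Λ := by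
    intro i y hy
    have hΛ : 0 < Λ := (Nat.zero_le _).trans_lt (hL i (ρ i))
    rw [← hbconst i y hy]
    simp only [hb]
    constructor
    · exact Nat.div_mul_le_self _ _
    · have := Nat.lt_div_mul_add (a := (H i).dist (ρ i) y + (Λ - 1 - L i (ρ i))) hΛ
      omega
  -- The truncated subtraction matters for the first band, which contains the root and may have
  -- fewer than `Λ` levels: its least level is `0`.
  refine ⟨ρ, fun i => b i x * Λ - (Λ - 1 - L i (ρ i)), ⟨fun i _ => hmono i, fun i _ => hreach i,
    fun i _ y hy => ?_, fun i _ y hy => ?_, fun i _ u v hv huv hd hlt => ?_⟩⟩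
  · have := hband i y hy
    omega
  · have := hband i y hy
    omega
  · have hxv : (H i).Reachable x v := hv.mono (hmono i)
    have h1 := hband i v hv
    rw [hcut i u v (hxv.trans huv.symm.reachable) huv hd]
    -- If the edge were selected, `v` would lie on the least level of the band, contrary to `hlt`.
    intro hmod
    have hLi := hL i (ρ i)
    have h2 : (H i).dist (ρ i) v + (Λ - 1 - L i (ρ i)) =
        ((H i).dist (ρ i) u / Λ + 1) * Λ := by
      have := Nat.div_add_mod' ((H i).dist (ρ i) u) Λ
      rw [add_mul, one_mul]
      omega
    rw [h2] at h1
    have h3 : (H i).dist (ρ i) u / Λ + 1 = b i x := by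
      have hΛ : 0 < Λ := (Nat.zero_le _).trans_lt hLi
      have h4 : b i x ≤ (H i).dist (ρ i) u / Λ + 1 := Nat.le_of_mul_le_mul_right h1.1 hΛ
      have h5 : (H i).dist (ρ i) u / Λ + 1 < b i x + 1 := by
        refine Nat.lt_of_mul_lt_mul_right (a := Λ) ?_
        rw [add_mul (b i x), one_mul]; exact h1.2
      omega
    rw [h3] at h2
    omega

theorem dist_le_of_reachable_minorEIter {G : SimpleGraph V} {r Λ : ℕ} {root : RootRule V}
    (hroot : root.Valid) {L : ℕ → V → ℕ} (hL : ∀ i v, L i v < Λ) (hG : ExcludesKrr r G) {x y : V}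
    (hxy : (G.deleteEdges (minorEIter G Λ root L r)).Reachable x y) :
    G.dist x y ≤ 20 * r ^ 2 * Λ := by
  obtain ⟨ρ, ℓ, h⟩ := exists_bandChain hroot hL r x (G := G)
  have h0 : G.deleteEdges (minorEIter G Λ root L 0) = G := by simp [minorEIter]
  have := h.dist_le (r_pos_of_excludesKrr hG) ((Nat.zero_le _).trans_lt (hL 0 x))
    (by rwa [h0]) hxy
  rwa [h0] at this

/-- For `Λ = 1` every level is selected in the first iteration. This case is separate in the
estimate of the running time, since the rounding in `Λ` is then not controlled by `ε⁻¹ d*`. -/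
theorem minorEIter_one_eq {G : SimpleGraph V} {root : RootRule V} {L : ℕ → V → ℕ}
    (hL : ∀ i v, L i v < 1) {r : ℕ} (hr : 0 < r) :
    G.deleteEdges (minorEIter G 1 root L r) = ⊥ := by
  have h1 : ∀ i, 0 < i → G.edgeSet ⊆ minorEIter G 1 root L i := by
    intro i hi
    induction i with
    | zero => omega
    | succ i ih =>
      rcases Nat.eq_zero_or_pos i with rfl | h0
      · intro e he
        refine Or.inr ?_
        induction e using Sym2.ind with
        | h u v =>
          rw [mem_cutEdges (hL 0)]
          refine ⟨?_, ?_⟩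
          · simpa [minorEIter] using he
          · rw [Nat.mod_one]
            exact (Nat.lt_one_iff.1 (hL 0 _)).symm
      · exact (ih h0).trans Set.subset_union_left
  ext u v
  simp only [SimpleGraph.deleteEdges_adj, SimpleGraph.bot_adj, iff_false, not_and, not_not]
  exact fun h => h1 r hr h

end MinorE

/-! ## The sizes of the components -/

section Sizes

open scoped Classical

variable {V : Type*} [Fintype V]

theorem card_ball_le (G : SimpleGraph V) {D : ℕ} (hD : ∀ v, G.degree v ≤ D) (x : V) (R : ℕ) :
    (Finset.univ.filter fun y => G.Reachable x y ∧ G.dist x y ≤ R).card ≤ (D + 1) ^ R := by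
  induction R with
  | zero =>
    have : (Finset.univ.filter fun y => G.Reachable x y ∧ G.dist x y ≤ 0) ⊆ {x} := by
      intro y hy
      simp only [Finset.mem_filter, Finset.mem_univ, true_and] at hy
      rw [Finset.mem_singleton, ← (hy.1.dist_eq_zero_iff.1 (by omega))]
    simpa using Finset.card_le_card this
  | succ R ih =>
    have hsub : (Finset.univ.filter fun y => G.Reachable x y ∧ G.dist x y ≤ R + 1) ⊆
        (Finset.univ.filter fun y => G.Reachable x y ∧ G.dist x y ≤ R).biUnion
          fun z => insert z (G.neighborFinset z) := by
      intro y hy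
      simp only [Finset.mem_filter, Finset.mem_univ, true_and, Finset.mem_biUnion,
        Finset.mem_insert, SimpleGraph.mem_neighborFinset] at hy ⊢
      by_cases hR : G.dist x y ≤ R
      · exact ⟨y, ⟨hy.1, hR⟩, Or.inl rfl⟩
      · obtain ⟨g, -, gs, gadj, gd⟩ := exists_geodesic G hy.1
        have hd : G.dist x y = R + 1 := by omega
        rw [hd] at gs gadj gd
        refine ⟨g R, ⟨(gd R (by omega)).1, (gd R (by omega)).2.le⟩, Or.inr ?_⟩
        have := gadj R (by omega)
        rwa [gs] at this
    refine (Finset.card_le_card hsub).trans (Finset.card_biUnion_le.trans ?_)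
    refine (Finset.sum_le_card_nsmul _ _ (D + 1) fun z _ => ?_).trans ?_
    · refine (Finset.card_insert_le _ _).trans ?_
      have := hD z
      rw [SimpleGraph.card_neighborFinset_eq_degree]
      omega
    · rw [smul_eq_mul, pow_succ]
      exact Nat.mul_le_mul_right _ ih

/-- The edge count of a spanning tree. The useful cases are `d = 1`, with at most two vertices, and
`d = 0`, with at most one. -/
theorem two_mul_ncard_supp_le {G H : SimpleGraph V} (hle : H ≤ G) {d : ℕ}
    (hd : ∀ v, G.degree v ≤ d) (c : H.ConnectedComponent) : 2 * c.supp.ncard ≤ c.supp.ncard * d + 2 := by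
  rw [Set.ncard_eq_toFinset_card']
  refine (two_mul_card_supp_le_sum_degree H c).trans (Nat.add_le_add_right ?_ 2)
  exact Finset.sum_le_card_nsmul _ _ _ fun v _ => (SimpleGraph.degree_le_of_le hle).trans (hd v)

/-- The component lies in a ball of radius `20 r² Λ` of `G`. For `D ≥ 2` the estimate `D + 1 ≤ D²`
turns the base of the ball bound into `D`; for `D = 1` components are vertices or single edges,
whence the factor `2`. -/
theorem ncard_supp_minorEIter_le {G : SimpleGraph V} {r Λ D : ℕ} {root : RootRule V}
    (hroot : root.Valid) {L : ℕ → V → ℕ} (hL : ∀ i v, L i v < Λ) (hG : ExcludesKrr r G)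
    (hD : ∀ v, G.degree v ≤ D) (hD1 : 1 ≤ D)
    (c : (G.deleteEdges (minorEIter G Λ root L r)).ConnectedComponent) :
    c.supp.ncard ≤ 2 * D ^ (40 * r ^ 2 * Λ) := by
  rcases Nat.lt_or_ge D 2 with h2 | h2
  · obtain rfl : D = 1 := by omega
    have h := two_mul_ncard_supp_le (SimpleGraph.deleteEdges_le _) hD c
    rw [one_pow]
    omega
  · induction c using SimpleGraph.ConnectedComponent.ind with
    | h x =>
      have hsub : ((G.deleteEdges (minorEIter G Λ root L r)).connectedComponentMk x).supp ⊆
          ((Finset.univ.filter fun y => G.Reachable x y ∧ G.dist x y ≤ 20 * r ^ 2 * Λ : Finset V) :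
            Set V) := by
        intro y hy
        have hy : (G.deleteEdges (minorEIter G Λ root L r)).Reachable x y :=
          (SimpleGraph.ConnectedComponent.eq.1 hy).symm
        simp only [Finset.coe_filter, Finset.mem_univ, true_and]
        exact ⟨hy.mono (SimpleGraph.deleteEdges_le _), dist_le_of_reachable_minorEIter hroot hL hG hy⟩
      calc _ ≤ (Finset.univ.filter fun y => G.Reachable x y ∧ G.dist x y ≤ 20 * r ^ 2 * Λ).card := by
            rw [← Set.ncard_coe_finset]
            exact Set.ncard_le_ncard hsub (Finset.finite_toSet _)
        _ ≤ (D + 1) ^ (20 * r ^ 2 * Λ) := card_ball_le G hD x _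
        _ ≤ (D ^ 2) ^ (20 * r ^ 2 * Λ) := Nat.pow_le_pow_left (by nlinarith) _
        _ = D ^ (40 * r ^ 2 * Λ) := by rw [← pow_mul]; congr 1; ring
        _ ≤ _ := Nat.le_mul_of_pos_left _ (by norm_num)

theorem ncard_supp_bot_le (H : SimpleGraph V) (hH : H = ⊥) (c : H.ConnectedComponent) :
    c.supp.ncard ≤ 1 := by
  have h := two_mul_ncard_supp_le (le_refl H) (d := 0) (fun v => by subst hH; simp) c
  omega

end Sizes

/-! ## Graphs without large minors have few edges -/

section Mader

open scoped Classical

variable {V : Type*} (G : SimpleGraph V)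

/-- The number of neighbours of `v` in `W`. -/
noncomputable def degIn (W : Finset V) (v : V) : ℕ := (W.filter (G.Adj v)).card

/-- Twice the number of edges in `W`. -/
noncomputable def degSum (W : Finset V) : ℕ := ∑ v ∈ W, degIn G W v

/-- The vertices of `W` outside `U` with a neighbour in `U`. -/
noncomputable def outerBoundary (W U : Finset V) : Finset V :=
  (W \ U).filter fun w => ∃ u ∈ U, G.Adj u w

theorem degSum_erase {W : Finset V} {w : V} (hw : w ∈ W) :
    degSum G W = degSum G (W.erase w) + 2 * degIn G W w := by
  have h1 : ∀ v ∈ W.erase w, degIn G W v =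
      degIn G (W.erase w) v + if G.Adj w v then 1 else 0 := by
    intro v hv
    unfold degIn
    rw [Finset.filter_erase]
    split_ifs with h
    · rw [Finset.card_erase_add_one]
      simp [hw, h.symm]
    · rw [Finset.erase_eq_of_notMem, add_zero]
      simp only [Finset.mem_filter, not_and]
      exact fun _ h' => h h'.symm
  unfold degSum
  rw [← Finset.add_sum_erase W _ hw, Finset.sum_congr rfl h1, Finset.sum_add_distrib]
  have h2 : (∑ v ∈ W.erase w, if G.Adj w v then 1 else 0) = degIn G W w := by
    rw [← Finset.card_filter]
    unfold degIn
    congr 1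
    ext v
    simp only [Finset.mem_filter, Finset.mem_erase]
    exact ⟨fun h => ⟨h.1.2, h.2⟩, fun h => ⟨⟨h.2.ne', h.1⟩, h.2⟩⟩
  omega

/-- Mader's argument: average degree at least `2 ^ t` gives a `K_t` minor. In a minimal dense set
`W`, contract a connected set `U` that is maximal subject to the contraction being dense. Then each
neighbour `w` of `U` has many neighbours in common with the contracted vertex, as otherwise `w`
could be contracted too. So the neighbourhood of `U` has half the density and contains a minor with
one vertex less, to which `U` is added. -/
theorem exists_complete_minor (t : ℕ) : ∀ W : Finset V, W.Nonempty →
    2 ^ t * W.card ≤ degSum G W →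
    ∃ B : ℕ → Set V, (∀ i < t, B i ⊆ W ∧ (G.induce (B i)).Connected) ∧
      (∀ i < t, ∀ j < t, i ≠ j → Disjoint (B i) (B j) ∧ ∃ x ∈ B i, ∃ y ∈ B j, G.Adj x y) := by
  induction t with
  | zero => exact fun W _ _ => ⟨fun _ => ∅, fun i h => absurd h (Nat.not_lt_zero i),
      fun i h => absurd h (Nat.not_lt_zero i)⟩
  | succ t ih =>
    intro W0 hW0 hd0
    set k := 2 ^ (t + 1) with hk
    have hkpos : 0 < k := by positivity
    -- a minimal dense set
    obtain ⟨W, hWsub, ⟨hWne, hWd⟩, hWmin⟩ : ∃ W ⊆ W0, (W.Nonempty ∧ k * W.card ≤ degSum G W) ∧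
        ∀ W' ⊂ W, W'.Nonempty → degSum G W' < k * W'.card := by
      obtain ⟨W, hW, hmin⟩ := Finset.exists_min_image
        (W0.powerset.filter fun W => W.Nonempty ∧ k * W.card ≤ degSum G W) Finset.card
        ⟨W0, by simp [hW0, hd0]⟩
      simp only [Finset.mem_filter, Finset.mem_powerset] at hW
      refine ⟨W, hW.1, hW.2, fun W' hW' hne => ?_⟩
      by_contra! h
      have := hmin W' (by
        simp only [Finset.mem_filter, Finset.mem_powerset]
        exact ⟨hW'.1.trans hW.1, hne, h⟩)
      exact absurd (Finset.card_lt_card hW') (by omega)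
    -- a maximal connected set whose contraction is dense
    let Good : Finset V → Prop := fun U => U.Nonempty ∧ (G.induce (U : Set V)).Connected ∧
      k * ((W \ U).card + 1) ≤ degSum G (W \ U) + 2 * (outerBoundary G W U).card
    obtain ⟨v, hv⟩ := hWne
    have hgood0 : Good {v} := by
      refine ⟨by simp, by rw [Finset.coe_singleton]; simp, ?_⟩
      rw [Finset.sdiff_singleton_eq_erase]
      have h1 := Finset.card_erase_add_one hv
      have h2 := degSum_erase G hv
      have h3 : (outerBoundary G W {v}).card = degIn G W v := by
        unfold outerBoundary degIn
        congr 1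
        ext w
        simp only [Finset.mem_filter, Finset.mem_sdiff, Finset.mem_singleton, exists_eq_left]
        exact ⟨fun h => ⟨h.1.1, h.2⟩, fun h => ⟨⟨h.1, h.2.ne'⟩, h.2⟩⟩
      rw [h1, h3, ← h2]
      exact hWd
    obtain ⟨U, hU, hUmax⟩ := Finset.exists_max_image (W.powerset.filter Good) Finset.card
      ⟨{v}, by simp [hv, hgood0]⟩
    simp only [Finset.mem_filter, Finset.mem_powerset] at hU
    obtain ⟨hUW, hUne, hUc, hUd⟩ := hU
    set N := outerBoundary G W U with hN
    have hNW : N ⊆ W \ U := Finset.filter_subset _ _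
    -- Without neighbours of `U`, the rest `W \ U` would itself be dense, against the minimality of
    -- `W`.
    have hNne : N.Nonempty := by
      by_contra h
      rw [Finset.not_nonempty_iff_eq_empty] at h
      rw [h, Finset.card_empty, mul_zero, add_zero] at hUd
      rcases (W \ U).eq_empty_or_nonempty with he | hne
      · rw [he] at hUd
        simp only [Finset.card_empty, degSum, Finset.sum_empty] at hUd
        omega
      · have hss : W \ U ⊂ W := Finset.sdiff_ssubset hUW hUne
        have := hWmin _ hss hne
        rw [mul_add] at hUd
        omega
    -- Contracting `w` as well removes one vertex, and it lowers twice the number of edges by `2`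
    -- for the edge to `U` and by `2` for each common neighbour. With fewer than `2 ^ t` common
    -- neighbours the loss is at most `2 · 2 ^ t = k`, so density survives, against the maximality
    -- of `U`.
    have hdeg : ∀ w ∈ N, 2 ^ t ≤ degIn G N w := by
      intro w hw
      have hwWU := hNW hw
      have hwW : w ∈ W := (Finset.mem_sdiff.1 hwWU).1
      have hwU : w ∉ U := (Finset.mem_sdiff.1 hwWU).2
      obtain ⟨u, hu, huw⟩ := (Finset.mem_filter.1 hw).2
      by_contra! hlt
      have hset : W \ insert w U = (W \ U).erase w := by
        ext z; simp only [Finset.mem_sdiff, Finset.mem_insert, Finset.mem_erase]; tauto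
      have h1 := Finset.card_erase_add_one hwWU
      have h2 := degSum_erase G hwWU
      have hbd : outerBoundary G W (insert w U) =
          (N.erase w) ∪ (((W \ U).filter (G.Adj w)) \ N) := by
        ext z
        simp only [outerBoundary, hN, Finset.mem_filter, Finset.mem_sdiff, Finset.mem_insert,
          Finset.mem_union, Finset.mem_erase]
        constructor
        · rintro ⟨⟨hz, hz'⟩, a, (rfl | ha), haz⟩
          · by_cases hb : ∃ u ∈ U, G.Adj u z
            · exact Or.inl ⟨fun e => hz' (Or.inl e), ⟨hz, fun e => hz' (Or.inr e)⟩, hb⟩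
            · exact Or.inr ⟨⟨⟨hz, fun e => hz' (Or.inr e)⟩, haz⟩, fun h => hb h.2⟩
          · exact Or.inl ⟨fun e => hz' (Or.inl e), ⟨hz, fun e => hz' (Or.inr e)⟩, a, ha, haz⟩
        · rintro (⟨hz, ⟨hz1, hz2⟩, a, ha, haz⟩ | ⟨⟨⟨hz1, hz2⟩, haz⟩, -⟩)
          · exact ⟨⟨hz1, fun h => h.elim hz hz2⟩, a, Or.inr ha, haz⟩
          · exact ⟨⟨hz1, fun h => h.elim (fun e => haz.ne' e) hz2⟩, w, Or.inl rfl, haz⟩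
      have hdisj : Disjoint (N.erase w) (((W \ U).filter (G.Adj w)) \ N) :=
        Finset.disjoint_of_subset_left (Finset.erase_subset _ _) Finset.disjoint_sdiff
      have h3 := Finset.card_erase_add_one hw
      have h4 : (((W \ U).filter (G.Adj w)) \ N).card + degIn G N w = degIn G (W \ U) w := by
        have e1 : (((W \ U).filter (G.Adj w)) ∩ N) = N.filter (G.Adj w) := by
          ext z
          simp only [Finset.mem_inter, Finset.mem_filter]
          exact ⟨fun h => ⟨h.2, h.1.2⟩, fun h => ⟨⟨hNW h.1, h.2⟩, h.1⟩⟩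
        have e2 := Finset.card_sdiff_add_card_inter ((W \ U).filter (G.Adj w)) N
        rw [e1] at e2
        exact e2
      have hgood : Good (insert w U) := by
        refine ⟨Finset.insert_nonempty _ _, ?_, ?_⟩
        · rw [Finset.coe_insert]
          have e : insert w (U : Set V) = (U : Set V) ∪ {u, w} := by
            ext z
            simp only [Set.mem_insert_iff, Finset.mem_coe, Set.mem_union, Set.mem_singleton_iff]
            constructor
            · rintro (h | h)
              exacts [Or.inr (Or.inr h), Or.inl h]
            · rintro (h | h | h)
              exacts [Or.inr h, Or.inr (h ▸ hu), Or.inl h]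
          rw [e]
          exact SimpleGraph.induce_union_connected hUc.preconnected
            (SimpleGraph.induce_pair_connected_of_adj huw).preconnected ⟨u, hu, by simp⟩
        · rw [hset, hbd, Finset.card_union_of_disjoint hdisj, h1]
          have hk2 : k = 2 * 2 ^ t := by rw [hk, pow_succ]; ring
          rw [mul_add, mul_one] at hUd
          omega
      have := hUmax (insert w U) (by
        simp only [Finset.mem_filter, Finset.mem_powerset]
        exact ⟨Finset.insert_subset hwW hUW, hgood⟩)
      rw [Finset.card_insert_of_notMem hwU] at this
      omega
    obtain ⟨B, hB1, hB2⟩ := ih N hNne (by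
      rw [mul_comm, ← smul_eq_mul]
      exact Finset.card_nsmul_le_sum _ _ _ hdeg)
    have hUdisj : ∀ i < t, Disjoint (U : Set V) (B i) ∧ ∃ x ∈ (U : Set V), ∃ y ∈ B i, G.Adj x y := by
      intro i hi
      constructor
      · rw [Set.disjoint_left]
        intro z hz hz'
        exact (Finset.mem_sdiff.1 (hNW ((hB1 i hi).1 hz'))).2 hz
      · obtain ⟨⟨z, hz⟩⟩ := (hB1 i hi).2.nonempty
        obtain ⟨u, hu, huz⟩ := (Finset.mem_filter.1 ((hB1 i hi).1 hz)).2
        exact ⟨u, hu, z, hz, huz⟩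
    obtain ⟨B', hBt, hBi⟩ : ∃ B' : ℕ → Set V, B' t = U ∧ ∀ i ≠ t, B' i = B i :=
      ⟨fun i => if i = t then U else B i, by simp, fun i hi => by simp [hi]⟩
    refine ⟨B', fun i hi => ?_, fun i hi j hj hij => ?_⟩
    · by_cases h : i = t
      · rw [h, hBt]
        exact ⟨fun z hz => hWsub (hUW hz), hUc⟩
      · rw [hBi i h]
        have := hB1 i (by omega)
        exact ⟨fun z hz => hWsub (Finset.mem_sdiff.1 (hNW (this.1 hz))).1, this.2⟩
    · by_cases h : i = t <;> by_cases h' : j = t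
      · omega
      · rw [h, hBt, hBi j h']
        exact hUdisj j (by omega)
      · rw [h', hBt, hBi i h]
        obtain ⟨h1, x, hx, y, hy, hxy⟩ := hUdisj i (by omega)
        exact ⟨h1.symm, y, hy, x, hx, hxy.symm⟩
      · rw [hBi i h, hBi j h']
        exact hB2 i (by omega) j (by omega) hij

/-- The number of edges is linear in the number of vertices. -/
theorem sum_degree_le_of_excludesKrr [Fintype V] {r : ℕ} (hG : ExcludesKrr r G) :
    ∑ v, G.degree v ≤ 2 ^ (2 * r) * Fintype.card V := by
  by_contra! h
  have hne : (Finset.univ : Finset V).Nonempty := by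
    by_contra h'
    rw [Finset.not_nonempty_iff_eq_empty] at h'
    rw [h'] at h
    simp at h
  have hdeg : degSum G Finset.univ = ∑ v, G.degree v := by
    unfold degSum degIn
    refine Finset.sum_congr rfl fun v _ => ?_
    rw [← SimpleGraph.card_neighborFinset_eq_degree]
    congr 1
    ext w
    simp
  -- A complete minor on `2 r` branch sets contains `K_{r,r}`: the first `r` sets are one side, the
  -- others the second side.
  obtain ⟨B, hB1, hB2⟩ := exists_complete_minor G (2 * r) Finset.univ hne (by
    rw [hdeg, Finset.card_univ]; exact h.le)
  refine hG ⟨Sum.elim (fun i => B i) fun j => B (r + j), ?_, ?_, ?_⟩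
  · rintro (i | j)
    · exact (hB1 i (by omega)).2
    · exact (hB1 (r + j) (by omega)).2
  · rintro (i | i) (j | j) hij
    · exact (hB2 i (by omega) j (by omega) fun e => hij (by rw [Fin.ext e])).1
    · exact (hB2 i (by omega) (r + j) (by omega) (by omega)).1
    · exact (hB2 (r + i) (by omega) j (by omega) (by omega)).1
    · exact (hB2 (r + i) (by omega) (r + j) (by omega) fun e => hij (by
        rw [Fin.ext (Nat.add_left_cancel e)])).1
  · rintro (i | i) (j | j) hij
    · simp at hij
    · exact (hB2 i (by omega) (r + j) (by omega) (by omega)).2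
    · exact (hB2 (r + i) (by omega) j (by omega) (by omega)).2
    · simp at hij

end Mader

/-! ## Reasoning about programs -/

namespace RAM

/-- Whether the program contains an assignment to the array `a` of natural numbers. -/
def Prog.writesNat : Prog → ℕ → Bool
  | .skip, _ => false
  | .setNat a _ _, b => Nat.beq a b
  | .setReal _ _ _, _ => false
  | .draw a _, b => Nat.beq a b
  | .seq p p', b => p.writesNat b || p'.writesNat b
  | .cond _ p p', b => p.writesNat b || p'.writesNat b
  | .loop _ p, b => p.writesNat b

/-- Whether the program contains an assignment to the array `a` of real numbers. -/
def Prog.writesReal : Prog → ℕ → Bool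
  | .skip, _ => false
  | .setNat _ _ _, _ => false
  | .setReal a _ _, b => Nat.beq a b
  | .draw _ _, _ => false
  | .seq p p', b => p.writesReal b || p'.writesReal b
  | .cond _ p p', b => p.writesReal b || p'.writesReal b
  | .loop _ p, b => p.writesReal b

/-- Whether the program reads random numbers. -/
def Prog.draws : Prog → Bool
  | .skip => false
  | .setNat _ _ _ => false
  | .setReal _ _ _ => false
  | .draw _ _ => true
  | .seq p p' => p.draws || p'.draws
  | .cond _ p p' => p.draws || p'.draws
  | .loop _ p => p.draws

/-- The states agree on everything that the program does not write. -/
structure Agree (p : Prog) (σ σ' : State) : Prop where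
  nat : ∀ a, p.writesNat a = false → σ'.nat a = σ.nat a
  real : ∀ a, p.writesReal a = false → σ'.real a = σ.real a
  coins : p.draws = false → σ'.coins = σ.coins

theorem Agree.refl (p : Prog) (σ : State) : Agree p σ σ :=
  ⟨fun _ _ => rfl, fun _ _ => rfl, fun _ => rfl⟩

theorem Agree.trans {p : Prog} {σ σ' σ'' : State} (h : Agree p σ σ') (h' : Agree p σ' σ'') :
    Agree p σ σ'' :=
  ⟨fun a ha => (h'.nat a ha).trans (h.nat a ha), fun a ha => (h'.real a ha).trans (h.real a ha),
    fun ha => (h'.coins ha).trans (h.coins ha)⟩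

theorem Agree.weaken {p p' : Prog} {σ σ' : State} (h : Agree p σ σ')
    (hn : ∀ a, p'.writesNat a = false → p.writesNat a = false)
    (hr : ∀ a, p'.writesReal a = false → p.writesReal a = false)
    (hd : p'.draws = false → p.draws = false) : Agree p' σ σ' :=
  ⟨fun a ha => h.nat a (hn a ha), fun a ha => h.real a (hr a ha), fun ha => h.coins (hd ha)⟩

theorem Agree.seq_left {p p' : Prog} {σ σ' : State} (h : Agree p σ σ') : Agree (.seq p p') σ σ' :=
  h.weaken (fun _ ha => (Bool.or_eq_false_iff.1 ha).1) (fun _ ha => (Bool.or_eq_false_iff.1 ha).1)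
    fun ha => (Bool.or_eq_false_iff.1 ha).1

theorem Agree.seq_right {p p' : Prog} {σ σ' : State} (h : Agree p' σ σ') : Agree (.seq p p') σ σ' :=
  h.weaken (fun _ ha => (Bool.or_eq_false_iff.1 ha).2) (fun _ ha => (Bool.or_eq_false_iff.1 ha).2)
    fun ha => (Bool.or_eq_false_iff.1 ha).2

/-- The frame rule. What a concrete program leaves alone is computed by evaluation, so the frame
conditions below are mostly closed by `rfl`. -/
theorem Exec.agree {p : Prog} {σ σ' : State} {t : ℕ} (h : Exec p σ σ' t) : Agree p σ σ' := by
  induction h with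
  | skip σ => exact Agree.refl _ _
  | setNat a i e σ =>
    refine ⟨fun b hb => ?_, fun _ _ => rfl, fun _ => rfl⟩
    exact Function.update_of_ne (fun h => Nat.ne_of_beq_eq_false hb h.symm) _ _
  | setReal a i e σ =>
    refine ⟨fun _ _ => rfl, fun b hb => ?_, fun _ => rfl⟩
    exact Function.update_of_ne (fun h => Nat.ne_of_beq_eq_false hb h.symm) _ _
  | draw a i σ =>
    refine ⟨fun b hb => ?_, fun _ _ => rfl, fun h => by simp [Prog.draws] at h⟩
    exact Function.update_of_ne (fun h => Nat.ne_of_beq_eq_false hb h.symm) _ _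
  | seq _ _ ih ih' => exact ih.seq_left.trans ih'.seq_right
  | @condTrue b p p' _ _ _ _ _ ih =>
    have h := Agree.seq_left (p' := p') ih
    exact ⟨h.nat, h.real, h.coins⟩
  | @condFalse b p p' _ _ _ _ _ ih =>
    have h := Agree.seq_right (p := p) ih
    exact ⟨h.nat, h.real, h.coins⟩
  | loopTrue _ _ _ ih ih' => exact Agree.trans ⟨ih.nat, ih.real, ih.coins⟩ ih'
  | loopFalse _ => exact Agree.refl _ _

/-- This transfers a step bound proved for one constructed run to every given run of the program. -/
theorem Exec.deterministic {p : Prog} {σ σ₁ σ₂ : State} {t₁ t₂ : ℕ} (h₁ : Exec p σ σ₁ t₁)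
    (h₂ : Exec p σ σ₂ t₂) : σ₁ = σ₂ ∧ t₁ = t₂ := by
  induction h₁ generalizing σ₂ t₂ with
  | skip σ => cases h₂; exact ⟨rfl, rfl⟩
  | setNat a i e σ => cases h₂; exact ⟨rfl, rfl⟩
  | setReal a i e σ => cases h₂; exact ⟨rfl, rfl⟩
  | draw a i σ => cases h₂; exact ⟨rfl, rfl⟩
  | seq _ _ ih ih' =>
    cases h₂ with
    | seq h h' =>
      obtain ⟨rfl, rfl⟩ := ih h
      obtain ⟨rfl, rfl⟩ := ih' h'
      exact ⟨rfl, rfl⟩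
  | condTrue hb _ ih =>
    cases h₂ with
    | condTrue _ h => obtain ⟨rfl, rfl⟩ := ih h; exact ⟨rfl, rfl⟩
    | condFalse hb' _ => exact absurd hb hb'
  | condFalse hb _ ih =>
    cases h₂ with
    | condTrue hb' _ => exact absurd hb' hb
    | condFalse _ h => obtain ⟨rfl, rfl⟩ := ih h; exact ⟨rfl, rfl⟩
  | loopTrue hb _ _ ih ih' =>
    cases h₂ with
    | loopTrue _ h h' =>
      obtain ⟨rfl, rfl⟩ := ih h
      obtain ⟨rfl, rfl⟩ := ih' h'
      exact ⟨rfl, rfl⟩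
    | loopFalse hb' => exact absurd hb hb'
  | loopFalse hb =>
    cases h₂ with
    | loopTrue hb' _ _ => exact absurd hb' hb
    | loopFalse _ => exact ⟨rfl, rfl⟩

/-- The program halts, in a state and after a number of steps that satisfy `Q`. -/
def Runs (p : Prog) (σ : State) (Q : State → ℕ → Prop) : Prop :=
  ∃ σ' t, Exec p σ σ' t ∧ Q σ' t

/-- The frame information comes for free when a postcondition is weakened, so specifications only
have to speak of what a program changes. -/
theorem Runs.mono {p : Prog} {σ : State} {Q Q' : State → ℕ → Prop} (h : Runs p σ Q)
    (hQ : ∀ σ' t, Agree p σ σ' → Q σ' t → Q' σ' t) : Runs p σ Q' := by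
  obtain ⟨σ', t, he, hq⟩ := h
  exact ⟨σ', t, he, hQ σ' t he.agree hq⟩

theorem runs_skip {σ : State} {Q : State → ℕ → Prop} : Runs .skip σ Q ↔ Q σ 1 :=
  ⟨fun ⟨_, _, he, hq⟩ => by cases he; exact hq, fun h => ⟨_, _, .skip _, h⟩⟩

theorem runs_setNat {a : ℕ} {i e : NExp} {σ : State} {Q : State → ℕ → Prop} :
    Runs (.setNat a i e) σ Q ↔ Q (σ.writeNat a (i.val σ) (e.val σ)) 1 :=
  ⟨fun ⟨_, _, he, hq⟩ => by cases he; exact hq, fun h => ⟨_, _, .setNat _ _ _ _, h⟩⟩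

theorem runs_setReal {a : ℕ} {i : NExp} {e : RExp} {σ : State} {Q : State → ℕ → Prop} :
    Runs (.setReal a i e) σ Q ↔ Q (σ.writeReal a (i.val σ) (e.val σ)) 1 :=
  ⟨fun ⟨_, _, he, hq⟩ => by cases he; exact hq, fun h => ⟨_, _, .setReal _ _ _ _, h⟩⟩

theorem runs_draw {a : ℕ} {i : NExp} {σ : State} {Q : State → ℕ → Prop} :
    Runs (.draw a i) σ Q ↔ Q ((σ.writeNat a (i.val σ) (σ.coins 0)).nextCoin) 1 :=
  ⟨fun ⟨_, _, he, hq⟩ => by cases he; exact hq, fun h => ⟨_, _, .draw _ _ _, h⟩⟩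

theorem runs_seq {p p' : Prog} {σ : State} {Q : State → ℕ → Prop} :
    Runs (.seq p p') σ Q ↔ Runs p σ fun σ' t => Runs p' σ' fun σ'' t' => Q σ'' (t + t') :=
  ⟨fun ⟨_, _, he, hq⟩ => by cases he with | seq h h' => exact ⟨_, _, h, _, _, h', hq⟩,
    fun ⟨_, _, h, _, _, h', hq⟩ => ⟨_, _, .seq h h', hq⟩⟩

theorem runs_cond_of_true {b : Test} {p p' : Prog} {σ : State} {Q : State → ℕ → Prop}
    (hb : b.Holds σ) : Runs (.cond b p p') σ Q ↔ Runs p σ fun σ' t => Q σ' (t + 1) :=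
  ⟨fun ⟨_, _, he, hq⟩ => by
    cases he with
    | condTrue _ h => exact ⟨_, _, h, hq⟩
    | condFalse hb' _ => exact absurd hb hb',
    fun ⟨_, _, h, hq⟩ => ⟨_, _, .condTrue hb h, hq⟩⟩

theorem runs_cond_of_false {b : Test} {p p' : Prog} {σ : State} {Q : State → ℕ → Prop}
    (hb : ¬ b.Holds σ) : Runs (.cond b p p') σ Q ↔ Runs p' σ fun σ' t => Q σ' (t + 1) :=
  ⟨fun ⟨_, _, he, hq⟩ => by
    cases he with
    | condTrue hb' _ => exact absurd hb' hb
    | condFalse _ h => exact ⟨_, _, h, hq⟩,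
    fun ⟨_, _, h, hq⟩ => ⟨_, _, .condFalse hb h, hq⟩⟩

/-- The rule for loops, with an invariant and a potential that bounds the number of steps. -/
theorem runs_loop {b : Test} {p : Prog} (I : State → Prop) (Φ : State → ℕ) (B : ℕ)
    (hB : ∀ σ, I σ → Φ σ ≤ B) {σ : State}
    (step : ∀ σ', Agree p σ σ' → I σ' → b.Holds σ' →
      Runs p σ' fun σ'' t => I σ'' ∧ Φ σ' + t + 1 ≤ Φ σ'') (h : I σ) :
    Runs (.loop b p) σ fun σ' t => I σ' ∧ ¬ b.Holds σ' ∧ Φ σ + t ≤ Φ σ' + 1 := by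
  -- Induction on the room `B - Φ` that is left: each pass raises the potential by at least the
  -- steps it takes, so the bound also proves termination.
  have key : ∀ m σ', B - Φ σ' ≤ m → Agree p σ σ' → I σ' →
      Runs (.loop b p) σ' fun σ'' t => I σ'' ∧ ¬ b.Holds σ'' ∧ Φ σ' + t ≤ Φ σ'' + 1 := by
    intro m
    induction m with
    | zero =>
      intro σ' hm ha hi
      by_cases hb : b.Holds σ'
      · obtain ⟨σ'', t, -, hi', ht⟩ := step σ' ha hi hb
        have := hB σ'' hi'
        omega
      · exact ⟨σ', 1, .loopFalse hb, hi, hb, le_rfl⟩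
    | succ m ih =>
      intro σ' hm ha hi
      by_cases hb : b.Holds σ'
      · obtain ⟨σ'', t, he, hi', ht⟩ := step σ' ha hi hb
        obtain ⟨σ₃, t', he', hi₃, hb₃, ht'⟩ := ih σ'' (by have := hB σ'' hi'; omega)
          (ha.trans he.agree) hi'
        exact ⟨σ₃, _, .loopTrue hb he he', hi₃, hb₃, by omega⟩
      · exact ⟨σ', 1, .loopFalse hb, hi, hb, le_rfl⟩
  exact key _ σ le_rfl (Agree.refl _ _) h

/-- The value of a scalar variable: cell `0` of the array `a`. -/
abbrev NExp.var (a : ℕ) : NExp := .get a (.lit 0)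

/-- The assignment to a scalar variable. -/
abbrev Prog.setVar (a : ℕ) (e : NExp) : Prog := .setNat a (.lit 0) e

/-- `for i = lo, …, hi - 1`. -/
def forLoop (i : ℕ) (lo hi : NExp) (body : Prog) : Prog :=
  .seq (.setVar i lo) (.loop (.natLt (.var i) hi) (.seq body (.setVar i (.add (.var i) (.lit 1)))))

theorem Agree.forLoop {i : ℕ} {lo hi : NExp} {body : Prog} {σ σ' : State} (h : Agree body σ σ') :
    Agree (forLoop i lo hi body) σ σ' :=
  Agree.seq_right ⟨h.seq_left.nat, h.seq_left.real, h.seq_left.coins⟩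

@[simp] theorem nat_writeNat_self (σ : State) (a i x : ℕ) :
    (σ.writeNat a i x).nat a = Function.update (σ.nat a) i x := Function.update_self ..

@[simp] theorem nat_writeNat_of_ne (σ : State) {a b : ℕ} (i x : ℕ) (h : b ≠ a) :
    (σ.writeNat a i x).nat b = σ.nat b := Function.update_of_ne h ..

@[simp] theorem real_writeNat (σ : State) (a i x : ℕ) : (σ.writeNat a i x).real = σ.real := rfl

@[simp] theorem real_writeReal_self (σ : State) (a i : ℕ) (x : ℝ) :
    (σ.writeReal a i x).real a = Function.update (σ.real a) i x := Function.update_self ..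

@[simp] theorem real_writeReal_of_ne (σ : State) {a b : ℕ} (i : ℕ) (x : ℝ) (h : b ≠ a) :
    (σ.writeReal a i x).real b = σ.real b := Function.update_of_ne h ..

@[simp] theorem nat_writeReal (σ : State) (a i : ℕ) (x : ℝ) : (σ.writeReal a i x).nat = σ.nat := rfl

@[simp] theorem nat_nextCoin (σ : State) : σ.nextCoin.nat = σ.nat := rfl

/-- The rule for `for` loops. The number of steps is bounded by a potential. -/
theorem runs_for {i : ℕ} {lo hi : NExp} {body : Prog} {σ : State} (I : ℕ → State → Prop)
    (Φ : ℕ → State → ℕ) {a b : ℕ} (hlo : lo.val σ = a) (hab : a ≤ b)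
    (hhi : ∀ σ', Agree (forLoop i lo hi body) σ σ' → hi.val σ' = b)
    (hbody : body.writesNat i = false)
    (hI : ∀ k σ' x, I k σ' → I k (σ'.writeNat i 0 x) ∧ Φ k (σ'.writeNat i 0 x) = Φ k σ')
    (step : ∀ k σ', a ≤ k → k < b → Agree (forLoop i lo hi body) σ σ' → σ'.nat i 0 = k → I k σ' →
      Runs body σ' fun σ'' t => I (k + 1) σ'' ∧ Φ k σ' + t + 2 ≤ Φ (k + 1) σ'')
    (h : I a σ) :
    Runs (forLoop i lo hi body) σ fun σ' t => I b σ' ∧ Φ a σ + t ≤ Φ b σ' + 2 := by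
  set inc : Prog := .setVar i (.add (.var i) (.lit 1)) with hinc
  set lp : Prog := .loop (.natLt (.var i) hi) (.seq body inc) with hlp
  have hfor : forLoop i lo hi body = .seq (.setVar i lo) lp := rfl
  -- Induction on the number `b - k` of remaining passes. The `2` charged per pass pays for the test
  -- and for the increment of the loop variable.
  have key : ∀ m k σ', b - k ≤ m → a ≤ k → k ≤ b → Agree (forLoop i lo hi body) σ σ' →
      σ'.nat i 0 = k → I k σ' →
      Runs lp σ' fun σ'' t => I b σ'' ∧ Φ k σ' + t ≤ Φ b σ'' + 1 := by
    intro m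
    induction m with
    | zero =>
      intro k σ' hm hak hkb hag hk hIk
      obtain rfl : k = b := by omega
      refine ⟨σ', 1, .loopFalse ?_, hIk, le_rfl⟩
      simp only [Test.Holds, NExp.val, hk, hhi σ' hag]
      omega
    | succ m ih =>
      intro k σ' hm hak hkb hag hk hIk
      rcases Nat.eq_or_lt_of_le hkb with rfl | hlt
      · refine ⟨σ', 1, .loopFalse ?_, hIk, le_rfl⟩
        simp only [Test.Holds, NExp.val, hk, hhi σ' hag]
        omega
      · obtain ⟨σ₁, t₁, he₁, hI₁, ht₁⟩ := step k σ' hak hlt hag hk hIk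
        have hk₁ : σ₁.nat i 0 = k := by rw [he₁.agree.nat i hbody, hk]
        have he₂ : Exec inc σ₁ (σ₁.writeNat i 0 (k + 1)) 1 := by
          have := Exec.setNat i (.lit 0) (.add (.var i) (.lit 1)) σ₁
          simpa only [NExp.val, hk₁] using this
        have hbody' := Exec.seq he₁ he₂
        have hag' : Agree (forLoop i lo hi body) σ' (σ₁.writeNat i 0 (k + 1)) := by
          have h1 := hbody'.agree
          rw [hfor]
          exact Agree.seq_right ⟨h1.nat, h1.real, h1.coins⟩
        have hII := hI (k + 1) σ₁ (k + 1) hI₁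
        obtain ⟨σ₃, t₃, he₃, hI₃, ht₃⟩ := ih (k + 1) (σ₁.writeNat i 0 (k + 1)) (by omega) (by omega)
          (by omega) (hag.trans hag') (by simp) hII.1
        refine ⟨σ₃, _, .loopTrue ?_ hbody' he₃, hI₃, ?_⟩
        · simp only [Test.Holds, NExp.val, hk, hhi σ' hag]
          exact hlt
        · rw [hII.2] at ht₃
          omega
  have hII := hI a σ a h
  have he₀ : Exec (.setVar i lo) σ (σ.writeNat i 0 a) 1 := by
    have := Exec.setNat i (.lit 0) lo σ
    simpa only [NExp.val, hlo] using this
  obtain ⟨σ₃, t₃, he₃, hI₃, ht₃⟩ := key _ a (σ.writeNat i 0 a) le_rfl le_rfl hab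
    (by rw [hfor]; exact he₀.agree.seq_left) (by simp) hII.1
  refine ⟨σ₃, _, by rw [hfor]; exact .seq he₀ he₃, hI₃, ?_⟩
  rw [hII.2] at ht₃
  omega

/-- The rule for `for` loops with a bound for the number of steps of each pass. -/
theorem runs_for_sum {i : ℕ} {lo hi : NExp} {body : Prog} {σ : State} (I : ℕ → State → Prop)
    (T : ℕ → ℕ) {a b : ℕ} (hlo : lo.val σ = a) (hab : a ≤ b)
    (hhi : ∀ σ', Agree (forLoop i lo hi body) σ σ' → hi.val σ' = b)
    (hbody : body.writesNat i = false)
    (hI : ∀ k σ' x, I k σ' → I k (σ'.writeNat i 0 x))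
    (step : ∀ k σ', a ≤ k → k < b → Agree (forLoop i lo hi body) σ σ' → σ'.nat i 0 = k → I k σ' →
      Runs body σ' fun σ'' t => I (k + 1) σ'' ∧ t ≤ T k)
    (h : I a σ) :
    Runs (forLoop i lo hi body) σ fun σ' t => I b σ' ∧ t ≤ ∑ k ∈ Finset.Ico a b, (T k + 2) + 2 := by
  refine (runs_for I (fun k _ => ∑ j ∈ Finset.Ico a k, (T j + 2)) hlo hab hhi hbody
    (fun k σ' x hk => ⟨hI k σ' x hk, rfl⟩) (fun k σ' hak hkb hag hk hIk => ?_) h).mono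
    fun σ' t _ hq => ⟨hq.1, ?_⟩
  · refine (step k σ' hak hkb hag hk hIk).mono fun σ'' t _ hq => ⟨hq.1, ?_⟩
    rw [Finset.sum_Ico_succ_top hak]
    have := hq.2
    omega
  · have := hq.2
    simp only [Finset.Ico_self, Finset.sum_empty] at this
    omega

end RAM

/-! ## Breadth-first search on arrays -/

/-- The arrays of a breadth-first search: visited marks, queue, distances, distances modulo `Λ`
and roots. -/
structure SearchData where
  vis : ℕ → ℕ
  queue : ℕ → ℕ
  dist : ℕ → ℕ
  res : ℕ → ℕ
  root : ℕ → ℕ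

namespace SearchData

/-- Appending `w` to the queue, at the position `t`. -/
def push (A : SearchData) (t w d m ρ : ℕ) : SearchData where
  vis := Function.update A.vis w 1
  queue := Function.update A.queue t w
  dist := Function.update A.dist w d
  res := Function.update A.res w m
  root := Function.update A.root w ρ

/-- The invariant of the search when the queue has length `t` and the neighbours of its first `h`
vertices have been visited. -/
structure Core (n Λ : ℕ) (E : ℕ → ℕ → Prop) (A : SearchData) (t h : ℕ) : Prop where
  queue_inj : ∀ i < t, ∀ j < t, A.queue i = A.queue j → i = j
  queue_lt : ∀ k < t, A.queue k < n
  queue_vis : ∀ k < t, A.vis (A.queue k) ≠ 0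
  vis_queue : ∀ w < n, A.vis w ≠ 0 → ∃ k < t, A.queue k = w
  root_lt : ∀ w < n, A.vis w ≠ 0 → A.root w < n
  root_vis : ∀ w < n, A.vis w ≠ 0 → A.vis (A.root w) ≠ 0
  root_root : ∀ w < n, A.vis w ≠ 0 → A.root (A.root w) = A.root w
  root_dist : ∀ w < n, A.vis w ≠ 0 → A.dist (A.root w) = 0
  root_le : ∀ w < n, A.vis w ≠ 0 → A.root w ≤ w
  parent : ∀ w < n, A.vis w ≠ 0 → A.root w = w ∨
    ∃ u < n, A.vis u ≠ 0 ∧ E u w ∧ A.dist w = A.dist u + 1 ∧ A.root w = A.root u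
  res_eq : ∀ w < n, A.vis w ≠ 0 → A.res w = A.dist w % Λ
  done : ∀ k < h, ∀ w, E (A.queue k) w →
    A.vis w ≠ 0 ∧ A.root w = A.root (A.queue k) ∧ A.dist w ≤ A.dist (A.queue k) + 1

/-- The invariant for the current component, which has the root `v` and starts at the position
`st` of the queue. -/
structure Comp (A : SearchData) (v st h t : ℕ) : Prop where
  st_le : st ≤ h
  h_le : h ≤ t
  st_lt : st < t
  seg : ∀ k < t, A.root (A.queue k) = v ↔ st ≤ k
  mono : ∀ i j, st ≤ i → i ≤ j → j < t → A.dist (A.queue i) ≤ A.dist (A.queue j)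
  near : h < t → ∀ j < t, A.dist (A.queue j) ≤ A.dist (A.queue h) + 1 ∨ j < st

/-- The segments of the queue that belong to the finished components. The root `ex` is exempt. -/
def Segs (n : ℕ) (A : SearchData) (sS sE : ℕ → ℕ) (t ex : ℕ) : Prop :=
  ∀ x < n, x ≠ ex → A.vis x ≠ 0 → A.root x = x →
    sS x ≤ sE x ∧ sE x ≤ t ∧ ∀ k < t, A.root (A.queue k) = x ↔ sS x ≤ k ∧ k < sE x

variable {n Λ : ℕ} {E : ℕ → ℕ → Prop} {A : SearchData} {t h v st : ℕ}

theorem Core.le_n (H : Core n Λ E A t h) : t ≤ n := by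
  have := Finset.card_le_card_of_injOn (s := Finset.range t) (t := Finset.range n) A.queue
    (fun k hk => by simpa using H.queue_lt k (by simpa using hk))
    (fun i hi j hj => H.queue_inj i (by simpa using hi) j (by simpa using hj))
  simpa using this

/-- The alternatives in `hρ` are the two uses: `w` starts a new component, or `w` is reached from a
visited `u`. As `w` was not visited, no entry of a visited vertex is overwritten. -/
theorem Core.push (H : Core n Λ E A t h) (hh : h ≤ t) {w d ρ : ℕ} (hw : w < n) (hvis : A.vis w = 0)
    (hρ : (ρ = w ∧ d = 0) ∨ ∃ u < n, A.vis u ≠ 0 ∧ E u w ∧ d = A.dist u + 1 ∧ ρ = A.root u ∧ ρ ≤ w) :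
    Core n Λ E (A.push t w d (d % Λ) ρ) (t + 1) h := by
  have hne : ∀ x, A.vis x ≠ 0 → x ≠ w := fun x hx e => hx (e ▸ hvis)
  have hq : ∀ k < t, (A.push t w d (d % Λ) ρ).queue k = A.queue k := fun k hk =>
    Function.update_of_ne hk.ne _ _
  have hqt : (A.push t w d (d % Λ) ρ).queue t = w := Function.update_self ..
  have hvw : (A.push t w d (d % Λ) ρ).vis w = 1 := Function.update_self ..
  have hdw : (A.push t w d (d % Λ) ρ).dist w = d := Function.update_self ..
  have hmw : (A.push t w d (d % Λ) ρ).res w = d % Λ := Function.update_self ..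
  have hrw : (A.push t w d (d % Λ) ρ).root w = ρ := Function.update_self ..
  have hv : ∀ x ≠ w, (A.push t w d (d % Λ) ρ).vis x = A.vis x := fun x hx =>
    Function.update_of_ne hx _ _
  have hd : ∀ x ≠ w, (A.push t w d (d % Λ) ρ).dist x = A.dist x := fun x hx =>
    Function.update_of_ne hx _ _
  have hm : ∀ x ≠ w, (A.push t w d (d % Λ) ρ).res x = A.res x := fun x hx =>
    Function.update_of_ne hx _ _
  have hr : ∀ x ≠ w, (A.push t w d (d % Λ) ρ).root x = A.root x := fun x hx =>
    Function.update_of_ne hx _ _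
  generalize A.push t w d (d % Λ) ρ = A' at *
  have hv' : ∀ x, A.vis x ≠ 0 → A'.vis x ≠ 0 := fun x hx => by rw [hv x (hne x hx)]; exact hx
  have hcase : ∀ k < t + 1, k = t ∨ k < t := fun k hk => by omega
  have hold : ∀ x, A'.vis x ≠ 0 → x ≠ w → A.vis x ≠ 0 := fun x hx hxw => by rwa [hv x hxw] at hx
  have hrold : ∀ x < n, A.vis x ≠ 0 → A'.root (A.root x) = A.root (A.root x) ∧
      A'.dist (A.root x) = A.dist (A.root x) := fun x hx hxv =>
    ⟨hr _ (hne _ (H.root_vis x hx hxv)), hd _ (hne _ (H.root_vis x hx hxv))⟩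
  refine ⟨?_, ?_, ?_, ?_, ?_, ?_, ?_, ?_, ?_, ?_, ?_, ?_⟩
  · intro i hi j hj e
    rcases hcase i hi with rfl | hi' <;> rcases hcase j hj with h' | hj'
    · exact h'.symm
    · rw [hqt, hq j hj'] at e
      exact absurd e.symm (hne _ (H.queue_vis j hj'))
    · rw [h', hqt, hq i hi'] at e
      exact absurd e (hne _ (H.queue_vis i hi'))
    · rw [hq i hi', hq j hj'] at e
      exact H.queue_inj i hi' j hj' e
  · intro k hk
    rcases hcase k hk with rfl | hk'
    · rw [hqt]; exact hw
    · rw [hq k hk']; exact H.queue_lt k hk'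
  · intro k hk
    rcases hcase k hk with rfl | hk'
    · rw [hqt, hvw]; exact one_ne_zero
    · rw [hq k hk']; exact hv' _ (H.queue_vis k hk')
  · intro x hx hxv
    by_cases hxw : x = w
    · exact ⟨t, by omega, hxw ▸ hqt⟩
    · obtain ⟨k, hk, rfl⟩ := H.vis_queue x hx (hold x hxv hxw)
      exact ⟨k, by omega, hq k hk⟩
  · intro x hx hxv
    by_cases hxw : x = w
    · subst hxw
      rw [hrw]
      rcases hρ with ⟨rfl, -⟩ | ⟨u, hu, huv, -, -, rfl, -⟩
      · exact hw
      · exact H.root_lt u hu huv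
    · rw [hr x hxw]; exact H.root_lt x hx (hold x hxv hxw)
  · intro x hx hxv
    by_cases hxw : x = w
    · subst hxw
      rw [hrw]
      rcases hρ with ⟨rfl, -⟩ | ⟨u, hu, huv, -, -, rfl, -⟩
      · exact hxv
      · exact hv' _ (H.root_vis u hu huv)
    · rw [hr x hxw]; exact hv' _ (H.root_vis x hx (hold x hxv hxw))
  · intro x hx hxv
    by_cases hxw : x = w
    · subst hxw
      rw [hrw]
      rcases hρ with ⟨rfl, -⟩ | ⟨u, hu, huv, -, -, rfl, -⟩
      · exact hrw
      · rw [(hrold u hu huv).1]; exact H.root_root u hu huv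
    · have hxo := hold x hxv hxw
      rw [hr x hxw, (hrold x hx hxo).1]; exact H.root_root x hx hxo
  · intro x hx hxv
    by_cases hxw : x = w
    · subst hxw
      rw [hrw]
      rcases hρ with ⟨rfl, rfl⟩ | ⟨u, hu, huv, -, -, rfl, -⟩
      · exact hdw
      · rw [(hrold u hu huv).2]; exact H.root_dist u hu huv
    · have hxo := hold x hxv hxw
      rw [hr x hxw, (hrold x hx hxo).2]; exact H.root_dist x hx hxo
  · intro x hx hxv
    by_cases hxw : x = w
    · subst hxw
      rw [hrw]
      rcases hρ with ⟨rfl, -⟩ | ⟨u, -, -, -, -, -, hle⟩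
      · exact le_rfl
      · exact hle
    · rw [hr x hxw]; exact H.root_le x hx (hold x hxv hxw)
  · intro x hx hxv
    by_cases hxw : x = w
    · subst hxw
      rw [hrw]
      rcases hρ with ⟨rfl, -⟩ | ⟨u, hu, huv, huw, rfl, rfl, -⟩
      · exact Or.inl rfl
      · refine Or.inr ⟨u, hu, hv' u huv, huw, ?_, ?_⟩
        · rw [hdw, hd u (hne u huv)]
        · rw [hr u (hne u huv)]
    · rw [hr x hxw]
      rcases H.parent x hx (hold x hxv hxw) with e | ⟨u, hu, huv, hux, h1, h2⟩
      · exact Or.inl e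
      · refine Or.inr ⟨u, hu, hv' u huv, hux, ?_, ?_⟩
        · rw [hd x hxw, hd u (hne u huv), h1]
        · rw [hr u (hne u huv), h2]
  · intro x hx hxv
    by_cases hxw : x = w
    · subst hxw; rw [hmw, hdw]
    · rw [hm x hxw, hd x hxw]; exact H.res_eq x hx (hold x hxv hxw)
  · intro k hk x hx
    have hkt : k < t := by omega
    rw [hq k hkt] at hx ⊢
    obtain ⟨h1, h2, h3⟩ := H.done k hk x hx
    have hk' := hne _ (H.queue_vis k hkt)
    rw [hr x (hne x h1), hd x (hne x h1), hr _ hk', hd _ hk']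
    exact ⟨hv' x h1, h2, h3⟩

/-- Distances stay sorted along the queue, because no vertex of the current component is further
than one beyond the head, and the new vertex is exactly that far. -/
theorem Comp.push (H : Core n Λ E A t h) (C : Comp A v st h t) {w m : ℕ} (hh : h < t)
    (hvis : A.vis w = 0) :
    Comp (A.push t w (A.dist (A.queue h) + 1) m (A.root (A.queue h))) v st h (t + 1) := by
  have hne : ∀ x, A.vis x ≠ 0 → x ≠ w := fun x hx e => hx (e ▸ hvis)
  set A' := A.push t w (A.dist (A.queue h) + 1) m (A.root (A.queue h)) with hA'
  have hq : ∀ k < t, A'.queue k = A.queue k := fun k hk => Function.update_of_ne hk.ne _ _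
  have hqt : A'.queue t = w := Function.update_self ..
  have hdw : A'.dist w = A.dist (A.queue h) + 1 := Function.update_self ..
  have hrw : A'.root w = A.root (A.queue h) := Function.update_self ..
  have hd : ∀ k < t, A'.dist (A'.queue k) = A.dist (A.queue k) := fun k hk => by
    rw [hq k hk]; exact Function.update_of_ne (hne _ (H.queue_vis k hk)) _ _
  have hr : ∀ k < t, A'.root (A'.queue k) = A.root (A.queue k) := fun k hk => by
    rw [hq k hk]; exact Function.update_of_ne (hne _ (H.queue_vis k hk)) _ _
  have hcase : ∀ k < t + 1, k = t ∨ k < t := fun k hk => by omega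
  have hdt : A'.dist (A'.queue t) = A.dist (A.queue h) + 1 := by rw [hqt, hdw]
  refine ⟨C.st_le, by omega, by have := C.st_lt; omega, ?_, ?_, ?_⟩
  · intro k hk
    rcases hcase k hk with rfl | hk'
    · rw [hqt, hrw, C.seg h hh]
      exact ⟨fun _ => C.st_lt.le, fun _ => C.st_le⟩
    · rw [hr k hk']; exact C.seg k hk'
  · intro i j hi hij hj
    rcases hcase j hj with rfl | hj'
    · rcases hcase i (by omega) with rfl | hi'
      · exact le_rfl
      · rw [hdt, hd i hi']
        rcases C.near hh i hi' with h1 | h1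
        · exact h1
        · omega
    · rw [hd i (by omega), hd j hj']; exact C.mono i j hi hij hj'
  · intro _ j hj
    rw [hd h hh]
    rcases hcase j hj with rfl | hj'
    · rw [hdt]; exact Or.inl le_rfl
    · rw [hd j hj']; exact C.near hh j hj'

/-- Roots of visited vertices are visited, so no earlier vertex of the queue can have the unvisited
`v` as its root. -/
theorem Comp.start (H : Core n Λ E A t t) {m : ℕ} (hvis : A.vis v = 0) :
    Comp (A.push t v 0 m v) v t t (t + 1) := by
  have hne : ∀ x, A.vis x ≠ 0 → x ≠ v := fun x hx e => hx (e ▸ hvis)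
  set A' := A.push t v 0 m v with hA'
  have hq : ∀ k < t, A'.queue k = A.queue k := fun k hk => Function.update_of_ne hk.ne _ _
  have hqt : A'.queue t = v := Function.update_self ..
  have hrw : A'.root v = v := Function.update_self ..
  have hr : ∀ k < t, A'.root (A'.queue k) = A.root (A.queue k) := fun k hk => by
    rw [hq k hk]; exact Function.update_of_ne (hne _ (H.queue_vis k hk)) _ _
  refine ⟨le_rfl, by omega, by omega, fun k hk => ?_, fun i j hi hij hj => ?_, fun _ j hj => ?_⟩
  · rcases (by omega : k = t ∨ k < t) with rfl | hk'
    · rw [hqt, hrw]; simp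
    · rw [hr k hk']
      have h1 := H.root_vis _ (H.queue_lt k hk') (H.queue_vis k hk')
      exact ⟨fun e => absurd e (hne _ h1), fun h => by omega⟩
  · obtain rfl : i = t := by omega
    obtain rfl : j = i := by omega
    exact le_rfl
  · rcases (by omega : j = t ∨ j < t) with rfl | hj'
    · exact Or.inl (by omega)
    · exact Or.inr hj'

/-- All neighbours of the head are now in the queue. None belongs to an earlier component: its own
neighbours were then fully processed, which by symmetry of `E` would have put the head into that
component. The bound on the distance is `near`. -/
theorem Core.advance (H : Core n Λ E A t h) (hE : ∀ u w, E u w → u < n ∧ w < n)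
    (hsymm : ∀ u w, E u w → E w u) (C : Comp A v st h t) (hh : h < t)
    (hscan : ∀ w, E (A.queue h) w → A.vis w ≠ 0) :
    Core n Λ E A t (h + 1) ∧ Comp A v st (h + 1) t := by
  refine ⟨⟨H.queue_inj, H.queue_lt, H.queue_vis, H.vis_queue, H.root_lt, H.root_vis, H.root_root,
    H.root_dist, H.root_le, H.parent, H.res_eq, fun k hk w hw => ?_⟩,
    ⟨by have := C.st_le; omega, by omega, C.st_lt, C.seg, C.mono, fun hh' j hj => ?_⟩⟩
  · rcases (by omega : k = h ∨ k < h) with rfl | hk'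
    · have hwv := hscan w hw
      obtain ⟨j, hj, rfl⟩ := H.vis_queue w (hE _ _ hw).2 hwv
      have hroot := (C.seg k hh).2 C.st_le
      by_cases hjst : st ≤ j
      · refine ⟨hwv, ?_, ?_⟩
        · rw [hroot, (C.seg j hj).2 hjst]
        · rcases C.near hh j hj with h1 | h1
          · exact h1
          · omega
      · exfalso
        have h1 := (H.done j (by have := C.st_le; omega) _ (hsymm _ _ hw)).2.1
        rw [hroot] at h1
        exact hjst ((C.seg j hj).1 h1.symm)
    · exact H.done k hk' w hw
  · rcases C.near hh j hj with h1 | h1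
    · have := C.mono h (h + 1) C.st_le (by omega) hh'
      exact Or.inl (by omega)
    · exact Or.inr h1

theorem Segs.push {sS sE : ℕ → ℕ} (H : Core n Λ E A t h) (S : Segs n A sS sE t v) {w d m : ℕ}
    (hvis : A.vis w = 0) (hw : w = v ∨ A.vis v ≠ 0) :
    Segs n (A.push t w d m v) sS sE (t + 1) v := by
  have hne : ∀ x, A.vis x ≠ 0 → x ≠ w := fun x hx e => hx (e ▸ hvis)
  set A' := A.push t w d m v with hA'
  have hq : ∀ k < t, A'.queue k = A.queue k := fun k hk => Function.update_of_ne hk.ne _ _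
  have hqt : A'.queue t = w := Function.update_self ..
  have hrw : A'.root w = v := Function.update_self ..
  have hr : ∀ k < t, A'.root (A'.queue k) = A.root (A.queue k) := fun k hk => by
    rw [hq k hk]; exact Function.update_of_ne (hne _ (H.queue_vis k hk)) _ _
  intro x hx hxv hvx hrx
  by_cases hxw : x = w
  · subst hxw
    rw [hrw] at hrx
    exact absurd hrx.symm hxv
  · have h1 : A'.vis x = A.vis x := Function.update_of_ne hxw _ _
    have h2 : A'.root x = A.root x := Function.update_of_ne hxw _ _
    obtain ⟨h3, h4, h5⟩ := S x hx hxv (h1 ▸ hvx) (h2 ▸ hrx)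
    refine ⟨h3, by omega, fun k hk => ?_⟩
    rcases (by omega : k = t ∨ k < t) with rfl | hk'
    · rw [hqt, hrw]
      exact ⟨fun e => absurd e.symm hxv, fun e => by omega⟩
    · rw [hr k hk']; exact h5 k hk'

theorem Segs.finish {sS sE : ℕ → ℕ} (C : Comp A v st t t) (S : Segs n A sS sE t v)
    (hS : sS v = st) (hEv : sE v = t) (ex : ℕ) : Segs n A sS sE t ex := by
  intro x hx _ hvx hrx
  by_cases hxv : x = v
  · subst hxv
    refine ⟨by rw [hS, hEv]; exact C.st_le, by rw [hEv], fun k hk => ?_⟩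
    rw [C.seg k hk, hS, hEv]
    exact ⟨fun h => ⟨h, hk⟩, fun h => h.1⟩
  · exact S x hx hxv hvx hrx

/-- What the search computes. -/
structure Result (n Λ : ℕ) (E : ℕ → ℕ → Prop) (A : SearchData) (sS sE : ℕ → ℕ) : Prop where
  queue_inj : ∀ i < n, ∀ j < n, A.queue i = A.queue j → i = j
  queue_lt : ∀ k < n, A.queue k < n
  root_lt : ∀ w < n, A.root w < n
  root_root : ∀ w < n, A.root (A.root w) = A.root w
  root_dist : ∀ w < n, A.dist (A.root w) = 0
  root_le : ∀ w < n, A.root w ≤ w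
  parent : ∀ w < n, A.root w = w ∨
    ∃ u < n, E u w ∧ A.dist w = A.dist u + 1 ∧ A.root w = A.root u
  res_eq : ∀ w < n, A.res w = A.dist w % Λ
  edge : ∀ u w, E u w → A.root w = A.root u ∧ A.dist w ≤ A.dist u + 1
  seg : ∀ x < n, A.root x = x → sS x ≤ sE x ∧ sE x ≤ n ∧
    ∀ k < n, A.root (A.queue k) = x ↔ sS x ≤ k ∧ k < sE x

theorem Core.result {sS sE : ℕ → ℕ} (H : Core n Λ E A t t) (hE : ∀ u w, E u w → u < n ∧ w < n)
    (S : Segs n A sS sE t n) (hall : ∀ x < n, A.vis x ≠ 0) : Result n Λ E A sS sE := by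
  have htn : t = n := by
    -- All `n` vertices are visited and each visited vertex is in the queue, so the queue has length
    -- `n`.
    refine le_antisymm H.le_n ?_
    have hsub : Finset.range n ⊆ (Finset.range t).image A.queue := by
      intro x hx
      obtain ⟨k, hk, rfl⟩ := H.vis_queue x (by simpa using hx) (hall x (by simpa using hx))
      exact Finset.mem_image_of_mem _ (by simpa using hk)
    have := (Finset.card_le_card hsub).trans Finset.card_image_le
    simpa using this
  subst htn
  refine ⟨H.queue_inj, H.queue_lt, fun w hw => H.root_lt w hw (hall w hw),
    fun w hw => H.root_root w hw (hall w hw), fun w hw => H.root_dist w hw (hall w hw),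
    fun w hw => H.root_le w hw (hall w hw), fun w hw => ?_,
    fun w hw => H.res_eq w hw (hall w hw), fun u w huw => ?_,
    fun x hx hrx => S x hx hx.ne (hall x hx) hrx⟩
  · rcases H.parent w hw (hall w hw) with h | ⟨u, hu, -, h1, h2, h3⟩
    · exact Or.inl h
    · exact Or.inr ⟨u, hu, h1, h2, h3⟩
  · obtain ⟨k, hk, rfl⟩ := H.vis_queue u (hE _ _ huw).1 (hall u (hE _ _ huw).1)
    exact (H.done k hk w huw).2

end SearchData

/-! ## The meaning of the result of the search -/

/-- The adjacency relation of a graph on `Fin n`, as a relation on natural numbers. -/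
def natAdj {n : ℕ} (H : SimpleGraph (Fin n)) (u w : ℕ) : Prop :=
  ∃ (hu : u < n) (hw : w < n), H.Adj ⟨u, hu⟩ ⟨w, hw⟩

open scoped Classical in
/-- The rule that picks the least node of each component. -/
noncomputable def minRoot (n : ℕ) : RootRule (Fin n) := fun _ H c =>
  c.supp.toFinset.min' (by
    obtain ⟨v, hv⟩ := c.exists_rep
    exact ⟨v, Set.mem_toFinset.2 hv⟩)

theorem minRoot_valid (n : ℕ) : (minRoot n).Valid := by
  intro i H c
  classical
  have := Finset.min'_mem c.supp.toFinset (by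
    obtain ⟨v, hv⟩ := c.exists_rep
    exact ⟨v, Set.mem_toFinset.2 hv⟩)
  simpa [minRoot] using this

theorem minRoot_le {n : ℕ} (i : ℕ) (H : SimpleGraph (Fin n)) (v : Fin n) :
    minRoot n i H (H.connectedComponentMk v) ≤ v := by
  classical
  exact Finset.min'_le _ _ (by simp)

namespace SearchData.Result

variable {n Λ : ℕ} {H : SimpleGraph (Fin n)} {A : SearchData} {sS sE : ℕ → ℕ}

theorem root_eq_of_reachable (R : Result n Λ (natAdj H) A sS sE) {u w : Fin n}
    (h : H.Reachable u w) : A.root w = A.root u := by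
  rw [SimpleGraph.reachable_iff_reflTransGen] at h
  induction h with
  | refl => rfl
  | tail _ hbc ih => rw [← ih]; exact (R.edge _ _ ⟨_, _, hbc⟩).1

/-- Following parents lowers the recorded distance by one and keeps the root; distance `0` is
reached only at a root. -/
theorem exists_walk (R : Result n Λ (natAdj H) A sS sE) (k : ℕ) : ∀ w : Fin n, A.dist w = k →
    ∃ p : H.Walk ⟨A.root w, R.root_lt w w.2⟩ w, p.length = k := by
  induction k with
  | zero =>
    intro w hk
    rcases R.parent w w.2 with e | ⟨u, hu, -, h2, -⟩
    · have : (⟨A.root w, R.root_lt w w.2⟩ : Fin n) = w := Fin.ext e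
      rw [this]
      exact ⟨.nil, rfl⟩
    · omega
  | succ k ih =>
    intro w hk
    rcases R.parent w w.2 with e | ⟨u, hu, ⟨_, _, hadj⟩, h2, h3⟩
    · have := R.root_dist w w.2
      rw [e] at this
      omega
    · obtain ⟨p, hp⟩ := ih ⟨u, hu⟩ (by change A.dist u = k; omega)
      have e : (⟨A.root w, R.root_lt w w.2⟩ : Fin n) = ⟨A.root u, R.root_lt u hu⟩ := Fin.ext h3
      rw [e]
      exact ⟨p.concat hadj, by rw [SimpleGraph.Walk.length_concat, hp]⟩

theorem reachable_root (R : Result n Λ (natAdj H) A sS sE) (w : Fin n) :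
    H.Reachable ⟨A.root w, R.root_lt w w.2⟩ w := by
  obtain ⟨p, -⟩ := R.exists_walk _ w rfl
  exact ⟨p⟩

theorem reachable_iff (R : Result n Λ (natAdj H) A sS sE) {u w : Fin n} :
    H.Reachable u w ↔ A.root u = A.root w := by
  refine ⟨fun h => (R.root_eq_of_reachable h).symm, fun h => ?_⟩
  have e : (⟨A.root u, R.root_lt u u.2⟩ : Fin n) = ⟨A.root w, R.root_lt w w.2⟩ := Fin.ext h
  have h1 := R.reachable_root u
  rw [e] at h1
  exact h1.symm.trans (R.reachable_root w)

/-- The walk along parents gives one inequality. The other holds because the recorded distance grows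
by at most one along each edge and is `0` at the root. -/
theorem dist_eq (R : Result n Λ (natAdj H) A sS sE) (w : Fin n) :
    H.dist ⟨A.root w, R.root_lt w w.2⟩ w = A.dist w := by
  refine le_antisymm ?_ ?_
  · obtain ⟨p, hp⟩ := R.exists_walk _ w rfl
    exact (SimpleGraph.dist_le p).trans hp.le
  · have key : ∀ (u v : Fin n) (p : H.Walk u v), A.dist v ≤ A.dist u + p.length := by
      intro u v p
      induction p with
      | nil => simp
      | @cons a b c hab p ih =>
        have := (R.edge _ _ ⟨_, _, hab⟩).2
        rw [SimpleGraph.Walk.length_cons]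
        have h1 : A.dist (b : ℕ) ≤ A.dist (a : ℕ) + 1 := this
        omega
    obtain ⟨p, hp⟩ := (R.reachable_root w).exists_walk_length_eq_dist
    have h1 := key _ _ p
    rw [hp] at h1
    have h2 : A.dist (A.root w) = 0 := R.root_dist w w.2
    have h3 : A.dist ((⟨A.root w, R.root_lt w w.2⟩ : Fin n) : ℕ) = 0 := h2
    omega

/-- Searches start at vertices in increasing order, so the root is at most every vertex of its
component (`root_le`). This identifies the node picked by the program with the least one. -/
theorem minRoot_eq (R : Result n Λ (natAdj H) A sS sE) (i : ℕ) (w : Fin n) :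
    minRoot n i H (H.connectedComponentMk w) = ⟨A.root w, R.root_lt w w.2⟩ := by
  refine le_antisymm ?_ ?_
  · have := minRoot_le i H ⟨A.root w, R.root_lt w w.2⟩
    rwa [SimpleGraph.ConnectedComponent.eq.2 (R.reachable_root w)] at this
  · have h1 := SimpleGraph.ConnectedComponent.eq.1 (minRoot_valid n i H (H.connectedComponentMk w))
    have h2 := R.root_le _ (minRoot n i H (H.connectedComponentMk w)).2
    rw [R.reachable_iff.1 h1] at h2
    exact h2

/-- The test for the selection of an edge. -/
theorem mem_cutEdges_iff (R : Result n Λ (natAdj H) A sS sE) {L : Fin n → ℕ} (hL : ∀ v, L v < Λ)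
    (i : ℕ) {u w : Fin n} (huw : H.Adj u w) :
    s(u, w) ∈ cutEdges Λ H (minRoot n i H) L ↔
      (if A.dist w < A.dist u then A.res w else A.res u) = L ⟨A.root u, R.root_lt u u.2⟩ := by
  have hroot := R.root_eq_of_reachable huw.reachable
  have hd := R.dist_eq w
  have e : (⟨A.root w, R.root_lt w w.2⟩ : Fin n) = ⟨A.root u, R.root_lt u u.2⟩ := Fin.ext hroot
  rw [e] at hd
  rw [mem_cutEdges hL, R.minRoot_eq, hd, R.dist_eq u, R.res_eq u u.2, R.res_eq w w.2]
  simp only [huw, true_and]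
  split_ifs with h
  · rw [min_eq_right h.le]
  · rw [min_eq_left (by omega)]

end SearchData.Result

namespace RAM

/-! ## The input -/

/-- The part of the encoding that the program never changes. -/
structure Input {n q : ℕ} (M : PairwiseMRF n q) (r Λ : ℕ) (σ : State) : Prop where
  size_n : σ.nat 0 0 = n
  size_q : σ.nat 0 1 = q
  param_r : σ.nat 0 2 = r
  param_Λ : σ.nat 0 3 = Λ
  off_zero : σ.nat 1 0 = 0
  off_succ : ∀ v : Fin n,
    σ.nat 1 ((v : ℕ) + 1) = σ.nat 1 (v : ℕ) + (M.graph.neighborSet v).ncard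
  neighbours : ∀ v u : Fin n, M.graph.Adj v u ↔
    ∃ s, σ.nat 1 (v : ℕ) ≤ s ∧ s < σ.nat 1 ((v : ℕ) + 1) ∧ σ.nat 2 s = (u : ℕ)
  vertex_pot : ∀ (v : Fin n) (a : Fin q), σ.real 0 ((v : ℕ) * q + (a : ℕ)) = (M.φ v a : ℝ)
  edge_pot : ∀ (v u : Fin n) (s : ℕ), σ.nat 1 (v : ℕ) ≤ s → s < σ.nat 1 ((v : ℕ) + 1) →
    σ.nat 2 s = (u : ℕ) → ∀ a b : Fin q,
      σ.real 1 ((s * q + (a : ℕ)) * q + (b : ℕ)) =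
        if v < u then (M.ψ v u a b : ℝ) else (M.ψ u v b a : ℝ)

variable {n q : ℕ} {M : PairwiseMRF n q} {r Λ : ℕ} {σ : State}

theorem Encodes.input {L : Draws n r Λ} (h : Encodes M r Λ L σ) : Input M r Λ σ :=
  ⟨h.size_n, h.size_q, h.param_r, h.param_Λ, h.off_zero, h.off_succ, h.neighbours, h.vertex_pot,
    h.edge_pot⟩

theorem Input.congr (h : Input M r Λ σ) {σ' : State} (h0 : σ'.nat 0 = σ.nat 0)
    (h1 : σ'.nat 1 = σ.nat 1) (h2 : σ'.nat 2 = σ.nat 2) (h3 : σ'.real 0 = σ.real 0)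
    (h4 : σ'.real 1 = σ.real 1) : Input M r Λ σ' := by
  constructor
  · rw [h0]; exact h.size_n
  · rw [h0]; exact h.size_q
  · rw [h0]; exact h.param_r
  · rw [h0]; exact h.param_Λ
  · rw [h1]; exact h.off_zero
  · rw [h1]; exact h.off_succ
  · rw [h1, h2]; exact h.neighbours
  · rw [h3]; exact h.vertex_pot
  · rw [h1, h2, h4]; exact h.edge_pot

theorem Input.of_agree (h : Input M r Λ σ) {σ' : State} {p : Prog} (ha : Agree p σ σ')
    (h0 : p.writesNat 0 = false) (h1 : p.writesNat 1 = false) (h2 : p.writesNat 2 = false)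
    (h3 : p.writesReal 0 = false) (h4 : p.writesReal 1 = false) : Input M r Λ σ' :=
  h.congr (ha.nat 0 h0) (ha.nat 1 h1) (ha.nat 2 h2) (ha.real 0 h3) (ha.real 1 h4)

theorem Input.off_le (h : Input M r Λ σ) {v : ℕ} (hv : v < n) : σ.nat 1 v ≤ σ.nat 1 (v + 1) := by
  have := h.off_succ ⟨v, hv⟩
  dsimp only at this
  omega

/-- The neighbours in the cells of `v` are distinct, and there are no others. -/
theorem Input.cells (h : Input M r Λ σ) (v : Fin n) :
    (∀ s, σ.nat 1 v ≤ s → s < σ.nat 1 (v + 1) →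
      ∃ u : Fin n, σ.nat 2 s = u ∧ M.graph.Adj v u) ∧
    Set.InjOn (σ.nat 2) (Set.Ico (σ.nat 1 v) (σ.nat 1 (v + 1))) := by
  classical
  set I := Finset.Ico (σ.nat 1 v) (σ.nat 1 (v + 1)) with hI
  set N := (M.graph.neighborSet v).toFinset.image (fun u : Fin n => (u : ℕ)) with hN
  -- Counting: `v` has as many cells as neighbours, and every neighbour occurs in some cell. Hence
  -- each occurs once and nothing else occurs.
  have hNc : N.card = I.card := by
    rw [hN, Finset.card_image_of_injective _ Fin.val_injective, hI, Nat.card_Ico, h.off_succ v,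
      Nat.add_sub_cancel_left, Set.ncard_eq_toFinset_card']
  have hsub : N ⊆ I.image (σ.nat 2) := by
    intro x hx
    obtain ⟨u, hu, rfl⟩ := Finset.mem_image.1 hx
    obtain ⟨s, h1, h2, h3⟩ := (h.neighbours v u).1 (by simpa using hu)
    exact Finset.mem_image.2 ⟨s, Finset.mem_Ico.2 ⟨h1, h2⟩, h3⟩
  have hcard : (I.image (σ.nat 2)).card = I.card :=
    le_antisymm Finset.card_image_le (hNc ▸ Finset.card_le_card hsub)
  have heq : N = I.image (σ.nat 2) := Finset.eq_of_subset_of_card_le hsub (by omega)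
  constructor
  · intro s h1 h2
    have : σ.nat 2 s ∈ N := by
      rw [heq]; exact Finset.mem_image_of_mem _ (Finset.mem_Ico.2 ⟨h1, h2⟩)
    obtain ⟨u, hu, e⟩ := Finset.mem_image.1 this
    exact ⟨u, e.symm, by simpa using hu⟩
  · have := Finset.card_image_iff.1 hcard
    rwa [hI, Finset.coe_Ico] at this

theorem Input.off_eq_sum (h : Input M r Λ σ) {k : ℕ} (hk : k ≤ n) :
    σ.nat 1 k = ∑ v ∈ Finset.range k, (σ.nat 1 (v + 1) - σ.nat 1 v) := by
  induction k with
  | zero => simpa using h.off_zero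
  | succ k ih =>
    have := h.off_le (v := k) (by omega)
    rw [Finset.sum_range_succ, ← ih (by omega)]
    omega

/-- The array `26` marks the cells of the edges in `B`. -/
def CutMarks (n : ℕ) (σ : State) (B : Set (Sym2 (Fin n))) : Prop :=
  ∀ (u w : Fin n) (s : ℕ), σ.nat 1 u ≤ s → s < σ.nat 1 (u + 1) → σ.nat 2 s = w →
    (σ.nat 26 s ≠ 0 ↔ s(u, w) ∈ B)

theorem CutMarks.congr {B : Set (Sym2 (Fin n))} (h : CutMarks n σ B) {σ' : State}
    (h1 : σ'.nat 1 = σ.nat 1) (h2 : σ'.nat 2 = σ.nat 2) (h3 : σ'.nat 26 = σ.nat 26) :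
    CutMarks n σ' B := by
  unfold CutMarks
  rw [h1, h2, h3]; exact h

theorem natAdj_lt {H : SimpleGraph (Fin n)} (u w : ℕ) (h : natAdj H u w) : u < n ∧ w < n :=
  ⟨h.1, h.2.1⟩

theorem natAdj_symm {H : SimpleGraph (Fin n)} (u w : ℕ) (h : natAdj H u w) : natAdj H w u :=
  ⟨h.2.1, h.1, h.2.2.symm⟩

theorem natAdj_of_cell (h : Input M r Λ σ) {B : Set (Sym2 (Fin n))} (hB : CutMarks n σ B) {u s : ℕ}
    (hu : u < n) (h1 : σ.nat 1 u ≤ s) (h2 : s < σ.nat 1 (u + 1)) (h3 : σ.nat 26 s = 0) :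
    natAdj (M.graph.deleteEdges B) u (σ.nat 2 s) := by
  obtain ⟨w, hw, hadj⟩ := (h.cells ⟨u, hu⟩).1 s h1 h2
  rw [hw]
  refine ⟨hu, w.2, ?_⟩
  rw [SimpleGraph.deleteEdges_adj]
  exact ⟨hadj, fun hmem => (hB ⟨u, hu⟩ w s h1 h2 hw).2 hmem h3⟩

theorem exists_cell (h : Input M r Λ σ) {B : Set (Sym2 (Fin n))} (hB : CutMarks n σ B) {u w : ℕ}
    (hadj : natAdj (M.graph.deleteEdges B) u w) :
    ∃ s, σ.nat 1 u ≤ s ∧ s < σ.nat 1 (u + 1) ∧ σ.nat 26 s = 0 ∧ σ.nat 2 s = w := by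
  obtain ⟨hu, hw, hadj⟩ := hadj
  rw [SimpleGraph.deleteEdges_adj] at hadj
  obtain ⟨s, h1, h2, h3⟩ := (h.neighbours ⟨u, hu⟩ ⟨w, hw⟩).1 hadj.1
  refine ⟨s, h1, h2, ?_, h3⟩
  by_contra hne
  exact hadj.2 ((hB ⟨u, hu⟩ ⟨w, hw⟩ s h1 h2 h3).1 hne)

/-! ## The search -/

/-- Append `w` to the queue. -/
def pushProg (w d m ρ : NExp) : Prog :=
  .seq (.setNat 20 w (.lit 1)) <| .seq (.setNat 21 (.var 13) w) <| .seq (.setNat 22 w d) <|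
  .seq (.setNat 23 w m) <| .seq (.setNat 24 w ρ) (.setVar 13 (.add (.var 13) (.lit 1)))

/-- `(m + 1) mod Λ`, where `m < Λ`. -/
def succMod (m : NExp) : NExp :=
  .mul (.add m (.lit 1))
    (.sub (.lit 1) (.sub (.lit 1) (.sub (.get 0 (.lit 3)) (.add m (.lit 1)))))

/-- Visit the neighbour of `u` in the cell `s`. -/
def scanProg : Prog :=
  .seq (.setVar 16 (.get 2 (.var 15))) <|
  .cond (.natEq (.get 26 (.var 15)) (.lit 0))
    (.cond (.natEq (.get 20 (.var 16)) (.lit 0))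
      (pushProg (.var 16) (.add (.get 22 (.var 14)) (.lit 1)) (succMod (.get 23 (.var 14)))
        (.get 24 (.var 14))) .skip) .skip

/-- Process the first vertex of the queue. -/
def expandProg : Prog :=
  .seq (.setVar 14 (.get 21 (.var 12))) <|
  .seq (forLoop 15 (.get 1 (.var 14)) (.get 1 (.add (.var 14) (.lit 1))) scanProg)
    (.setVar 12 (.add (.var 12) (.lit 1)))

/-- The search from `v`. -/
def exploreProg : Prog :=
  .seq (.setNat 27 (.var 11) (.var 13)) <|
  .seq (pushProg (.var 11) (.lit 0) (.lit 0) (.var 11)) <|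
  .seq (.loop (.natLt (.var 12) (.var 13)) expandProg) (.setNat 28 (.var 11) (.var 13))

/-- The search of the whole graph. -/
def sweepProg : Prog :=
  .seq (.setVar 12 (.lit 0)) <| .seq (.setVar 13 (.lit 0)) <|
  forLoop 11 (.lit 0) (.get 0 (.lit 0))
    (.cond (.natEq (.get 20 (.var 11)) (.lit 0)) exploreProg .skip)

/-- Remove all visited marks. -/
def clearProg : Prog := forLoop 11 (.lit 0) (.get 0 (.lit 0)) (.setNat 20 (.var 11) (.lit 0))

/-- The arrays of the search in a state. -/
def State.search (σ : State) : SearchData := ⟨σ.nat 20, σ.nat 21, σ.nat 22, σ.nat 23, σ.nat 24⟩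

/-- The machine has no division, so residues are updated along the search. The nested truncated
subtraction is the indicator of `m + 1 < Λ`, which resets the product to `0` at `Λ`. -/
theorem succMod_val {m : NExp} {d : ℕ} (hΛ : 0 < Λ) (hp : σ.nat 0 3 = Λ) (hm : m.val σ = d % Λ) :
    (succMod m).val σ = (d + 1) % Λ := by
  simp only [succMod, NExp.val, hp, hm]
  have h1 := Nat.mod_lt d hΛ
  have h2 : (d + 1) % Λ = (d % Λ + 1) % Λ := by rw [Nat.mod_add_mod]
  rw [h2]
  rcases (by omega : d % Λ + 1 < Λ ∨ d % Λ + 1 = Λ) with h | h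
  · rw [Nat.mod_eq_of_lt h]
    have : 1 - (1 - (Λ - (d % Λ + 1))) = 1 := by omega
    rw [this, mul_one]
  · rw [h]; simp

/-- The state-level invariant during the search from `v`. -/
structure SearchInv (n Λ : ℕ) (E : ℕ → ℕ → Prop) (v st h : ℕ) (σ : State) : Prop where
  core : σ.search.Core n Λ E (σ.nat 13 0) h
  comp : σ.search.Comp v st h (σ.nat 13 0)
  segs : SearchData.Segs n σ.search (σ.nat 27) (σ.nat 28) (σ.nat 13 0) v
  before : ∀ x < v, σ.nat 20 x ≠ 0
  vis_root : σ.nat 20 v ≠ 0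
  start : σ.nat 27 v = st

theorem SearchInv.congr {E : ℕ → ℕ → Prop} {v st h : ℕ} (H : SearchInv n Λ E v st h σ) {σ' : State}
    (h0 : σ'.search = σ.search) (h1 : σ'.nat 13 0 = σ.nat 13 0) (h2 : σ'.nat 27 = σ.nat 27)
    (h3 : σ'.nat 28 = σ.nat 28) : SearchInv n Λ E v st h σ' := by
  have h4 : σ'.nat 20 = σ.nat 20 := congrArg SearchData.vis h0
  obtain ⟨a, b, c, d, e, f⟩ := H
  constructor
  · rwa [h0, h1]
  · rwa [h0, h1]
  · rwa [h0, h1, h2, h3]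
  · rwa [h4]
  · rwa [h4]
  · rwa [h2]

/-- The arrays are written one after the other while the expressions are still to be evaluated. Each
expression is therefore required to depend only on arrays that are untouched when its value is
needed. -/
theorem runs_pushProg {w d m ρ : NExp} {Q : State → ℕ → Prop} {x dv mv ρv t : ℕ}
    (hw : ∀ σ' : State, σ'.nat 16 = σ.nat 16 → σ'.nat 11 = σ.nat 11 → w.val σ' = x)
    (hd : ∀ σ' : State, σ'.nat 14 = σ.nat 14 → σ'.nat 22 = σ.nat 22 → d.val σ' = dv)
    (hm : ∀ σ' : State, σ'.nat 14 = σ.nat 14 → σ'.nat 23 = σ.nat 23 → σ'.nat 0 = σ.nat 0 →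
      m.val σ' = mv)
    (hρ : ∀ σ' : State, σ'.nat 14 = σ.nat 14 → σ'.nat 24 = σ.nat 24 → σ'.nat 11 = σ.nat 11 →
      ρ.val σ' = ρv)
    (ht : σ.nat 13 0 = t)
    (hQ : ∀ σ' : State, σ'.search = σ.search.push t x dv mv ρv → σ'.nat 13 0 = t + 1 →
      (∀ a, (pushProg w d m ρ).writesNat a = false → σ'.nat a = σ.nat a) →
      σ'.real = σ.real → Q σ' 6) :
    Runs (pushProg w d m ρ) σ Q := by
  have key : Runs (pushProg w d m ρ) σ fun σ' k => k = 6 ∧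
      σ'.search = σ.search.push t x dv mv ρv ∧ σ'.nat 13 0 = t + 1 := by
    unfold pushProg
    simp only [runs_seq, runs_setNat]
    refine ⟨trivial, ?_, ?_⟩
    · rw [hw σ rfl rfl, hw _ (by simp) (by simp), hw _ (by simp) (by simp), hw _ (by simp) (by simp),
        hw _ (by simp) (by simp), hd _ (by simp) (by simp), hm _ (by simp) (by simp) (by simp),
        hρ _ (by simp) (by simp) (by simp)]
      simp [State.search, SearchData.push, NExp.val, ht]
    · simp [NExp.val, ht]
  refine key.mono fun σ' k hag h => ?_
  rw [h.1]
  exact hQ σ' h.2.1 h.2.2 hag.nat (funext fun a => hag.real a rfl)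

theorem runs_scanProg {E : ℕ → ℕ → Prop} {v st h u s : ℕ} (hin : Input M r Λ σ) (hΛ : 0 < Λ)
    (H : SearchInv n Λ E v st h σ) (hh : h < σ.nat 13 0) (hu : σ.nat 21 h = u)
    (hvar : σ.nat 14 0 = u) (hs : σ.nat 15 0 = s) (hun : u < n)
    (hE : σ.nat 26 s = 0 → E u (σ.nat 2 s)) (hEn : ∀ u w, E u w → u < n ∧ w < n) :
    Runs scanProg σ fun σ' t => (SearchInv n Λ E v st h σ' ∧ h < σ'.nat 13 0 ∧
      (∀ k ≤ h, σ'.nat 21 k = σ.nat 21 k) ∧ (∀ x, σ.nat 20 x ≠ 0 → σ'.nat 20 x ≠ 0) ∧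
      (σ.nat 26 s = 0 → σ'.nat 20 (σ.nat 2 s) ≠ 0)) ∧ t ≤ 9 := by
  unfold scanProg
  rw [runs_seq, runs_setNat]
  simp only [NExp.val, hs]
  set σ₁ := σ.writeNat 16 0 (σ.nat 2 s) with hσ₁
  have H₁ : SearchInv n Λ E v st h σ₁ := H.congr rfl rfl rfl rfl
  by_cases hcut : σ.nat 26 s = 0
  · rw [runs_cond_of_true (by simp [Test.Holds, NExp.val, hσ₁, hs, hcut])]
    by_cases hvis : σ.nat 20 (σ.nat 2 s) = 0
    · rw [runs_cond_of_true (by simp [Test.Holds, NExp.val, hσ₁, hvis])]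
      have huq : σ.search.queue h = u := hu
      have huv : σ.nat 20 u ≠ 0 := by
        have := H.core.queue_vis h hh
        rwa [huq] at this
      have hroot : σ.nat 24 u = v := by
        have := (H.comp.seg h hh).2 H.comp.st_le
        rwa [huq] at this
      refine runs_pushProg (x := σ.nat 2 s) (dv := σ.nat 22 u + 1) (mv := (σ.nat 22 u + 1) % Λ)
        (ρv := σ.nat 24 u) (t := σ.nat 13 0) ?_ ?_ ?_ ?_ (by simp [hσ₁]) ?_
      · intro σ' h1 _; simp [NExp.val, h1, hσ₁]
      · intro σ' h1 h2; simp [NExp.val, h1, h2, hσ₁, hvar]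
      · intro σ' h1 h2 h3
        refine succMod_val hΛ ?_ ?_
        · rw [h3]; exact hin.param_Λ
        · simp only [NExp.val, h1, h2]
          change σ.nat 23 (σ.nat 14 0) = _
          rw [hvar]
          exact H.core.res_eq u hun huv
      · intro σ' h1 h2 _; simp [NExp.val, h1, h2, hσ₁, hvar]
      · intro σ' h1 h2 h3 _
        have h27 : σ'.nat 27 = σ.nat 27 := by rw [h3 27 rfl]; rfl
        have h28 : σ'.nat 28 = σ.nat 28 := by rw [h3 28 rfl]; rfl
        have hs1 : σ₁.search = σ.search := rfl
        rw [hs1] at h1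
        have hv20 : σ'.nat 20 = Function.update (σ.nat 20) (σ.nat 2 s) 1 :=
          congrArg SearchData.vis h1
        have hv21 : σ'.nat 21 = Function.update (σ.nat 21) (σ.nat 13 0) (σ.nat 2 s) :=
          congrArg SearchData.queue h1
        have hwn := (hEn _ _ (hE hcut)).2
        have hmono : ∀ x, σ.nat 20 x ≠ 0 → σ'.nat 20 x ≠ 0 := by
          intro x hx
          rw [hv20, Function.update_of_ne]
          · exact hx
          · rintro rfl; exact hx hvis
        -- All vertices below `v` have been visited, and this one has not. So the root stays the
        -- least vertex of its component.
        have hvle : v ≤ σ.nat 2 s := by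
          by_contra! hlt
          exact H.before _ hlt hvis
        refine ⟨⟨⟨?_, ?_, ?_, ?_, ?_, ?_⟩, by rw [h2]; omega, ?_, hmono, ?_⟩, by omega⟩
        · rw [h1, h2]
          refine H.core.push H.comp.h_le hwn hvis (Or.inr ⟨u, hun, huv, hE hcut, rfl, rfl, ?_⟩)
          rw [hroot]; exact hvle
        · rw [h1, h2]
          have := H.comp.push (m := (σ.nat 22 u + 1) % Λ) H.core hh hvis
          rw [huq] at this
          exact this
        · rw [h1, h2, h27, h28, hroot]
          exact H.segs.push H.core hvis (Or.inr H.vis_root)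
        · exact fun x hx => hmono x (H.before x hx)
        · exact hmono v H.vis_root
        · rw [h27]; exact H.start
        · intro k hk
          rw [hv21, Function.update_of_ne (by omega)]
        · intro _
          rw [hv20, Function.update_self]; exact one_ne_zero
    · rw [runs_cond_of_false (by simp [Test.Holds, NExp.val, hσ₁, hvis]), runs_skip]
      exact ⟨⟨H₁, hh, fun _ _ => rfl, fun _ hx => hx, fun _ => hvis⟩, by omega⟩
  · rw [runs_cond_of_false (by simp [Test.Holds, NExp.val, hσ₁, hs, hcut]), runs_skip]
    exact ⟨⟨H₁, hh, fun _ _ => rfl, fun _ hx => hx, fun h => absurd h hcut⟩, by omega⟩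

/-- The bound for the number of steps that are used to process the first `h` vertices. -/
def queueCost (off queue : ℕ → ℕ) (h : ℕ) : ℕ :=
  ∑ k ∈ Finset.range h, (11 * (off (queue k + 1) - off (queue k)) + 6)

/-- Vertices in the queue are distinct, so the costs of processing them add up to at most one pass
over all vertices and all adjacency cells. -/
theorem queueCost_le {E : ℕ → ℕ → Prop} {t h : ℕ} {A : SearchData} (hin : Input M r Λ σ)
    (H : A.Core n Λ E t h) (hh : h ≤ t) : queueCost (σ.nat 1) A.queue h ≤ 11 * σ.nat 1 n + 6 * n := by
  have h1 : queueCost (σ.nat 1) A.queue h =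
      ∑ v ∈ (Finset.range h).image A.queue, (11 * (σ.nat 1 (v + 1) - σ.nat 1 v) + 6) := by
    rw [Finset.sum_image]
    · rfl
    · intro i hi j hj
      exact H.queue_inj i (by simp at hi; omega) j (by simp at hj; omega)
  have hsub : (Finset.range h).image A.queue ⊆ Finset.range n := by
    intro x hx
    obtain ⟨k, hk, rfl⟩ := Finset.mem_image.1 hx
    exact Finset.mem_range.2 (H.queue_lt k (by simp at hk; omega))
  rw [h1]
  refine (Finset.sum_le_sum_of_subset hsub).trans ?_
  rw [Finset.sum_add_distrib, ← Finset.mul_sum, ← hin.off_eq_sum le_rfl]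
  simp [mul_comm]

/-- Each cell costs at most `9` steps and `2` for the loop, which is the `11` in `queueCost`. When
all cells are scanned, `Core.advance` moves the head. -/
theorem runs_expandProg {v st h : ℕ} (hin : Input M r Λ σ) (hΛ : 0 < Λ)
    {B : Set (Sym2 (Fin n))} (hB : CutMarks n σ B)
    (H : SearchInv n Λ (natAdj (M.graph.deleteEdges B)) v st h σ) (hhd : σ.nat 12 0 = h)
    (hh : h < σ.nat 13 0) :
    Runs expandProg σ fun σ' t =>
      (SearchInv n Λ (natAdj (M.graph.deleteEdges B)) v st (h + 1) σ' ∧ σ'.nat 12 0 = h + 1) ∧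
      queueCost (σ.nat 1) (σ.nat 21) h + t + 1 ≤ queueCost (σ.nat 1) (σ'.nat 21) (h + 1) := by
  set E := natAdj (M.graph.deleteEdges B) with hE
  unfold expandProg
  rw [runs_seq, runs_setNat]
  simp only [NExp.val, hhd]
  set u := σ.nat 21 h with hu
  set σ₁ := σ.writeNat 14 0 u with hσ₁
  have hun : u < n := H.core.queue_lt h hh
  have H₁ : SearchInv n Λ E v st h σ₁ := H.congr rfl rfl rfl rfl
  have hin₁ : Input M r Λ σ₁ := hin.congr rfl rfl rfl rfl rfl
  have hoff := hin.off_le hun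
  rw [runs_seq]
  have hloop := runs_for_sum (σ := σ₁) (i := 15) (lo := .get 1 (.var 14))
    (hi := .get 1 (.add (.var 14) (.lit 1))) (body := scanProg)
    (fun s σ' => SearchInv n Λ E v st h σ' ∧ h < σ'.nat 13 0 ∧
      (∀ k ≤ h, σ'.nat 21 k = σ.nat 21 k) ∧
      ∀ s', σ.nat 1 u ≤ s' → s' < s → σ.nat 26 s' = 0 → σ'.nat 20 (σ.nat 2 s') ≠ 0)
    (fun _ => 9) (a := σ.nat 1 u) (b := σ.nat 1 (u + 1))
    (by simp [NExp.val, hσ₁]) hoff ?_ rfl ?_ ?_ ?_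
  · refine hloop.mono fun σ₂ t hag hq => ?_
    obtain ⟨⟨H₂, hh₂, hQ₂, hscan⟩, ht⟩ := hq
    rw [runs_setNat]
    have h12 : σ₂.nat 12 0 = h := by rw [hag.nat 12 rfl]; exact hhd
    simp only [NExp.val, h12]
    -- Every edge of the current graph at the head has an unmarked cell, so its other end was
    -- visited in the loop.
    have hadv := H₂.core.advance natAdj_lt natAdj_symm H₂.comp hh₂ (by
      intro w hw
      have hq : σ₂.search.queue h = u := hQ₂ h le_rfl
      rw [hq] at hw
      obtain ⟨s, h1, h2, h3, h4⟩ := exists_cell hin hB hw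
      have := hscan s h1 h2 h3
      rwa [h4] at this)
    refine ⟨⟨⟨hadv.1, hadv.2, H₂.segs, H₂.before, H₂.vis_root, H₂.start⟩, by simp⟩, ?_⟩
    have e1 : queueCost (σ.nat 1) (σ.nat 21) h = queueCost (σ.nat 1) (σ₂.nat 21) h := by
      refine Finset.sum_congr rfl fun k hk => ?_
      rw [hQ₂ k (by simp at hk; omega)]
    have e2 : queueCost (σ.nat 1) (σ₂.nat 21) (h + 1) = queueCost (σ.nat 1) (σ₂.nat 21) h +
        (11 * (σ.nat 1 (u + 1) - σ.nat 1 u) + 6) := by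
      unfold queueCost
      rw [Finset.sum_range_succ, hQ₂ h le_rfl]
    have e3 : (σ₂.writeNat 12 0 (h + 1)).nat 21 = σ₂.nat 21 := rfl
    rw [e3, e1, e2]
    simp only [Finset.sum_const, Nat.card_Ico, smul_eq_mul] at ht
    omega
  · intro σ' hag
    simp only [NExp.val]
    rw [hag.nat 1 rfl, hag.nat 14 rfl]
    simp [hσ₁]
  · rintro k σ' x ⟨h1, h2, h3, h4⟩
    exact ⟨h1.congr rfl rfl rfl rfl, h2, h3, h4⟩
  · rintro s σ' hs1 hs2 hag hs ⟨h1, h2, h3, h4⟩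
    have h26 : σ'.nat 26 = σ.nat 26 := by rw [hag.nat 26 rfl]; rfl
    have hn2 : σ'.nat 2 = σ.nat 2 := by rw [hag.nat 2 rfl]; rfl
    have hin' : Input M r Λ σ' := hin₁.of_agree hag rfl rfl rfl rfl rfl
    refine (runs_scanProg (E := E) hin' hΛ h1 h2 (h3 h le_rfl) ?_ hs hun ?_ natAdj_lt).mono ?_
    · rw [hag.nat 14 rfl]; simp [hσ₁, hu]
    · intro h0
      rw [hn2]
      rw [h26] at h0
      exact natAdj_of_cell hin hB hun hs1 hs2 h0
    · rintro σ'' t - ⟨⟨a1, a2, a3, a4, a5⟩, ht⟩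
      refine ⟨⟨a1, a2, fun k hk => (a3 k hk).trans (h3 k hk), fun s' b1 b2 b3 => ?_⟩, ht⟩
      rcases (by omega : s' < s ∨ s' = s) with b4 | rfl
      · exact a4 _ (h4 s' b1 b4 b3)
      · rw [h26, hn2] at a5
        exact a5 b3
  · exact ⟨H₁, hh, fun _ _ => rfl, fun s' h1 h2 => by omega⟩

/-- The state-level invariant between the searches from different vertices. -/
structure SweepInv (n Λ : ℕ) (E : ℕ → ℕ → Prop) (v : ℕ) (σ : State) : Prop where
  core : σ.search.Core n Λ E (σ.nat 13 0) (σ.nat 13 0)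
  segs : SearchData.Segs n σ.search (σ.nat 27) (σ.nat 28) (σ.nat 13 0) n
  before : ∀ x < v, σ.nat 20 x ≠ 0
  head : σ.nat 12 0 = σ.nat 13 0

/-- The time is measured by the growth of `queueCost`, so that the searches of all components
together cost one pass over the graph. The two recorded positions of the queue delimit the segment
of the component. -/
theorem runs_exploreProg {v : ℕ} (hin : Input M r Λ σ) (hΛ : 0 < Λ)
    {B : Set (Sym2 (Fin n))} (hB : CutMarks n σ B)
    (H : SweepInv n Λ (natAdj (M.graph.deleteEdges B)) v σ) (hvar : σ.nat 11 0 = v) (hv : v < n)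
    (hvis : σ.nat 20 v = 0) :
    Runs exploreProg σ fun σ' t =>
      SweepInv n Λ (natAdj (M.graph.deleteEdges B)) (v + 1) σ' ∧
      queueCost (σ.nat 1) (σ.nat 21) (σ.nat 13 0) + t ≤
        queueCost (σ.nat 1) (σ'.nat 21) (σ'.nat 13 0) + 9 := by
  set E := natAdj (M.graph.deleteEdges B) with hE
  unfold exploreProg
  rw [runs_seq, runs_setNat]
  simp only [NExp.val, hvar]
  set st := σ.nat 13 0 with hst
  set σ₁ := σ.writeNat 27 v st with hσ₁
  rw [runs_seq]
  refine runs_pushProg (x := v) (dv := 0) (mv := 0) (ρv := v) (t := st) ?_ ?_ ?_ ?_ ?_ ?_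
  · intro σ' _ h1; simp [NExp.val, h1, hσ₁, hvar]
  · intros; rfl
  · intros; rfl
  · intro σ' _ _ h1; simp [NExp.val, h1, hσ₁, hvar]
  · simp [hσ₁, hst]
  intro σ₂ h1 h2 h3 hreal
  have hs1 : σ₁.search = σ.search := rfl
  rw [hs1] at h1
  have h27 : σ₂.nat 27 = Function.update (σ.nat 27) v st := by rw [h3 27 rfl]; simp [hσ₁]
  have h28 : σ₂.nat 28 = σ.nat 28 := by rw [h3 28 rfl]; rfl
  have h12 : σ₂.nat 12 0 = st := by rw [h3 12 rfl]; exact H.head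
  have hv20 : σ₂.nat 20 = Function.update (σ.nat 20) v 1 := congrArg SearchData.vis h1
  have hv21 : σ₂.nat 21 = Function.update (σ.nat 21) st v := congrArg SearchData.queue h1
  have hseg0 : SearchData.Segs n σ.search (Function.update (σ.nat 27) v st) (σ.nat 28) st v := by
    intro x hx hxv hvx hrx
    rw [Function.update_of_ne hxv]
    exact H.segs x hx hx.ne hvx hrx
  have H₂ : SearchInv n Λ E v st (σ₂.nat 12 0) σ₂ := by
    have hc := H.core.push (Λ := Λ) le_rfl hv hvis (d := 0) (ρ := v) (Or.inl ⟨rfl, rfl⟩)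
    rw [Nat.zero_mod] at hc
    refine ⟨?_, ?_, ?_, ?_, ?_, ?_⟩
    · rw [h1, h2, h12]; exact hc
    · rw [h1, h2, h12]; exact SearchData.Comp.start H.core hvis
    · rw [h1, h2, h27, h28]; exact hseg0.push H.core hvis (Or.inl rfl)
    · intro x hx
      rw [hv20, Function.update_of_ne hx.ne]
      exact H.before x hx
    · rw [hv20, Function.update_self]; exact one_ne_zero
    · rw [h27, Function.update_self]
  have hin₂ : Input M r Λ σ₂ := hin.congr (h3 0 rfl) (h3 1 rfl) (h3 2 rfl) (by rw [hreal]; rfl)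
    (by rw [hreal]; rfl)
  have hB₂ : CutMarks n σ₂ B := hB.congr (h3 1 rfl) (h3 2 rfl) (h3 26 rfl)
  rw [runs_seq]
  have hoff : σ₂.nat 1 = σ.nat 1 := h3 1 rfl
  have hloop := runs_loop (σ := σ₂) (b := .natLt (.var 12) (.var 13)) (p := expandProg)
    (fun σ' => SearchInv n Λ E v st (σ'.nat 12 0) σ')
    (fun σ' => queueCost (σ.nat 1) (σ'.nat 21) (σ'.nat 12 0)) (11 * σ.nat 1 n + 6 * n)
    (fun σ' h' => queueCost_le hin h'.core h'.comp.h_le) ?_ H₂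
  · refine hloop.mono fun σ₃ t hag hq => ?_
    obtain ⟨H₃, hb, ht⟩ := hq
    rw [runs_setNat]
    have h11 : σ₃.nat 11 0 = v := by rw [hag.nat 11 rfl, h3 11 rfl]; exact hvar
    simp only [NExp.val, h11]
    have hhead : σ₃.nat 12 0 = σ₃.nat 13 0 := by
      simp only [Test.Holds, NExp.val] at hb
      have := H₃.comp.h_le
      omega
    have hs : (σ₃.writeNat 28 v (σ₃.nat 13 0)).search = σ₃.search := rfl
    have hcore := H₃.core
    have hcomp := H₃.comp
    rw [hhead] at hcore hcomp
    refine ⟨⟨?_, ?_, ?_, ?_⟩, ?_⟩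
    · exact hcore
    · rw [hs]
      have hseg1 : SearchData.Segs n σ₃.search (σ₃.nat 27)
          (Function.update (σ₃.nat 28) v (σ₃.nat 13 0)) (σ₃.nat 13 0) v := by
        intro x hx hxv hvx hrx
        rw [Function.update_of_ne hxv]
        exact H₃.segs x hx hxv hvx hrx
      have := hseg1.finish hcomp H₃.start (Function.update_self ..) n
      simpa using this
    · intro x hx
      rcases (by omega : x < v ∨ x = v) with hx | rfl
      · exact H₃.before x hx
      · exact H₃.vis_root
    · exact hhead
    · have e1 : queueCost (σ.nat 1) (σ₂.nat 21) st = queueCost (σ.nat 1) (σ.nat 21) st := by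
        refine Finset.sum_congr rfl fun k hk => ?_
        rw [hv21, Function.update_of_ne (by simp at hk; omega)]
      rw [h12, e1, hhead] at ht
      have e2 : (σ₃.writeNat 28 v (σ₃.nat 13 0)).nat 21 = σ₃.nat 21 := rfl
      have e3 : (σ₃.writeNat 28 v (σ₃.nat 13 0)).nat 13 = σ₃.nat 13 := rfl
      rw [e2, e3]
      omega
  · intro σ' hag hI hb
    have hin' : Input M r Λ σ' := hin₂.of_agree hag rfl rfl rfl rfl rfl
    have hB' : CutMarks n σ' B := hB₂.congr (hag.nat 1 rfl) (hag.nat 2 rfl) (hag.nat 26 rfl)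
    simp only [Test.Holds, NExp.val] at hb
    refine (runs_expandProg hin' hΛ hB' hI rfl hb).mono ?_
    rintro σ'' t - ⟨⟨a1, a2⟩, a3⟩
    rw [a2]
    rw [hag.nat 1 rfl, hoff] at a3
    exact ⟨a1, a3⟩

theorem runs_sweepProg (hin : Input M r Λ σ) (hΛ : 0 < Λ)
    {B : Set (Sym2 (Fin n))} (hB : CutMarks n σ B) (hvis : ∀ v < n, σ.nat 20 v = 0) :
    Runs sweepProg σ fun σ' t =>
      SearchData.Result n Λ (natAdj (M.graph.deleteEdges B)) σ'.search (σ'.nat 27) (σ'.nat 28) ∧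
      t ≤ 11 * σ.nat 1 n + 20 * n + 4 := by
  set E := natAdj (M.graph.deleteEdges B) with hE
  unfold sweepProg
  simp only [runs_seq, runs_setNat, NExp.val]
  set σ₁ := (σ.writeNat 12 0 0).writeNat 13 0 0 with hσ₁
  have hin₁ : Input M r Λ σ₁ := hin.congr rfl rfl rfl rfl rfl
  have hB₁ : CutMarks n σ₁ B := hB.congr rfl rfl rfl
  have hn : ∀ σ' : State, σ'.nat 0 = σ.nat 0 → σ'.nat 0 0 = n := fun σ' h => by
    rw [h]; exact hin.size_n
  have hloop := runs_for (σ := σ₁) (i := 11) (lo := .lit 0) (hi := .get 0 (.lit 0))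
    (body := .cond (.natEq (.get 20 (.var 11)) (.lit 0)) exploreProg .skip)
    (fun v σ' => SweepInv n Λ E v σ')
    -- The potential combines the amortised cost of the queue with a constant charge for each
    -- candidate root.
    (fun v σ' => queueCost (σ.nat 1) (σ'.nat 21) (σ'.nat 13 0) + 14 * v) (a := 0) (b := n)
    rfl (Nat.zero_le _) ?_ rfl ?_ ?_ ?_
  · refine hloop.mono fun σ' t _ hq => ⟨?_, ?_⟩
    · refine hq.1.core.result natAdj_lt hq.1.segs hq.1.before
    · have h1 := queueCost_le hin hq.1.core le_rfl
      have h2 := hq.2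
      change queueCost (σ.nat 1) (σ'.nat 21) (σ'.nat 13 0) ≤ _ at h1
      omega
  · intro σ' hag
    exact hn σ' (hag.nat 0 rfl)
  · intro k σ' x h
    exact ⟨⟨h.core, h.segs, h.before, h.head⟩, rfl⟩
  · intro v σ' _ hv hag hvar hI
    have hin' : Input M r Λ σ' := hin₁.of_agree hag rfl rfl rfl rfl rfl
    have hB' : CutMarks n σ' B := hB₁.congr (hag.nat 1 rfl) (hag.nat 2 rfl) (hag.nat 26 rfl)
    by_cases h0 : σ'.nat 20 v = 0
    · rw [runs_cond_of_true (by simp [Test.Holds, NExp.val, hvar, h0])]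
      refine (runs_exploreProg hin' hΛ hB' hI hvar hv h0).mono ?_
      rintro σ'' t - ⟨a1, a2⟩
      refine ⟨a1, ?_⟩
      rw [hag.nat 1 rfl] at a2
      change queueCost (σ.nat 1) _ _ + _ ≤ queueCost (σ.nat 1) _ _ + _ at a2
      omega
    · rw [runs_cond_of_false (by simp [Test.Holds, NExp.val, hvar, h0]), runs_skip]
      refine ⟨⟨hI.core, hI.segs, fun x hx => ?_, hI.head⟩, by omega⟩
      rcases (by omega : x < v ∨ x = v) with hx | rfl
      · exact hI.before x hx
      · exact h0
  · have ht : σ₁.nat 13 0 = 0 := by simp [hσ₁]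
    have hv0 : ∀ w < n, ¬ σ₁.search.vis w ≠ 0 := fun w hw h => h (hvis w hw)
    refine ⟨?_, ?_, fun x hx => absurd hx (Nat.not_lt_zero x), by simp [hσ₁]⟩
    · rw [ht]
      refine ⟨?_, ?_, ?_, ?_, ?_, ?_, ?_, ?_, ?_, ?_, ?_, ?_⟩
      · intro i hi; omega
      · intro i hi; omega
      · intro i hi; omega
      · intro w hw h; exact absurd h (hv0 w hw)
      · intro w hw h; exact absurd h (hv0 w hw)
      · intro w hw h; exact absurd h (hv0 w hw)
      · intro w hw h; exact absurd h (hv0 w hw)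
      · intro w hw h; exact absurd h (hv0 w hw)
      · intro w hw h; exact absurd h (hv0 w hw)
      · intro w hw h; exact absurd h (hv0 w hw)
      · intro w hw h; exact absurd h (hv0 w hw)
      · intro i hi; omega
    · intro x hx _ h; exact absurd h (hv0 x hx)

theorem runs_clearProg (hin : Input M r Λ σ) :
    Runs clearProg σ fun σ' t => (∀ v < n, σ'.nat 20 v = 0) ∧ t ≤ 3 * n + 2 := by
  unfold clearProg
  refine (runs_for_sum (fun v σ' => ∀ x < v, σ'.nat 20 x = 0) (fun _ => 1) (a := 0) (b := n) rfl
    (Nat.zero_le _) ?_ rfl ?_ ?_ ?_).mono ?_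
  · intro σ' hag
    simp only [NExp.val]
    rw [hag.nat 0 rfl]; exact hin.size_n
  · intro k σ' x h; exact h
  · intro v σ' _ hv _ hvar hI
    rw [runs_setNat]
    simp only [NExp.val, hvar]
    refine ⟨fun x hx => ?_, le_rfl⟩
    rw [nat_writeNat_self]
    by_cases hxv : x = v
    · rw [hxv, Function.update_self]
    · rw [Function.update_of_ne hxv]; exact hI x (by omega)
  · intro x hx; omega
  · rintro σ' t - ⟨h1, h2⟩
    refine ⟨h1, ?_⟩
    simp at h2
    omega

end RAM

namespace RAM

variable {n q : ℕ} {M : PairwiseMRF n q} {r Λ : ℕ} {σ : State}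

/-! ## The decomposition -/

theorem Input.off_mono (h : Input M r Λ σ) {u v : ℕ} (huv : u ≤ v) (hv : v ≤ n) :
    σ.nat 1 u ≤ σ.nat 1 v := by
  induction v, huv using Nat.le_induction with
  | base => exact le_rfl
  | succ v _ ih => exact (ih (by omega)).trans (h.off_le (by omega))

theorem Input.owner_unique (h : Input M r Λ σ) {u v s : ℕ} (hu : u < n) (hv : v < n)
    (h1 : σ.nat 1 u ≤ s) (h2 : s < σ.nat 1 (u + 1)) (h3 : σ.nat 1 v ≤ s)
    (h4 : s < σ.nat 1 (v + 1)) : u = v := by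
  rcases lt_trichotomy u v with hlt | rfl | hlt
  · have := h.off_mono (u := u + 1) (v := v) hlt hv.le
    omega
  · rfl
  · have := h.off_mono (u := v + 1) (v := u) hlt hu.le
    omega

/-- Draw a random number for every vertex. -/
def drawProg : Prog := forLoop 11 (.lit 0) (.get 0 (.lit 0)) (.draw 25 (.var 11))

/-- Mark the cell `s` of `u` if its edge is selected. -/
def markCell : Prog :=
  .seq (.setVar 16 (.get 2 (.var 15))) <|
  .seq (.cond (.natLt (.get 22 (.var 16)) (.get 22 (.var 14))) (.setVar 17 (.get 23 (.var 16)))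
    (.setVar 17 (.get 23 (.var 14)))) <|
  .cond (.natEq (.var 17) (.get 25 (.get 24 (.var 14)))) (.setNat 26 (.var 15) (.lit 1)) .skip

/-- Mark all selected edges. -/
def markProg : Prog :=
  forLoop 14 (.lit 0) (.get 0 (.lit 0)) <|
    forLoop 15 (.get 1 (.var 14)) (.get 1 (.add (.var 14) (.lit 1))) markCell

/-- One iteration of the decomposition. -/
def iterProg : Prog := .seq drawProg <| .seq clearProg <| .seq sweepProg markProg

/-- The decomposition. -/
def decompProg : Prog := forLoop 10 (.lit 0) (.get 0 (.lit 2)) iterProg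

/-- Exactly `n` numbers are consumed, one per vertex whether or not it is a root, so iteration `i`
reads the block of the stream that starts at `i n`. -/
theorem runs_drawProg (hin : Input M r Λ σ) :
    Runs drawProg σ fun σ' t => ((∀ v < n, σ'.nat 25 v = σ.coins v) ∧
      ∀ k, σ'.coins k = σ.coins (n + k)) ∧ t ≤ 3 * n + 2 := by
  unfold drawProg
  refine (runs_for_sum (fun v σ' => (∀ x < v, σ'.nat 25 x = σ.coins x) ∧
    ∀ k, σ'.coins k = σ.coins (v + k)) (fun _ => 1) (a := 0) (b := n) rfl
    (Nat.zero_le _) ?_ rfl ?_ ?_ ?_).mono ?_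
  · intro σ' hag
    simp only [NExp.val]
    rw [hag.nat 0 rfl]; exact hin.size_n
  · intro k σ' x h; exact h
  · intro v σ' _ hv _ hvar hI
    rw [runs_draw]
    simp only [NExp.val, hvar]
    refine ⟨⟨fun x hx => ?_, fun k => ?_⟩, le_rfl⟩
    · rw [nat_nextCoin, nat_writeNat_self]
      by_cases hxv : x = v
      · rw [hxv, Function.update_self, hI.2]; rfl
      · rw [Function.update_of_ne hxv]; exact hI.1 x (by omega)
    · change σ'.coins (k + 1) = _
      rw [hI.2]; congr 1; omega
  · exact ⟨fun x hx => by omega, fun k => by rw [zero_add]⟩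
  · rintro σ' t - ⟨h1, h2⟩
    refine ⟨h1, ?_⟩
    simp at h2
    omega

/-- The test for the edge in the cell `s` of `u`. -/
def Selected (σ : State) (u s : ℕ) : Prop :=
  (if σ.nat 22 (σ.nat 2 s) < σ.nat 22 u then σ.nat 23 (σ.nat 2 s) else σ.nat 23 u) =
    σ.nat 25 (σ.nat 24 u)

theorem runs_markCell {u s : ℕ} (hu : σ.nat 14 0 = u) (hs : σ.nat 15 0 = s) :
    Runs markCell σ fun σ' t =>
      ((∀ x, x ≠ s → σ'.nat 26 x = σ.nat 26 x) ∧
        (σ'.nat 26 s ≠ 0 ↔ σ.nat 26 s ≠ 0 ∨ Selected σ u s)) ∧ t ≤ 5 := by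
  unfold markCell
  have step : Runs (.cond (.natLt (.get 22 (.var 16)) (.get 22 (.var 14)))
      (.setVar 17 (.get 23 (.var 16))) (.setVar 17 (.get 23 (.var 14))))
      (σ.writeNat 16 0 (σ.nat 2 s)) fun σ' t => σ'.nat 17 0 =
        (if σ.nat 22 (σ.nat 2 s) < σ.nat 22 u then σ.nat 23 (σ.nat 2 s) else σ.nat 23 u) ∧
        t = 2 := by
    by_cases h : σ.nat 22 (σ.nat 2 s) < σ.nat 22 u
    · rw [runs_cond_of_true (by simp [Test.Holds, NExp.val, hu, h]), runs_setNat]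
      simp [NExp.val, h]
    · rw [runs_cond_of_false (by simp only [Test.Holds, NExp.val]; simpa [hu] using h), runs_setNat]
      simp [NExp.val, h, hu]
  rw [runs_seq, runs_setNat]
  simp only [NExp.val, hs]
  rw [runs_seq]
  refine step.mono fun σ' t hag h => ?_
  obtain ⟨h, rfl⟩ := h
  have h14 : σ'.nat 14 0 = u := by rw [hag.nat 14 rfl]; exact hu
  have h15 : σ'.nat 15 0 = s := by rw [hag.nat 15 rfl]; exact hs
  have h24 : σ'.nat 24 = σ.nat 24 := hag.nat 24 rfl
  have h25 : σ'.nat 25 = σ.nat 25 := hag.nat 25 rfl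
  have h26 : σ'.nat 26 = σ.nat 26 := hag.nat 26 rfl
  by_cases hsel : Selected σ u s
  · rw [runs_cond_of_true (by
      simp only [Test.Holds, NExp.val, h, h14, h24, h25]; exact hsel), runs_setNat]
    simp only [NExp.val, h15]
    refine ⟨⟨fun x hx => ?_, ?_⟩, by omega⟩
    · rw [nat_writeNat_self, Function.update_of_ne hx, h26]
    · simp [hsel]
  · rw [runs_cond_of_false (by
      simp only [Test.Holds, NExp.val, h, h14, h24, h25]; exact hsel), runs_skip]
    refine ⟨⟨fun x _ => by rw [h26], ?_⟩, by omega⟩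
    simp [hsel, h26]

/-- Each cell is decided on its own, and marking one cell does not influence the test for another.
Both cells of an edge become marked because, for a search result, the test expresses membership of
the edge. -/
theorem runs_markProg (hin : Input M r Λ σ) :
    Runs markProg σ fun σ' t =>
      (∀ u s, u < n → σ.nat 1 u ≤ s → s < σ.nat 1 (u + 1) →
        (σ'.nat 26 s ≠ 0 ↔ σ.nat 26 s ≠ 0 ∨ Selected σ u s)) ∧
      t ≤ 7 * σ.nat 1 n + 4 * n + 2 := by
  unfold markProg
  refine (runs_for_sum (fun v σ' => ∀ u s, u < n → σ.nat 1 u ≤ s → s < σ.nat 1 (u + 1) →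
        (σ'.nat 26 s ≠ 0 ↔ σ.nat 26 s ≠ 0 ∨ u < v ∧ Selected σ u s))
      (fun v => 7 * (σ.nat 1 (v + 1) - σ.nat 1 v) + 2) (a := 0) (b := n) rfl
      (Nat.zero_le _) ?_ rfl ?_ ?_ ?_).mono ?_
  · intro σ' hag
    simp only [NExp.val]
    rw [hag.nat 0 rfl]; exact hin.size_n
  · intro k σ' x h; exact h
  · intro v σ' _ hv hag hvar hI
    have h1 : σ'.nat 1 = σ.nat 1 := hag.nat 1 rfl
    have hlo : (NExp.get 1 (.var 14)).val σ' = σ.nat 1 v := by simp [NExp.val, hvar, h1]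
    refine (runs_for_sum (fun k σ'' => ∀ u s, u < n → σ.nat 1 u ≤ s → s < σ.nat 1 (u + 1) →
        (σ''.nat 26 s ≠ 0 ↔ σ.nat 26 s ≠ 0 ∨ (u < v ∨ u = v ∧ s < k) ∧ Selected σ u s))
      (fun _ => 5) (a := σ.nat 1 v) (b := σ.nat 1 (v + 1)) hlo
      (hin.off_le hv) ?_ rfl ?_ ?_ ?_).mono ?_
    · intro σ'' hag'
      simp only [NExp.val]
      rw [hag'.nat 1 rfl, hag'.nat 14 rfl, hvar, h1]
    · intro k σ'' x h; exact h
    · intro k σ'' hk1 hk2 hag' hk hI'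
      have ht : Agree markProg σ σ'' := hag.trans hag'.forLoop
      have hsel : ∀ u s, Selected σ'' u s ↔ Selected σ u s := by
        intro u s
        unfold Selected
        rw [ht.nat 22 rfl, ht.nat 2 rfl, ht.nat 23 rfl, ht.nat 25 rfl, ht.nat 24 rfl]
      have h14 : σ''.nat 14 0 = v := by rw [hag'.nat 14 rfl]; exact hvar
      refine (runs_markCell h14 hk).mono ?_
      rintro σ₃ t - ⟨⟨a1, a2⟩, a3⟩
      refine ⟨fun u s hu hs1 hs2 => ?_, a3⟩
      by_cases hsk : s = k
      · subst hsk
        -- A cell belongs to only one vertex, so the present pass is the one for this `u`.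
        have := hin.owner_unique hu hv hs1 hs2 hk1 hk2
        subst this
        rw [a2, hI' u s hu hs1 hs2, hsel]
        simp
      · rw [a1 s hsk, hI' u s hu hs1 hs2]
        have : s < k ↔ s < k + 1 := by omega
        rw [this]
    · intro u s hu hs1 hs2
      rw [hI u s hu hs1 hs2]
      have : u < v ∨ u = v ∧ s < σ.nat 1 v ↔ u < v := by
        constructor
        · rintro (h | ⟨rfl, h⟩)
          · exact h
          · omega
        · exact Or.inl
      rw [this]
    · rintro σ₃ t - ⟨a1, a2⟩
      refine ⟨fun u s hu hs1 hs2 => ?_, ?_⟩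
      · rw [a1 u s hu hs1 hs2]
        have : u < v ∨ u = v ∧ s < σ.nat 1 (v + 1) ↔ u < v + 1 := by
          constructor
          · rintro (h | ⟨rfl, h⟩) <;> omega
          · intro h
            rcases (by omega : u < v ∨ u = v) with h | rfl
            · exact Or.inl h
            · exact Or.inr ⟨rfl, hs2⟩
        rw [this]
      · simp only [Finset.sum_const, Nat.card_Ico, smul_eq_mul] at a2
        omega
  · intro u s _ _ _
    simp
  · rintro σ' t - ⟨a1, a2⟩
    refine ⟨fun u s hu h1 h2 => ?_, ?_⟩
    · rw [a1 u s hu h1 h2]; simp [hu]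
    · rw [Finset.sum_add_distrib, Finset.sum_add_distrib, Nat.Ico_zero_eq_range, ← Finset.mul_sum,
        ← hin.off_eq_sum le_rfl] at a2
      simp at a2
      omega

/-- Cells marked before stay marked. The other cells carry edges of the current graph, for which the
test on distances and residues is membership in `cutEdges` with the least nodes as roots. -/
theorem runs_iterProg (hin : Input M r Λ σ) (hΛ : 0 < Λ) {B : Set (Sym2 (Fin n))}
    (hB : CutMarks n σ B) (i : ℕ) {L : Fin n → ℕ} (hL : ∀ v, L v < Λ)
    (hcoins : ∀ v : Fin n, σ.coins v = L v) :
    Runs iterProg σ fun σ' t =>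
      (CutMarks n σ' (B ∪ cutEdges Λ (M.graph.deleteEdges B)
        (minRoot n i (M.graph.deleteEdges B)) L) ∧
      ∀ k, σ'.coins k = σ.coins (n + k)) ∧ t ≤ 18 * σ.nat 1 n + 30 * n + 10 := by
  unfold iterProg
  rw [runs_seq]
  refine (runs_drawProg hin).mono ?_
  rintro σ₁ t₁ hag₁ ⟨⟨hd, hc⟩, ht₁⟩
  have hin₁ := hin.of_agree hag₁ rfl rfl rfl rfl rfl
  rw [runs_seq]
  refine (runs_clearProg hin₁).mono ?_
  rintro σ₂ t₂ hag₂ ⟨hv, ht₂⟩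
  have hin₂ := hin₁.of_agree hag₂ rfl rfl rfl rfl rfl
  have hB₂ : CutMarks n σ₂ B :=
    (hB.congr (hag₁.nat 1 rfl) (hag₁.nat 2 rfl) (hag₁.nat 26 rfl)).congr (hag₂.nat 1 rfl)
      (hag₂.nat 2 rfl) (hag₂.nat 26 rfl)
  rw [runs_seq]
  refine (runs_sweepProg hin₂ hΛ hB₂ hv).mono ?_
  rintro σ₃ t₃ hag₃ ⟨R, ht₃⟩
  have hin₃ := hin₂.of_agree hag₃ rfl rfl rfl rfl rfl
  have hB₃ : CutMarks n σ₃ B := hB₂.congr (hag₃.nat 1 rfl) (hag₃.nat 2 rfl) (hag₃.nat 26 rfl)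
  refine (runs_markProg hin₃).mono ?_
  rintro σ₄ t₄ hag₄ ⟨hmark, ht₄⟩
  have e1 : σ₂.nat 1 n = σ.nat 1 n := by rw [hag₂.nat 1 rfl, hag₁.nat 1 rfl]
  have e2 : σ₃.nat 1 n = σ.nat 1 n := by rw [hag₃.nat 1 rfl, e1]
  rw [e1] at ht₃
  rw [e2] at ht₄
  refine ⟨⟨?_, fun k => ?_⟩, by omega⟩
  · intro u w s h1 h2 h3
    rw [hag₄.nat 1 rfl] at h1 h2
    rw [hag₄.nat 2 rfl] at h3
    rw [hmark u s u.2 h1 h2, hB₃ u w s h1 h2 h3, Set.mem_union]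
    by_cases hmem : s(u, w) ∈ B
    · simp [hmem]
    · simp only [hmem, false_or]
      have hadj : (M.graph.deleteEdges B).Adj u w := by
        rw [SimpleGraph.deleteEdges_adj]
        exact ⟨(hin₃.neighbours u w).2 ⟨s, h1, h2, h3⟩, hmem⟩
      rw [R.mem_cutEdges_iff hL i hadj]
      unfold Selected
      have hlt : σ₃.nat 24 u < n := R.root_lt u u.2
      have h25 : σ₃.nat 25 (σ₃.nat 24 u) = L ⟨σ₃.nat 24 u, hlt⟩ := by
        rw [hag₃.nat 25 rfl, hag₂.nat 25 rfl, hd _ hlt, ← hcoins]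
      rw [h25, h3]
      rfl
  · rw [hag₄.coins rfl, hag₃.coins rfl, hag₂.coins rfl]
    exact hc k

theorem runs_decompProg (hin : Input M r Λ σ) (hΛ : 0 < Λ) (h26 : ∀ s, σ.nat 26 s = 0)
    {L : Draws n r Λ} (hcoins : ∀ (i : Fin r) (v : Fin n), σ.coins (i * n + v) = L i v) :
    Runs decompProg σ fun σ' t => CutMarks n σ' (minorE M.graph r Λ (minRoot n) L) ∧
      t ≤ r * (18 * σ.nat 1 n + 30 * n + 12) + 2 := by
  rw [minorE_eq]
  unfold decompProg
  refine (runs_for_sum (fun i σ' =>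
      CutMarks n σ' (minorEIter M.graph Λ (minRoot n) (extendDraws L) i) ∧
        ∀ k, σ'.coins k = σ.coins (i * n + k))
      (fun _ => 18 * σ.nat 1 n + 30 * n + 10) (a := 0) (b := r) rfl
      (Nat.zero_le _) ?_ rfl ?_ ?_ ?_).mono ?_
  · intro σ' hag
    simp only [NExp.val]
    rw [hag.nat 0 rfl]; exact hin.param_r
  · intro k σ' x h
    exact ⟨h.1.congr rfl rfl rfl, h.2⟩
  · intro i σ' _ hi hag hvar hI
    have hin' : Input M r Λ σ' := hin.of_agree hag rfl rfl rfl rfl rfl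
    refine (runs_iterProg hin' hΛ hI.1 i (L := extendDraws L i) (extendDraws_lt hΛ L i) ?_).mono ?_
    · intro v
      rw [hI.2, hcoins ⟨i, hi⟩ v]
      simp [extendDraws, hi]
    · rintro σ'' t - ⟨⟨a1, a2⟩, a3⟩
      rw [hag.nat 1 rfl] at a3
      refine ⟨⟨a1, fun k => ?_⟩, a3⟩
      rw [a2, hI.2]
      congr 1
      ring
  · refine ⟨fun u w s _ _ _ => ?_, fun k => by simp⟩
    simp [h26, minorEIter]
  · rintro σ' t - ⟨a1, a2⟩
    refine ⟨a1.1, ?_⟩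
    simp at a2
    linarith

end RAM

namespace RAM

variable {n q : ℕ} {M : PairwiseMRF n q} {r Λ : ℕ} {σ : State}

/-! ## The contribution of the removed edges -/

/-- The value of a scalar real variable: cell `0` of the array `a`. -/
abbrev RExp.var (a : ℕ) : RExp := .get a (.lit 0)

/-- Entry number `18` of the table of the cell `15`. -/
def tableEntry : RExp :=
  .get 1 (.add (.mul (.var 15) (.mul (.get 0 (.lit 1)) (.get 0 (.lit 1)))) (.var 18))

/-- Compare the extreme values that have been found with one entry of the table. -/
def extremeStep : Prog :=
  .seq (.cond (.realLt tableEntry (.var 5)) (.setReal 5 (.lit 0) tableEntry) .skip)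
    (.cond (.realLt (.var 6) tableEntry) (.setReal 6 (.lit 0) tableEntry) .skip)

/-- Find the extreme values of the table of the cell `15`. -/
def extremesProg : Prog :=
  .seq (.setVar 18 (.lit 0)) <| .seq (.setReal 5 (.lit 0) tableEntry) <|
  .seq (.setReal 6 (.lit 0) tableEntry) <|
  forLoop 18 (.lit 0) (.mul (.get 0 (.lit 1)) (.get 0 (.lit 1))) extremeStep

/-- Add the extreme values of the potential of a removed edge to the output. -/
def boundCell : Prog :=
  .seq (.setVar 16 (.get 2 (.var 15))) <|
  .cond (.natEq (.get 26 (.var 15)) (.lit 0)) .skip <|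
  .cond (.natLt (.var 14) (.var 16))
    (.seq extremesProg <|
      .seq (.setReal 2 (.lit 0) (.add (.get 2 (.lit 0)) (.var 5)))
        (.setReal 2 (.lit 1) (.add (.get 2 (.lit 1)) (.var 6)))) .skip

/-- Add the extreme values of the potentials of all removed edges to the output. -/
def boundsProg : Prog :=
  forLoop 14 (.lit 0) (.get 0 (.lit 0)) <|
    forLoop 15 (.get 1 (.var 14)) (.get 1 (.add (.var 14) (.lit 1))) boundCell

theorem exists_pair_of_lt {q e : ℕ} (he : e < q * q) :
    ∃ p : Fin q × Fin q, e = (p.1 : ℕ) * q + p.2 := by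
  have hq : 0 < q := by
    rcases Nat.eq_zero_or_pos q with rfl | h
    · simp at he
    · exact h
  refine ⟨(⟨e / q, Nat.div_lt_of_lt_mul he⟩, ⟨e % q, Nat.mod_lt _ hq⟩), ?_⟩
  simp only
  rw [mul_comm]
  exact (Nat.div_add_mod e q).symm

theorem pair_lt {q : ℕ} (p : Fin q × Fin q) : (p.1 : ℕ) * q + p.2 < q * q := by
  have h1 := p.1.2
  have h2 := p.2.2
  calc (p.1 : ℕ) * q + p.2 < p.1 * q + q := by omega
    _ = (p.1 + 1) * q := by ring
    _ ≤ q * q := Nat.mul_le_mul_right _ h1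

theorem table_index (s q a b : ℕ) : (s * q + a) * q + b = s * (q * q) + (a * q + b) := by ring

/-- The table is read as a list of `q²` numbers. The running values bound all entries seen and are
themselves entries; starting from entry `0` makes this true because `q > 0`. -/
theorem runs_extremesProg (hin : Input M r Λ σ) (hq : 0 < q) {s : ℕ} (hs : σ.nat 15 0 = s) :
    Runs extremesProg σ fun σ' t =>
      (σ'.real 5 0 = ⨅ p : Fin q × Fin q, σ.real 1 ((s * q + p.1) * q + p.2) ∧
        σ'.real 6 0 = ⨆ p : Fin q × Fin q, σ.real 1 ((s * q + p.1) * q + p.2)) ∧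
      t ≤ 6 * (q * q) + 5 := by
  set f : ℕ → ℝ := fun e => σ.real 1 (s * (q * q) + e) with hf
  have hentry : ∀ σ' : State, σ'.nat 15 = σ.nat 15 → σ'.nat 0 = σ.nat 0 →
      σ'.real 1 = σ.real 1 → tableEntry.val σ' = f (σ'.nat 18 0) := by
    intro σ' h1 h2 h3
    simp only [tableEntry, RExp.val, NExp.val, h1, h2, h3, hs, hin.size_q, hf]
  have hqq : 0 < q * q := Nat.mul_pos hq hq
  unfold extremesProg
  simp only [runs_seq, runs_setNat, runs_setReal]
  rw [hentry _ (by simp) (by simp) (by simp), hentry _ (by simp) (by simp) (by simp)]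
  simp only [NExp.val, nat_writeReal, nat_writeNat_self, Function.update_self]
  set σ₁ := ((σ.writeNat 18 0 0).writeReal 5 0 (f 0)).writeReal 6 0 (f 0) with hσ₁
  refine (runs_for_sum (σ := σ₁) (fun e σ' => ((∀ e' < e, σ'.real 5 0 ≤ f e') ∧
      ∃ e' < q * q, σ'.real 5 0 = f e') ∧ (∀ e' < e, f e' ≤ σ'.real 6 0) ∧
      ∃ e' < q * q, σ'.real 6 0 = f e') (fun _ => 4) (a := 0) (b := q * q) rfl
      (Nat.zero_le _) ?_ rfl ?_ ?_ ?_).mono ?_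
  · intro σ' hag
    simp only [NExp.val]
    rw [hag.nat 0 rfl]
    change σ.nat 0 1 * σ.nat 0 1 = _
    rw [hin.size_q]
  · intro k σ' x h; exact h
  · rintro e σ' - he hag hvar ⟨⟨a1, a2⟩, a3, a4⟩
    have hent : ∀ σ'' : State, σ''.nat = σ'.nat → σ''.real 1 = σ'.real 1 →
        tableEntry.val σ'' = f e := by
      intro σ'' h1 h2
      rw [hentry σ'' (by rw [h1, hag.nat 15 rfl]; rfl) (by rw [h1, hag.nat 0 rfl]; rfl)
        (by rw [h2, hag.real 1 rfl]; rfl), h1, hvar]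
    unfold extremeStep
    rw [runs_seq]
    have step1 : Runs (.cond (.realLt tableEntry (.var 5)) (.setReal 5 (.lit 0) tableEntry) .skip)
        σ' fun σ'' t => ((∀ e' < e + 1, σ''.real 5 0 ≤ f e') ∧
          ∃ e' < q * q, σ''.real 5 0 = f e') ∧ t = 2 := by
      by_cases hlt : f e < σ'.real 5 0
      · rw [runs_cond_of_true (by
          simp only [Test.Holds, hent σ' rfl rfl]; exact hlt), runs_setReal, hent σ' rfl rfl]
        simp only [NExp.val, real_writeReal_self, Function.update_self]
        refine ⟨⟨fun e' he' => ?_, e, he, rfl⟩, trivial⟩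
        rcases (by omega : e' < e ∨ e' = e) with h | rfl
        · exact hlt.le.trans (a1 e' h)
        · exact le_rfl
      · rw [runs_cond_of_false (by
          simp only [Test.Holds, hent σ' rfl rfl]; exact hlt), runs_skip]
        refine ⟨⟨fun e' he' => ?_, a2⟩, rfl⟩
        rcases (by omega : e' < e ∨ e' = e) with h | rfl
        · exact a1 e' h
        · exact not_lt.1 hlt
    refine step1.mono ?_
    rintro σ'' t hag'' ⟨hb, rfl⟩
    have hn'' : σ''.nat = σ'.nat := funext fun a => hag''.nat a rfl
    have h6 : σ''.real 6 = σ'.real 6 := hag''.real 6 rfl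
    have he'' : tableEntry.val σ'' = f e := hent σ'' hn'' (hag''.real 1 rfl)
    by_cases hlt : σ'.real 6 0 < f e
    · rw [runs_cond_of_true (by
        simp only [Test.Holds, he'', RExp.val, NExp.val, h6]; exact hlt), runs_setReal, he'']
      simp only [NExp.val, real_writeReal_self, Function.update_self]
      refine ⟨⟨hb, fun e' he' => ?_, e, he, rfl⟩, by omega⟩
      rcases (by omega : e' < e ∨ e' = e) with h | rfl
      · exact (a3 e' h).trans hlt.le
      · exact le_rfl
    · rw [runs_cond_of_false (by
        simp only [Test.Holds, he'', RExp.val, NExp.val, h6]; exact hlt), runs_skip, h6]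
      refine ⟨⟨hb, fun e' he' => ?_, a4⟩, by omega⟩
      rcases (by omega : e' < e ∨ e' = e) with h | rfl
      · exact a3 e' h
      · exact not_lt.1 hlt
  · refine ⟨⟨fun e' h => by omega, 0, hqq, ?_⟩, fun e' h => by omega, 0, hqq, ?_⟩ <;> simp [hσ₁]
  · rintro σ' t - ⟨⟨⟨a1, e₁, h1, h1'⟩, a3, e₂, h2, h2'⟩, ht⟩
    have hne : Nonempty (Fin q × Fin q) := ⟨(⟨0, hq⟩, ⟨0, hq⟩)⟩
    have hfin : (Set.range fun p : Fin q × Fin q =>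
      σ.real 1 ((s * q + p.1) * q + p.2)).Finite := Set.finite_range _
    refine ⟨⟨le_antisymm (le_ciInf fun p => ?_) ?_, le_antisymm ?_ (ciSup_le fun p => ?_)⟩, ?_⟩
    · rw [table_index]; exact a1 _ (pair_lt p)
    · obtain ⟨p, rfl⟩ := exists_pair_of_lt h1
      rw [h1']
      refine (ciInf_le hfin.bddBelow p).trans (le_of_eq ?_)
      rw [table_index]
    · obtain ⟨p, rfl⟩ := exists_pair_of_lt h2
      rw [h2']
      refine le_trans (le_of_eq ?_) (le_ciSup hfin.bddAbove p)
      rw [table_index]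
    · rw [table_index]; exact a3 _ (pair_lt p)
    · simp at ht
      omega

/-- The contribution of the cell `s` of `u` to the lower bound. -/
noncomputable def cellLower (q : ℕ) (σ : State) (u s : ℕ) : ℝ :=
  if σ.nat 26 s ≠ 0 ∧ u < σ.nat 2 s then
    ⨅ p : Fin q × Fin q, σ.real 1 ((s * q + p.1) * q + p.2) else 0

/-- The contribution of the cell `s` of `u` to the upper bound. -/
noncomputable def cellUpper (q : ℕ) (σ : State) (u s : ℕ) : ℝ :=
  if σ.nat 26 s ≠ 0 ∧ u < σ.nat 2 s then
    ⨆ p : Fin q × Fin q, σ.real 1 ((s * q + p.1) * q + p.2) else 0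

/-- Only the cell at the smaller endpoint is used, so that each removed edge counts once. -/
theorem runs_boundCell (hin : Input M r Λ σ) (hq : 0 < q) {u s : ℕ} (hu : σ.nat 14 0 = u)
    (hs : σ.nat 15 0 = s) :
    Runs boundCell σ fun σ' t => (σ'.real 2 0 = σ.real 2 0 + cellLower q σ u s ∧
      σ'.real 2 1 = σ.real 2 1 + cellUpper q σ u s) ∧ t ≤ 6 * (q * q) + 10 := by
  unfold boundCell
  rw [runs_seq, runs_setNat]
  simp only [NExp.val, hs]
  set σ₁ := σ.writeNat 16 0 (σ.nat 2 s) with hσ₁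
  by_cases hcut : σ.nat 26 s = 0
  · rw [runs_cond_of_true (by simp [Test.Holds, NExp.val, hσ₁, hs, hcut]), runs_skip]
    refine ⟨⟨?_, ?_⟩, by omega⟩
    · simp [cellLower, hcut, hσ₁]
    · simp [cellUpper, hcut, hσ₁]
  rw [runs_cond_of_false (by simp [Test.Holds, NExp.val, hσ₁, hs, hcut])]
  by_cases hlt : u < σ.nat 2 s
  · rw [runs_cond_of_true (by simp [Test.Holds, NExp.val, hσ₁, hu, hlt]), runs_seq]
    have hin₁ : Input M r Λ σ₁ := hin.congr rfl rfl rfl rfl rfl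
    refine (runs_extremesProg hin₁ hq (s := s) (by simpa [hσ₁] using hs)).mono ?_
    rintro σ₂ t hag ⟨⟨h5, h6⟩, ht⟩
    have h2 : σ₂.real 2 = σ.real 2 := by rw [hag.real 2 rfl]; rfl
    rw [runs_seq, runs_setReal, runs_setReal]
    refine ⟨⟨?_, ?_⟩, by omega⟩
    · simp [RExp.val, NExp.val, h2, h5, cellLower, hcut, hlt, hσ₁]
    · simp [RExp.val, NExp.val, h2, h6, cellUpper, hcut, hlt, hσ₁]
  · rw [runs_cond_of_false (by simp only [Test.Holds, NExp.val, hσ₁]; simpa [hu] using hlt),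
      runs_skip]
    refine ⟨⟨?_, ?_⟩, by omega⟩
    · simp [cellLower, hlt, hσ₁]
    · simp [cellUpper, hlt, hσ₁]

theorem runs_boundsProg (hin : Input M r Λ σ) (hq : 0 < q) :
    Runs boundsProg σ fun σ' t =>
      (σ'.real 2 0 = σ.real 2 0 +
        ∑ u ∈ Finset.range n, ∑ s ∈ Finset.Ico (σ.nat 1 u) (σ.nat 1 (u + 1)), cellLower q σ u s ∧
      σ'.real 2 1 = σ.real 2 1 +
        ∑ u ∈ Finset.range n, ∑ s ∈ Finset.Ico (σ.nat 1 u) (σ.nat 1 (u + 1)), cellUpper q σ u s) ∧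
      t ≤ (6 * (q * q) + 12) * σ.nat 1 n + 4 * n + 2 := by
  unfold boundsProg
  refine (runs_for_sum (fun v σ' => σ'.real 2 0 = σ.real 2 0 +
        ∑ u ∈ Finset.range v, ∑ s ∈ Finset.Ico (σ.nat 1 u) (σ.nat 1 (u + 1)), cellLower q σ u s ∧
      σ'.real 2 1 = σ.real 2 1 +
        ∑ u ∈ Finset.range v, ∑ s ∈ Finset.Ico (σ.nat 1 u) (σ.nat 1 (u + 1)), cellUpper q σ u s)
      (fun v => (6 * (q * q) + 12) * (σ.nat 1 (v + 1) - σ.nat 1 v) + 2) (a := 0) (b := n) rfl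
      (Nat.zero_le _) ?_ rfl ?_ ?_ ?_).mono ?_
  · intro σ' hag
    simp only [NExp.val]
    rw [hag.nat 0 rfl]; exact hin.size_n
  · intro k σ' x h; exact h
  · intro v σ' _ hv hag hvar hI
    have h1 : σ'.nat 1 = σ.nat 1 := hag.nat 1 rfl
    have hlo : (NExp.get 1 (.var 14)).val σ' = σ.nat 1 v := by simp [NExp.val, hvar, h1]
    refine (runs_for_sum (fun k σ'' =>
        σ''.real 2 0 = σ'.real 2 0 + ∑ s ∈ Finset.Ico (σ.nat 1 v) k, cellLower q σ v s ∧
        σ''.real 2 1 = σ'.real 2 1 + ∑ s ∈ Finset.Ico (σ.nat 1 v) k, cellUpper q σ v s)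
      (fun _ => 6 * (q * q) + 10) (a := σ.nat 1 v) (b := σ.nat 1 (v + 1)) hlo
      (hin.off_le hv) ?_ rfl ?_ ?_ ?_).mono ?_
    · intro σ'' hag'
      simp only [NExp.val]
      rw [hag'.nat 1 rfl, hag'.nat 14 rfl, hvar, h1]
    · intro k σ'' x h; exact h
    · intro k σ'' hk1 hk2 hag' hk hI'
      have ht : Agree boundsProg σ σ'' := hag.trans hag'.forLoop
      have h14 : σ''.nat 14 0 = v := by rw [hag'.nat 14 rfl]; exact hvar
      have hin' : Input M r Λ σ'' := hin.of_agree ht rfl rfl rfl rfl rfl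
      have eL : cellLower q σ'' v k = cellLower q σ v k := by
        unfold cellLower; rw [ht.nat 26 rfl, ht.nat 2 rfl, ht.real 1 rfl]
      have eU : cellUpper q σ'' v k = cellUpper q σ v k := by
        unfold cellUpper; rw [ht.nat 26 rfl, ht.nat 2 rfl, ht.real 1 rfl]
      refine (runs_boundCell hin' hq h14 hk).mono ?_
      rintro σ₃ t - ⟨⟨a1, a2⟩, a3⟩
      refine ⟨⟨?_, ?_⟩, a3⟩
      · rw [a1, hI'.1, Finset.sum_Ico_succ_top hk1, eL, add_assoc]
      · rw [a2, hI'.2, Finset.sum_Ico_succ_top hk1, eU, add_assoc]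
    · simp
    · rintro σ₃ t - ⟨⟨a1, a2⟩, a3⟩
      refine ⟨⟨?_, ?_⟩, ?_⟩
      · rw [a1, hI.1, Finset.sum_range_succ, add_assoc]
      · rw [a2, hI.2, Finset.sum_range_succ, add_assoc]
      · simp only [Finset.sum_const, Nat.card_Ico, smul_eq_mul] at a3
        linarith
  · simp
  · rintro σ' t - ⟨a1, a2⟩
    refine ⟨a1, ?_⟩
    rw [Finset.sum_add_distrib, Finset.sum_add_distrib, Nat.Ico_zero_eq_range, ← Finset.mul_sum,
      ← hin.off_eq_sum le_rfl] at a2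
    simp at a2
    omega

open scoped Classical in
/-- A sum over the cells of a vertex is a sum over its neighbours. -/
theorem sum_cells (hin : Input M r Λ σ) (u : Fin n) {F : ℕ → ℝ} {G : Fin n → ℝ}
    (hFG : ∀ s w, σ.nat 1 u ≤ s → s < σ.nat 1 (u + 1) → σ.nat 2 s = (w : Fin n) → F s = G w) :
    ∑ s ∈ Finset.Ico (σ.nat 1 u) (σ.nat 1 (u + 1)), F s =
      ∑ w, if M.graph.Adj u w then G w else 0 := by
  obtain ⟨hc, hinj⟩ := hin.cells u
  rw [← Finset.sum_filter]
  have hn : ∀ s ∈ Finset.Ico (σ.nat 1 u) (σ.nat 1 (u + 1)), σ.nat 2 s < n := by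
    intro s hs
    obtain ⟨w, hw, -⟩ := hc s (Finset.mem_Ico.1 hs).1 (Finset.mem_Ico.1 hs).2
    rw [hw]; exact w.2
  refine Finset.sum_bij (fun s hs => ⟨σ.nat 2 s, hn s hs⟩) ?_ ?_ ?_ ?_
  · intro s hs
    obtain ⟨w, hw, hadj⟩ := hc s (Finset.mem_Ico.1 hs).1 (Finset.mem_Ico.1 hs).2
    simp only [Finset.mem_filter, Finset.mem_univ, true_and]
    convert hadj
  · intro s hs s' hs' h
    exact hinj (by simpa using hs) (by simpa using hs') (by simpa using h)
  · intro w hw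
    obtain ⟨s, h1, h2, h3⟩ := (hin.neighbours u w).1 (by simpa using hw)
    exact ⟨s, Finset.mem_Ico.2 ⟨h1, h2⟩, Fin.ext h3⟩
  · intro s hs
    exact hFG s _ (Finset.mem_Ico.1 hs).1 (Finset.mem_Ico.1 hs).2 rfl

theorem edge_table (hin : Input M r Λ σ) {u w : Fin n} {s : ℕ} (h1 : σ.nat 1 u ≤ s)
    (h2 : s < σ.nat 1 (u + 1)) (h3 : σ.nat 2 s = w) (huw : u < w) (a b : Fin q) :
    σ.real 1 ((s * q + a) * q + b) = M.ψ u w a b := by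
  rw [hin.edge_pot u w s h1 h2 h3 a b, if_pos huw]

open scoped Classical in
theorem sum_cellLower (hin : Input M r Λ σ) {B : Set (Sym2 (Fin n))} (hB : CutMarks n σ B)
    (hsub : B ⊆ M.graph.edgeSet) :
    ∑ u ∈ Finset.range n, ∑ s ∈ Finset.Ico (σ.nat 1 u) (σ.nat 1 (u + 1)), cellLower q σ u s =
      ∑ u, ∑ v, if u < v ∧ s(u, v) ∈ B then M.ψL u v else 0 := by
  rw [← Fin.sum_univ_eq_sum_range
    (fun u => ∑ s ∈ Finset.Ico (σ.nat 1 u) (σ.nat 1 (u + 1)), cellLower q σ u s)]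
  refine Finset.sum_congr rfl fun u _ => ?_
  rw [sum_cells hin u (G := fun w => if u < w ∧ s(u, w) ∈ B then M.ψL u w else 0)]
  · refine Finset.sum_congr rfl fun w _ => ?_
    by_cases h : u < w ∧ s(u, w) ∈ B
    · rw [if_pos (show M.graph.Adj u w from hsub h.2)]
    · simp [h]
  · intro s w h1 h2 h3
    unfold cellLower PairwiseMRF.ψL
    simp only [hB u w s h1 h2 h3, h3, Fin.val_fin_lt]
    by_cases h : s(u, w) ∈ B ∧ u < w
    · rw [if_pos ⟨h.1, h.2⟩, if_pos ⟨h.2, h.1⟩]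
      exact iInf_congr fun p => edge_table hin h1 h2 h3 h.2 _ _
    · rw [if_neg (fun h' => h ⟨h'.1, h'.2⟩), if_neg (fun h' => h ⟨h'.2, h'.1⟩)]

open scoped Classical in
theorem sum_cellUpper (hin : Input M r Λ σ) {B : Set (Sym2 (Fin n))} (hB : CutMarks n σ B)
    (hsub : B ⊆ M.graph.edgeSet) :
    ∑ u ∈ Finset.range n, ∑ s ∈ Finset.Ico (σ.nat 1 u) (σ.nat 1 (u + 1)), cellUpper q σ u s =
      ∑ u, ∑ v, if u < v ∧ s(u, v) ∈ B then M.ψU u v else 0 := by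
  rw [← Fin.sum_univ_eq_sum_range
    (fun u => ∑ s ∈ Finset.Ico (σ.nat 1 u) (σ.nat 1 (u + 1)), cellUpper q σ u s)]
  refine Finset.sum_congr rfl fun u _ => ?_
  rw [sum_cells hin u (G := fun w => if u < w ∧ s(u, w) ∈ B then M.ψU u w else 0)]
  · refine Finset.sum_congr rfl fun w _ => ?_
    by_cases h : u < w ∧ s(u, w) ∈ B
    · rw [if_pos (show M.graph.Adj u w from hsub h.2)]
    · simp [h]
  · intro s w h1 h2 h3
    unfold cellUpper PairwiseMRF.ψU
    simp only [hB u w s h1 h2 h3, h3, Fin.val_fin_lt]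
    by_cases h : s(u, w) ∈ B ∧ u < w
    · rw [if_pos ⟨h.1, h.2⟩, if_pos ⟨h.2, h.1⟩]
      exact iSup_congr fun p => edge_table hin h1 h2 h3 h.2 _ _
    · rw [if_neg (fun h' => h ⟨h'.1, h'.2⟩), if_neg (fun h' => h ⟨h'.2, h'.1⟩)]

end RAM

namespace RAM

variable {n q : ℕ} {M : PairwiseMRF n q} {r Λ : ℕ} {σ : State}

/-! ## The enumeration of the assignments of a component -/

/-- `for k` in the segment of the queue that holds the component of the root in the variable `11`.-/
def forSegment (body : Prog) : Prog := forLoop 18 (.get 27 (.var 11)) (.get 28 (.var 11)) body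

/-- Compute the number of assignments and set up the first one. -/
def initProg : Prog :=
  .seq (.setVar 30 (.lit 1)) <| forSegment <|
    .seq (.setVar 30 (.mul (.var 30) (.get 0 (.lit 1)))) (.setNat 29 (.get 21 (.var 18)) (.lit 0))

/-- Add the potential of the edge in the cell `15` of the vertex `14`. -/
def energyCell : Prog :=
  .seq (.setVar 16 (.get 2 (.var 15))) <|
  .cond (.natEq (.get 26 (.var 15)) (.lit 0))
    (.cond (.natLt (.var 14) (.var 16))
      (.setReal 3 (.lit 0) (.add (.var 3) (.get 1 (.add (.mul (.add (.mul (.var 15)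
        (.get 0 (.lit 1))) (.get 29 (.var 14))) (.get 0 (.lit 1))) (.get 29 (.var 16)))))) .skip)
    .skip

/-- Add the potentials of a vertex and of the edges to larger vertices. -/
def energyVertex : Prog :=
  .seq (.setVar 14 (.get 21 (.var 18))) <|
  .seq (.setReal 3 (.lit 0) (.add (.var 3) (.get 0 (.add (.mul (.var 14) (.get 0 (.lit 1)))
    (.get 29 (.var 14)))))) <|
  forLoop 15 (.get 1 (.var 14)) (.get 1 (.add (.var 14) (.lit 1))) energyCell

/-- Compute the energy of an assignment. -/
def energyProg : Prog := .seq (.setReal 3 (.lit 0) (.cast (.lit 0))) (forSegment energyVertex)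

/-- Increase a digit by the carry. -/
def carryStep : Prog :=
  .seq (.setVar 14 (.get 21 (.var 18))) <|
  .seq (.setVar 32 (.add (.get 29 (.var 14)) (.var 31))) <|
  .cond (.natEq (.var 32) (.get 0 (.lit 1))) (.setNat 29 (.var 14) (.lit 0))
    (.seq (.setNat 29 (.var 14) (.var 32)) (.setVar 31 (.lit 0)))

/-- Pass to the next assignment. -/
def carryProg : Prog := .seq (.setVar 31 (.lit 1)) (forSegment carryStep)

/-- Process one assignment. -/
def assignProg : Prog :=
  .seq energyProg <| .seq (.setReal 4 (.lit 0) (.add (.var 4) (.exp (.var 3)))) carryProg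

/-- Add the logarithm of the partition function of a component to the output. -/
def compProg : Prog :=
  .seq initProg <| .seq (.setReal 4 (.lit 0) (.cast (.lit 0))) <|
  .seq (forLoop 19 (.lit 0) (.var 30) assignProg) <|
  .seq (.setReal 2 (.lit 0) (.add (.get 2 (.lit 0)) (.log (.var 4))))
    (.setReal 2 (.lit 1) (.add (.get 2 (.lit 1)) (.log (.var 4))))

/-- Process all components. -/
def enumProg : Prog :=
  forLoop 11 (.lit 0) (.get 0 (.lit 0)) (.cond (.natEq (.get 24 (.var 11)) (.var 11)) compProg .skip)

/-- The potentials of the vertex `u` and of the edges from `u` to larger vertices, for the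
assignment `y`. -/
noncomputable def vertexEnergy (q : ℕ) (σ : State) (y : ℕ → ℕ) (u : ℕ) : ℝ :=
  σ.real 0 (u * q + y u) + ∑ s ∈ Finset.Ico (σ.nat 1 u) (σ.nat 1 (u + 1)),
    if σ.nat 26 s = 0 ∧ u < σ.nat 2 s then σ.real 1 ((s * q + y u) * q + y (σ.nat 2 s)) else 0

theorem vertexEnergy_congr {σ' : State} (h0 : σ'.real 0 = σ.real 0) (h1 : σ'.real 1 = σ.real 1)
    (h2 : σ'.nat 1 = σ.nat 1) (h3 : σ'.nat 2 = σ.nat 2) (h4 : σ'.nat 26 = σ.nat 26) (y : ℕ → ℕ)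
    (u : ℕ) : vertexEnergy q σ' y u = vertexEnergy q σ y u := by
  unfold vertexEnergy
  rw [h0, h1, h2, h3, h4]

/-- The number of cells of `u`. -/
def State.deg (σ : State) (u : ℕ) : ℕ := σ.nat 1 (u + 1) - σ.nat 1 u

theorem runs_energyCell (hin : Input M r Λ σ) {u s : ℕ} (hu : σ.nat 14 0 = u)
    (hs : σ.nat 15 0 = s) :
    Runs energyCell σ fun σ' t => σ'.real 3 0 = σ.real 3 0 +
      (if σ.nat 26 s = 0 ∧ u < σ.nat 2 s then
        σ.real 1 ((s * q + σ.nat 29 u) * q + σ.nat 29 (σ.nat 2 s)) else 0) ∧ t ≤ 4 := by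
  unfold energyCell
  rw [runs_seq, runs_setNat]
  simp only [NExp.val, hs]
  by_cases hcut : σ.nat 26 s = 0
  · rw [runs_cond_of_true (by simp [Test.Holds, NExp.val, hs, hcut])]
    by_cases hlt : u < σ.nat 2 s
    · rw [runs_cond_of_true (by simp [Test.Holds, NExp.val, hu, hlt]), runs_setReal]
      refine ⟨?_, by omega⟩
      simp [RExp.val, NExp.val, hcut, hlt, hs, hu, hin.size_q]
    · rw [runs_cond_of_false (by simp only [Test.Holds, NExp.val]; simpa [hu] using hlt), runs_skip]
      refine ⟨?_, by omega⟩
      simp [hlt]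
  · rw [runs_cond_of_false (by simp [Test.Holds, NExp.val, hs, hcut]), runs_skip]
    refine ⟨?_, by omega⟩
    simp [hcut]

theorem runs_energyVertex (hin : Input M r Λ σ) {k u : ℕ} (hk : σ.nat 18 0 = k)
    (hu : σ.nat 21 k = u) (hun : u < n) :
    Runs energyVertex σ fun σ' t => σ'.real 3 0 = σ.real 3 0 + vertexEnergy q σ (σ.nat 29) u ∧
      t ≤ 6 * σ.deg u + 4 := by
  unfold energyVertex
  rw [runs_seq, runs_setNat, runs_seq, runs_setReal]
  simp only [NExp.val, hk, hu]
  set σ₁ := (σ.writeNat 14 0 u).writeReal 3 0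
    (RExp.val (σ.writeNat 14 0 u) (.add (.var 3) (.get 0 (.add (.mul (.var 14) (.get 0 (.lit 1)))
    (.get 29 (.var 14)))))) with hσ₁
  have h3 : σ₁.real 3 0 = σ.real 3 0 + σ.real 0 (u * q + σ.nat 29 u) := by
    simp [hσ₁, RExp.val, NExp.val, hin.size_q]
  have hin₁ : Input M r Λ σ₁ := hin.congr rfl rfl rfl rfl rfl
  refine (runs_for_sum (σ := σ₁) (fun s σ' => σ'.real 3 0 = σ₁.real 3 0 +
    ∑ s ∈ Finset.Ico (σ.nat 1 u) s, if σ.nat 26 s = 0 ∧ u < σ.nat 2 s then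
        σ.real 1 ((s * q + σ.nat 29 u) * q + σ.nat 29 (σ.nat 2 s)) else 0)
      (fun _ => 4) (a := σ.nat 1 u) (b := σ.nat 1 (u + 1)) (by simp [NExp.val, hσ₁])
      (hin.off_le hun) ?_ rfl ?_ ?_ ?_).mono ?_
  · intro σ' hag
    simp only [NExp.val]
    rw [hag.nat 1 rfl, hag.nat 14 rfl]
    simp [hσ₁]
  · intro k σ' x h; exact h
  · intro s σ' hs1 hs2 hag hs hI
    have hin' : Input M r Λ σ' := hin₁.of_agree hag rfl rfl rfl rfl rfl
    refine (runs_energyCell hin' (u := u) (by rw [hag.nat 14 rfl]; simp [hσ₁]) hs).mono ?_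
    rintro σ'' t - ⟨a1, a2⟩
    refine ⟨?_, a2⟩
    rw [a1, hI, Finset.sum_Ico_succ_top hs1, add_assoc, hag.nat 26 rfl, hag.nat 2 rfl,
      hag.real 1 rfl, hag.nat 29 rfl]
    rfl
  · simp
  · rintro σ' t - ⟨a1, a2⟩
    refine ⟨?_, ?_⟩
    · rw [a1, h3, vertexEnergy, add_assoc]
    · simp only [Finset.sum_const, Nat.card_Ico, smul_eq_mul] at a2
      unfold State.deg
      omega

theorem forSegment_hi {body : Prog} {v : ℕ} (h28 : body.writesNat 28 = false)
    (h11 : body.writesNat 11 = false) (hvar : σ.nat 11 0 = v) (σ' : State)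
    (hag : Agree (forSegment body) σ σ') : (NExp.get 28 (.var 11)).val σ' = σ.nat 28 v := by
  simp only [NExp.val]
  rw [hag.nat 28, hag.nat 11, hvar]
  · change (_ || _) = false
    simp only [Prog.writesNat, h11]; rfl
  · change (_ || _) = false
    simp only [Prog.writesNat, h28]; rfl

theorem runs_energyProg (hin : Input M r Λ σ) {v : ℕ} (hvar : σ.nat 11 0 = v)
    (hle : σ.nat 27 v ≤ σ.nat 28 v)
    (hQ : ∀ k, σ.nat 27 v ≤ k → k < σ.nat 28 v → σ.nat 21 k < n) :
    Runs energyProg σ fun σ' t =>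
      σ'.real 3 0 = ∑ k ∈ Finset.Ico (σ.nat 27 v) (σ.nat 28 v),
        vertexEnergy q σ (σ.nat 29) (σ.nat 21 k) ∧
      t ≤ ∑ k ∈ Finset.Ico (σ.nat 27 v) (σ.nat 28 v), (6 * σ.deg (σ.nat 21 k) + 6) + 3 := by
  unfold energyProg
  rw [runs_seq, runs_setReal]
  set σ₁ := σ.writeReal 3 ((NExp.lit 0).val σ) ((RExp.cast (.lit 0)).val σ) with hσ₁
  have hin₁ : Input M r Λ σ₁ := hin.congr rfl rfl rfl rfl rfl
  refine (runs_for_sum (σ := σ₁) (fun k σ' => σ'.real 3 0 =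
    ∑ k ∈ Finset.Ico (σ.nat 27 v) k, vertexEnergy q σ (σ.nat 29) (σ.nat 21 k))
      (fun k => 6 * σ.deg (σ.nat 21 k) + 4) (a := σ.nat 27 v) (b := σ.nat 28 v)
      (by simp [NExp.val, hσ₁, hvar])
      hle (forSegment_hi (σ := σ₁) rfl rfl hvar) rfl ?_ ?_ ?_).mono ?_
  · intro k σ' x h; exact h
  · intro k σ' hk1 hk2 hag hk hI
    have hin' : Input M r Λ σ' := hin₁.of_agree hag rfl rfl rfl rfl rfl
    have h21 : σ'.nat 21 = σ.nat 21 := by rw [hag.nat 21 rfl]; rfl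
    refine (runs_energyVertex hin' hk rfl (by rw [h21]; exact hQ k hk1 hk2)).mono ?_
    rintro σ'' t - ⟨a1, a2⟩
    have h1 : σ'.nat 1 = σ.nat 1 := by rw [hag.nat 1 rfl]; rfl
    have h29 : σ'.nat 29 = σ.nat 29 := by rw [hag.nat 29 rfl]; rfl
    refine ⟨?_, ?_⟩
    · rw [a1, hI, Finset.sum_Ico_succ_top hk1, h21, h29, vertexEnergy_congr (hag.real 0 rfl)
        (hag.real 1 rfl) (hag.nat 1 rfl) (hag.nat 2 rfl) (hag.nat 26 rfl)]
      rfl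
    · rw [h21] at a2
      unfold State.deg at a2 ⊢
      rwa [h1] at a2
  · simp [hσ₁, RExp.val, NExp.val]
  · rintro σ' t - ⟨a1, a2⟩
    simp only [add_assoc, Nat.reduceAdd] at a2
    exact ⟨a1, by omega⟩

/-- Adding one to `c` in base `q`: a carry enters digit `j` exactly if `q ^ j ∣ c + 1`. The digit
overflows exactly if the carry continues to the next one. -/
theorem digit_carry {q c j : ℕ} (hq : 0 < q) :
    (c / q ^ j % q + (if q ^ j ∣ c + 1 then 1 else 0) = q →
      (c + 1) / q ^ j % q = 0 ∧ q ^ (j + 1) ∣ c + 1 ∧ q ^ j ∣ c + 1) ∧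
    (c / q ^ j % q + (if q ^ j ∣ c + 1 then 1 else 0) ≠ q →
      (c + 1) / q ^ j % q = c / q ^ j % q + (if q ^ j ∣ c + 1 then 1 else 0) ∧
        ¬ q ^ (j + 1) ∣ c + 1) := by
  have hlt := Nat.mod_lt (c / q ^ j) hq
  have hmod : (c + 1) / q ^ j % q =
      (c / q ^ j % q + (if q ^ j ∣ c + 1 then 1 else 0)) % q := by
    rw [Nat.succ_div, Nat.mod_add_mod]
  have hdvd : q ^ j ∣ c + 1 → (q ^ (j + 1) ∣ c + 1 ↔ (c + 1) / q ^ j % q = 0) := by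
    intro h
    rw [← Nat.dvd_iff_mod_eq_zero, pow_succ]
    exact (Nat.dvd_div_iff_mul_dvd h).symm
  by_cases hd : q ^ j ∣ c + 1
  · rw [hdvd hd, hmod]
    simp only [hd, if_true]
    refine ⟨fun h => ?_, fun h => ?_⟩
    · rw [h]; simp
    · rw [Nat.mod_eq_of_lt (by omega)]
      exact ⟨rfl, by omega⟩
  · have h' : ¬ q ^ (j + 1) ∣ c + 1 := fun h => hd ((pow_dvd_pow q (Nat.le_succ j)).trans h)
    rw [hmod]
    simp only [hd, if_false, add_zero]
    refine ⟨fun h => by omega, fun _ => ⟨Nat.mod_mod _ _, h'⟩⟩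

/-- The labels along the segment of the queue are the base `q` digits of the number `c` of the
assignment, least significant first. Digits already passed show `c + 1`, the others still `c`.
Distinctness of the queue entries keeps the digits from interfering. -/
theorem runs_carryProg (hin : Input M r Λ σ) (hq : 0 < q) {v : ℕ} (hvar : σ.nat 11 0 = v)
    (hle : σ.nat 27 v ≤ σ.nat 28 v)
    (hinj : ∀ i j, σ.nat 27 v ≤ i → i < σ.nat 28 v → σ.nat 27 v ≤ j → j < σ.nat 28 v →
      σ.nat 21 i = σ.nat 21 j → i = j) {c : ℕ}
    (hx : ∀ k, σ.nat 27 v ≤ k → k < σ.nat 28 v →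
      σ.nat 29 (σ.nat 21 k) = c / q ^ (k - σ.nat 27 v) % q) :
    Runs carryProg σ fun σ' t => (∀ k, σ.nat 27 v ≤ k → k < σ.nat 28 v →
        σ'.nat 29 (σ.nat 21 k) = (c + 1) / q ^ (k - σ.nat 27 v) % q) ∧
      t ≤ 7 * (σ.nat 28 v - σ.nat 27 v) + 3 := by
  unfold carryProg
  rw [runs_seq, runs_setNat]
  simp only [NExp.val]
  set σ₁ := σ.writeNat 31 0 1 with hσ₁
  refine (runs_for_sum (σ := σ₁) (fun k σ' => (∀ i, σ.nat 27 v ≤ i → i < σ.nat 28 v →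
        σ'.nat 29 (σ.nat 21 i) = (if i < k then c + 1 else c) / q ^ (i - σ.nat 27 v) % q) ∧
        σ'.nat 31 0 = if q ^ (k - σ.nat 27 v) ∣ c + 1 then 1 else 0)
      (fun _ => 5) (a := σ.nat 27 v) (b := σ.nat 28 v)
      (by simp [NExp.val, hσ₁, hvar])
      hle (forSegment_hi (σ := σ₁) rfl rfl hvar) rfl ?_ ?_ ?_).mono ?_
  · intro k σ' x h; exact h
  · rintro k σ' hk1 hk2 hag hk ⟨hI, hc⟩
    have h21 : σ'.nat 21 = σ.nat 21 := by rw [hag.nat 21 rfl]; rfl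
    have h0 : σ'.nat 0 1 = q := by rw [hag.nat 0 rfl]; exact hin.size_q
    set u := σ.nat 21 k with hu
    set a := c / q ^ (k - σ.nat 27 v) % q with ha
    have hxa : σ'.nat 29 u = a := by
      rw [hI k hk1 hk2, if_neg (lt_irrefl k)]
    have hother : ∀ (σ'' : State) (x : ℕ), σ''.nat 29 = Function.update (σ'.nat 29) u x →
        x = (c + 1) / q ^ (k - σ.nat 27 v) % q →
        ∀ i, σ.nat 27 v ≤ i → i < σ.nat 28 v →
        σ''.nat 29 (σ.nat 21 i) = (if i < k + 1 then c + 1 else c) / q ^ (i - σ.nat 27 v) % q := by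
      intro σ'' x hσ'' hx i hi1 hi2
      rw [hσ'']
      by_cases hik : i = k
      · rw [hik, ← hu, Function.update_self, if_pos (by omega), hx]
      · rw [Function.update_of_ne (fun h => hik (hinj i k hi1 hi2 hk1 hk2 h)), hI i hi1 hi2]
        have : i < k ↔ i < k + 1 := by omega
        simp only [this]
    have hsucc : k + 1 - σ.nat 27 v = k - σ.nat 27 v + 1 := by omega
    unfold carryStep
    rw [runs_seq, runs_setNat, runs_seq, runs_setNat]
    have hv14 : NExp.val σ' (.get 21 (.var 18)) = u := by
      simp only [NExp.val]; rw [hk, h21]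
    rw [hv14]
    set b := if q ^ (k - σ.nat 27 v) ∣ c + 1 then 1 else 0 with hb
    have hv32 : NExp.val (σ'.writeNat 14 ((NExp.lit 0).val σ') u)
        (.add (.get 29 (.var 14)) (.var 31)) = a + b := by
      simp [NExp.val, hxa, hc]
    rw [hv32]
    simp only [NExp.val]
    obtain ⟨hd1, hd2⟩ := digit_carry (c := c) (j := k - σ.nat 27 v) hq
    by_cases hab : a + b = q
    · rw [runs_cond_of_true (by simp [Test.Holds, NExp.val, hab, h0]), runs_setNat]
      obtain ⟨e1, e2, e3⟩ := hd1 hab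
      refine ⟨⟨hother _ 0 (by simp [NExp.val]) e1.symm, ?_⟩, by omega⟩
      rw [hsucc, if_pos e2]
      simp only [ne_eq, Nat.reduceEqDiff, not_false_eq_true, nat_writeNat_of_ne]
      rw [hc, hb, if_pos e3]
    · rw [runs_cond_of_false (by simp [Test.Holds, NExp.val, hab, h0]), runs_seq, runs_setNat,
        runs_setNat]
      obtain ⟨e1, e2⟩ := hd2 hab
      refine ⟨⟨hother _ (a + b) (by simp [NExp.val]) e1.symm, ?_⟩, by omega⟩
      rw [hsucc, if_neg e2]
      simp [NExp.val]
  · refine ⟨fun i hi1 hi2 => ?_, ?_⟩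
    · rw [if_neg (by omega)]; exact hx i hi1 hi2
    · simp [hσ₁]
  · rintro σ' t - ⟨⟨a1, -⟩, a2⟩
    refine ⟨fun k hk1 hk2 => ?_, ?_⟩
    · rw [a1 k hk1 hk2, if_pos hk2]
    · simp only [Finset.sum_const, Nat.card_Ico, smul_eq_mul] at a2
      omega

theorem runs_initProg (hin : Input M r Λ σ) {v : ℕ} (hvar : σ.nat 11 0 = v)
    (hle : σ.nat 27 v ≤ σ.nat 28 v) :
    Runs initProg σ fun σ' t => (σ'.nat 30 0 = q ^ (σ.nat 28 v - σ.nat 27 v) ∧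
      ∀ k, σ.nat 27 v ≤ k → k < σ.nat 28 v → σ'.nat 29 (σ.nat 21 k) = 0) ∧
      t ≤ 4 * (σ.nat 28 v - σ.nat 27 v) + 3 := by
  unfold initProg
  rw [runs_seq, runs_setNat]
  simp only [NExp.val]
  set σ₁ := σ.writeNat 30 0 1 with hσ₁
  refine (runs_for_sum (σ := σ₁) (fun k σ' => σ'.nat 30 0 = q ^ (k - σ.nat 27 v) ∧
      ∀ i, σ.nat 27 v ≤ i → i < k → σ'.nat 29 (σ.nat 21 i) = 0)
      (fun _ => 2) (a := σ.nat 27 v) (b := σ.nat 28 v)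
      (by simp [NExp.val, hσ₁, hvar])
      hle (forSegment_hi (σ := σ₁) rfl rfl hvar) rfl ?_ ?_ ?_).mono ?_
  · intro k σ' x h; exact h
  · rintro k σ' hk1 hk2 hag hk ⟨h30, hI⟩
    have h21 : σ'.nat 21 = σ.nat 21 := by rw [hag.nat 21 rfl]; rfl
    have h0 : σ'.nat 0 1 = q := by rw [hag.nat 0 rfl]; exact hin.size_q
    rw [runs_seq, runs_setNat, runs_setNat]
    refine ⟨⟨?_, fun i hi1 hi2 => ?_⟩, by omega⟩
    · simp only [NExp.val, ne_eq, Nat.reduceEqDiff, not_false_eq_true, nat_writeNat_of_ne,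
        nat_writeNat_self, Function.update_self, h30, h0]
      rw [← pow_succ]
      congr 1
      omega
    · simp only [NExp.val, ne_eq, Nat.reduceEqDiff, not_false_eq_true, nat_writeNat_of_ne,
        nat_writeNat_self, h21, hk]
      by_cases he : σ.nat 21 i = σ.nat 21 k
      · rw [he, Function.update_self]
      · rw [Function.update_of_ne he]
        refine hI i hi1 ?_
        have : i ≠ k := fun h => he (by rw [h])
        omega
  · refine ⟨by simp [hσ₁], fun i h1 h2 => by omega⟩
  · rintro σ' t - ⟨a1, a2⟩
    refine ⟨a1, ?_⟩
    simp only [Finset.sum_const, Nat.card_Ico, smul_eq_mul] at a2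
    omega

/-- The number of steps used for each assignment. -/
def assignCost (σ : State) (v : ℕ) : ℕ :=
  ∑ k ∈ Finset.Ico (σ.nat 27 v) (σ.nat 28 v), (6 * σ.deg (σ.nat 21 k) + 6) +
    7 * (σ.nat 28 v - σ.nat 27 v) + 7

/-- The hypothesis `hW` says that the energy depends only on the labels within the segment, hence
only on `c`. Leftover labels of other components in the array do no harm. -/
theorem runs_compProg (hin : Input M r Λ σ) (hq : 0 < q) {v : ℕ} (hvar : σ.nat 11 0 = v)
    (hle : σ.nat 27 v ≤ σ.nat 28 v)
    (hQ : ∀ k, σ.nat 27 v ≤ k → k < σ.nat 28 v → σ.nat 21 k < n)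
    (hinj : ∀ i j, σ.nat 27 v ≤ i → i < σ.nat 28 v → σ.nat 27 v ≤ j → j < σ.nat 28 v →
      σ.nat 21 i = σ.nat 21 j → i = j) {W : ℕ → ℝ}
    (hW : ∀ (c : ℕ) (y : ℕ → ℕ), (∀ k, σ.nat 27 v ≤ k → k < σ.nat 28 v →
      y (σ.nat 21 k) = c / q ^ (k - σ.nat 27 v) % q) →
      ∑ k ∈ Finset.Ico (σ.nat 27 v) (σ.nat 28 v), vertexEnergy q σ y (σ.nat 21 k) = W c) :
    Runs compProg σ fun σ' t =>
      (σ'.real 2 0 = σ.real 2 0 +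
          Real.log (∑ c ∈ Finset.range (q ^ (σ.nat 28 v - σ.nat 27 v)), Real.exp (W c)) ∧
        σ'.real 2 1 = σ.real 2 1 +
          Real.log (∑ c ∈ Finset.range (q ^ (σ.nat 28 v - σ.nat 27 v)), Real.exp (W c))) ∧
      t ≤ q ^ (σ.nat 28 v - σ.nat 27 v) * (assignCost σ v + 2) +
        4 * (σ.nat 28 v - σ.nat 27 v) + 8 := by
  unfold compProg
  rw [runs_seq]
  refine (runs_initProg hin hvar hle).mono ?_
  rintro σ₁ t₁ hag₁ ⟨⟨h30, hx₁⟩, ht₁⟩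
  have hin₁ : Input M r Λ σ₁ := hin.of_agree hag₁ rfl rfl rfl rfl rfl
  rw [runs_seq, runs_setReal]
  set σ₂ := σ₁.writeReal 4 ((NExp.lit 0).val σ₁) ((RExp.cast (.lit 0)).val σ₁) with hσ₂
  have hin₂ : Input M r Λ σ₂ := hin₁.congr rfl rfl rfl rfl rfl
  rw [runs_seq]
  set m := σ.nat 28 v - σ.nat 27 v with hm
  refine (runs_for_sum (σ := σ₂) (fun c σ' => σ'.real 4 0 = ∑ c' ∈ Finset.range c, Real.exp (W c') ∧
      ∀ k, σ.nat 27 v ≤ k → k < σ.nat 28 v →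
        σ'.nat 29 (σ.nat 21 k) = c / q ^ (k - σ.nat 27 v) % q)
      (fun _ => assignCost σ v) (a := 0) (b := q ^ m) rfl (Nat.zero_le _) ?_ rfl ?_ ?_ ?_).mono ?_
  · intro σ' hag
    simp only [NExp.val]
    rw [hag.nat 30 rfl]
    exact h30
  · intro c σ' x h; exact h
  · rintro c σ' - hc hag - ⟨hz, hx⟩
    have hin' : Input M r Λ σ' := hin₂.of_agree hag rfl rfl rfl rfl rfl
    have e11 : σ'.nat 11 0 = v := by
      rw [hag.nat 11 rfl]
      change σ₁.nat 11 0 = v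
      rw [hag₁.nat 11 rfl, hvar]
    have e27 : σ'.nat 27 = σ.nat 27 := by rw [hag.nat 27 rfl]; exact hag₁.nat 27 rfl
    have e28 : σ'.nat 28 = σ.nat 28 := by rw [hag.nat 28 rfl]; exact hag₁.nat 28 rfl
    have e21 : σ'.nat 21 = σ.nat 21 := by rw [hag.nat 21 rfl]; exact hag₁.nat 21 rfl
    have e1 : σ'.nat 1 = σ.nat 1 := by rw [hag.nat 1 rfl]; exact hag₁.nat 1 rfl
    have e2 : σ'.nat 2 = σ.nat 2 := by rw [hag.nat 2 rfl]; exact hag₁.nat 2 rfl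
    have e26 : σ'.nat 26 = σ.nat 26 := by rw [hag.nat 26 rfl]; exact hag₁.nat 26 rfl
    have er0 : σ'.real 0 = σ.real 0 := by rw [hag.real 0 rfl]; exact hag₁.real 0 rfl
    have er1 : σ'.real 1 = σ.real 1 := by rw [hag.real 1 rfl]; exact hag₁.real 1 rfl
    have hdeg : ∀ u, σ'.deg u = σ.deg u := fun u => by unfold State.deg; rw [e1]
    unfold assignProg
    rw [runs_seq]
    refine (runs_energyProg hin' e11 (by rw [e27, e28]; exact hle)
      (by rw [e27, e28, e21]; exact hQ)).mono ?_
    rintro σ₃ t₃ hag₃ ⟨h3, ht₃⟩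
    simp only [vertexEnergy_congr er0 er1 e1 e2 e26, e27, e28, e21, hdeg] at h3 ht₃
    rw [hW c (σ'.nat 29) hx] at h3
    rw [runs_seq, runs_setReal]
    have hin₃ : Input M r Λ σ₃ := hin'.of_agree hag₃ rfl rfl rfl rfl rfl
    set σ₄ := σ₃.writeReal 4 ((NExp.lit 0).val σ₃)
      ((RExp.add (.var 4) (.exp (.var 3))).val σ₃) with hσ₄
    have f27 : σ₄.nat 27 = σ.nat 27 := (hag₃.nat 27 rfl).trans e27
    have f28 : σ₄.nat 28 = σ.nat 28 := (hag₃.nat 28 rfl).trans e28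
    have f21 : σ₄.nat 21 = σ.nat 21 := (hag₃.nat 21 rfl).trans e21
    have f29 : σ₄.nat 29 = σ'.nat 29 := hag₃.nat 29 rfl
    have f11 : σ₄.nat 11 0 = v := by
      change σ₃.nat 11 0 = v
      rw [hag₃.nat 11 rfl, e11]
    have hin₄ : Input M r Λ σ₄ := hin₃.congr rfl rfl rfl rfl rfl
    refine (runs_carryProg hin₄ hq f11 (by rw [f27, f28]; exact hle)
      (by rw [f27, f28, f21]; exact hinj) (c := c)
      (by rw [f27, f28, f21, f29]; exact hx)).mono ?_
    rintro σ₅ t₅ hag₅ ⟨hx₅, ht₅⟩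
    rw [f27, f28, f21] at hx₅
    rw [f27, f28] at ht₅
    refine ⟨⟨?_, hx₅⟩, ?_⟩
    · rw [hag₅.real 4 rfl, Finset.sum_range_succ, ← hz]
      simp [hσ₄, RExp.val, NExp.val, h3, hag₃.real 4 rfl]
    · unfold assignCost
      omega
  · refine ⟨by simp [hσ₂, RExp.val, NExp.val], fun k hk1 hk2 => ?_⟩
    rw [Nat.zero_div, Nat.zero_mod]
    exact hx₁ k hk1 hk2
  · rintro σ₆ t₆ hag₆ ⟨⟨hz, -⟩, ht₆⟩
    have h2 : σ₆.real 2 = σ.real 2 := by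
      rw [hag₆.real 2 rfl]
      exact hag₁.real 2 rfl
    rw [runs_seq, runs_setReal, runs_setReal]
    refine ⟨⟨?_, ?_⟩, ?_⟩
    · simp [RExp.val, NExp.val, h2, hz]
    · simp [RExp.val, NExp.val, h2, hz]
    · simp only [Finset.sum_const, Nat.card_Ico, smul_eq_mul, tsub_zero] at ht₆
      omega

end RAM

/-! ## The components as segments of the queue -/

namespace SearchData.Result

variable {n Λ : ℕ} {H : SimpleGraph (Fin n)} {A : SearchData} {sS sE : ℕ → ℕ}

theorem exists_queue {E : ℕ → ℕ → Prop} (R : Result n Λ E A sS sE) {w : ℕ} (hw : w < n) :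
    ∃ k < n, A.queue k = w := by
  have hinj : Function.Injective fun k : Fin n => (⟨A.queue k, R.queue_lt k k.2⟩ : Fin n) :=
    fun i j h => Fin.ext (R.queue_inj i i.2 j j.2 (by simpa using h))
  obtain ⟨k, hk⟩ := Finite.surjective_of_injective hinj ⟨w, hw⟩
  exact ⟨k, k.2, congrArg Fin.val hk⟩

theorem mem_supp_iff (R : Result n Λ (natAdj H) A sS sE) {v w : Fin n} (hv : A.root v = v) :
    w ∈ (H.connectedComponentMk v).supp ↔ A.root w = v := by
  rw [SimpleGraph.ConnectedComponent.mem_supp_iff, SimpleGraph.ConnectedComponent.eq,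
    R.reachable_iff, hv]

theorem segment_lt {E : ℕ → ℕ → Prop} (R : Result n Λ E A sS sE) {v k : ℕ} (hv : v < n)
    (hr : A.root v = v) (h : k < sE v) : k < n :=
  h.trans_le (R.seg v hv hr).2.1

/-- The vertices of a component are enumerated by a segment of the queue. -/
noncomputable def segmentEquiv (R : Result n Λ (natAdj H) A sS sE) {v : Fin n}
    (hv : A.root v = v) : Fin (sE v - sS v) ≃ (H.connectedComponentMk v).supp :=
  have hlt : ∀ j : Fin (sE v - sS v), sS v + j < sE v := fun j => by have := j.2; omega
  Equiv.ofBijective (fun j => ⟨⟨A.queue (sS v + j), R.queue_lt _ (R.segment_lt v.2 hv (hlt j))⟩,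
    (R.mem_supp_iff hv).2 (((R.seg v v.2 hv).2.2 _ (R.segment_lt v.2 hv (hlt j))).2
      ⟨Nat.le_add_right _ _, hlt j⟩)⟩) (by
    constructor
    · intro i j h
      have h1 : A.queue (sS v + i) = A.queue (sS v + j) := by simpa using h
      have h2 := R.queue_inj _ (R.segment_lt v.2 hv (hlt i)) _ (R.segment_lt v.2 hv (hlt j)) h1
      exact Fin.ext (by omega)
    · rintro ⟨w, hw⟩
      obtain ⟨k, hk, hkw⟩ := R.exists_queue w.2
      have h1 := (R.mem_supp_iff hv).1 hw
      rw [← hkw] at h1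
      obtain ⟨h2, h3⟩ := ((R.seg v v.2 hv).2.2 k hk).1 h1
      refine ⟨⟨k - sS v, by omega⟩, Subtype.ext (Fin.ext ?_)⟩
      change A.queue (sS v + (k - sS v)) = w
      rw [Nat.add_sub_cancel' h2, hkw])

theorem segment_length (R : Result n Λ (natAdj H) A sS sE) {v : Fin n} (hv : A.root v = v) :
    sE v - sS v = (H.connectedComponentMk v).supp.ncard := by
  rw [← Nat.card_coe_set_eq, ← Nat.card_congr (R.segmentEquiv hv), Nat.card_fin]

theorem sum_segment (R : Result n Λ (natAdj H) A sS sE) {v : Fin n} (hv : A.root v = v)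
    [Fintype (H.connectedComponentMk v).supp] (F : ℕ → ℝ) : ∑ k ∈ Finset.Ico (sS v) (sE v), F (A.queue k) =
      ∑ w : (H.connectedComponentMk v).supp, F (w : Fin n) := by
  rw [Finset.sum_Ico_eq_sum_range, ← Fin.sum_univ_eq_sum_range (fun j => F (A.queue (sS v + j))),
    ← (R.segmentEquiv hv).sum_comp]
  rfl

/-- Segments of different roots are disjoint parts of the queue, so costs charged to the vertices of
the components add up without repetition. -/
theorem sum_segments_le {E : ℕ → ℕ → Prop} (R : Result n Λ E A sS sE) (g : ℕ → ℕ) :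
    ∑ v ∈ Finset.range n, (if A.root v = v then
      ∑ k ∈ Finset.Ico (sS v) (sE v), g (A.queue k) else 0) ≤ ∑ w ∈ Finset.range n, g w := by
  calc _ ≤ ∑ v ∈ Finset.range n, ∑ k ∈ Finset.range n with A.root (A.queue k) = v,
        g (A.queue k) := by
        refine Finset.sum_le_sum fun v hv => ?_
        split_ifs with h
        · refine Finset.sum_le_sum_of_subset fun k hk => ?_
          have hvn := Finset.mem_range.1 hv
          have hkn := R.segment_lt hvn h (Finset.mem_Ico.1 hk).2
          exact Finset.mem_filter.2 ⟨Finset.mem_range.2 hkn,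
            ((R.seg v hvn h).2.2 k hkn).2 (Finset.mem_Ico.1 hk)⟩
        · exact Nat.zero_le _
    _ = ∑ k ∈ Finset.range n, g (A.queue k) := Finset.sum_fiberwise_of_maps_to (fun k hk =>
        Finset.mem_range.2 (R.root_lt _ (R.queue_lt k (Finset.mem_range.1 hk)))) _
    _ = ∑ w ∈ (Finset.range n).image A.queue, g w := by
        rw [Finset.sum_image]
        intro i hi j hj h
        exact R.queue_inj i (by simpa using hi) j (by simpa using hj) h
    _ ≤ _ := Finset.sum_le_sum_of_subset fun x hx => by
        obtain ⟨k, hk, rfl⟩ := Finset.mem_image.1 hx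
        exact Finset.mem_range.2 (R.queue_lt k (Finset.mem_range.1 hk))

/-- A sum over the components is a sum over their roots. -/
theorem sum_components (R : Result n Λ (natAdj H) A sS sE) [Fintype H.ConnectedComponent] (f : H.ConnectedComponent → ℝ) :
    ∑ c, f c = ∑ v : Fin n, if A.root v = v then f (H.connectedComponentMk v) else 0 := by
  refine Fintype.sum_of_injective (fun c => minRoot n 0 H c) ?_ _ _ ?_ ?_
  · intro c c' h
    rw [← minRoot_valid n 0 H c, ← minRoot_valid n 0 H c']
    exact congrArg _ h
  · intro v hv
    rw [if_neg]
    intro h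
    refine hv ⟨H.connectedComponentMk v, ?_⟩
    simp only
    rw [R.minRoot_eq]
    exact Fin.ext h
  · intro c
    have h := R.minRoot_eq 0 (minRoot n 0 H c)
    rw [minRoot_valid] at h
    rw [if_pos (congrArg Fin.val h).symm, minRoot_valid]

end SearchData.Result

/-! ### Partition functions of all components -/

namespace RAM

variable {n q : ℕ} {M : PairwiseMRF n q} {r Λ : ℕ} {σ : State}

open scoped Classical in
/-- The exponent in the partition function of a component. -/
noncomputable def componentEnergy (M : PairwiseMRF n q) (H : SimpleGraph (Fin n)) (S : Set (Fin n))
    (x : S → Fin q) : ℝ :=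
  (∑ v : S, (M.φ v (x v) : ℝ)) +
    ∑ u : S, ∑ v : S, if u < v ∧ H.Adj u v then (M.ψ u v (x u) (x v) : ℝ) else 0

/-- Each edge of the component is counted at its smaller endpoint, and an unmarked cell of a vertex
leads to a vertex of the same component. Thus no label outside the component is read. -/
theorem sum_vertexEnergy (hin : Input M r Λ σ) {B : Set (Sym2 (Fin n))} (hB : CutMarks n σ B)
    {sS sE : ℕ → ℕ} {H : SimpleGraph (Fin n)} (hH : H = M.graph.deleteEdges B)
    (R : SearchData.Result n Λ (natAdj H) σ.search sS sE) {v : Fin n}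
    (hv : σ.nat 24 v = v)
    (x : (H.connectedComponentMk v).supp → Fin q) {y : ℕ → ℕ}
    (hy : ∀ w : (H.connectedComponentMk v).supp, y (w : Fin n) = x w) :
    ∑ k ∈ Finset.Ico (sS v) (sE v), vertexEnergy q σ y (σ.nat 21 k) =
      componentEnergy M H _ x := by
  classical
  have hHadj : ∀ {a b}, H.Adj a b ↔ M.graph.Adj a b ∧ s(a, b) ∉ B := by
    rw [hH]; exact SimpleGraph.deleteEdges_adj
  unfold componentEnergy
  rw [← Finset.sum_add_distrib]
  refine (R.sum_segment hv (vertexEnergy q σ y)).trans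
    (Finset.sum_congr (Finset.ext fun _ => by simp) fun u _ => ?_)
  unfold vertexEnergy
  congr 1
  · rw [hy u]; exact hin.vertex_pot _ _
  · rw [sum_cells hin (u : Fin n) (G := fun w =>
      if h : w ∈ (H.connectedComponentMk v).supp then
        if (u : Fin n) < w ∧ H.Adj u w then (M.ψ u w (x u) (x ⟨w, h⟩) : ℝ) else 0 else 0)]
    · symm
      refine (Finset.sum_congr (Finset.ext fun _ => by simp) fun _ _ => rfl).trans
        (Fintype.sum_of_injective (fun w : (H.connectedComponentMk v).supp => (w : Fin n))
        Subtype.val_injective _ _ ?_ ?_)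
      · intro w hw
        rw [dif_neg (fun h => hw ⟨⟨w, h⟩, rfl⟩), ite_self]
      · intro w
        rw [dif_pos w.2]
        by_cases h : (u : Fin n) < w ∧ H.Adj u w
        · have h1 : M.graph.Adj u w := (hHadj.1 h.2).1
          rw [if_pos h1, if_pos h, if_pos ⟨h.1, h.2⟩]
        · rw [if_neg (fun h' => h ⟨h'.1, h'.2⟩), if_neg h, ite_self]
    · intro s w h1 h2 h3
      have hadj := (hin.neighbours u w).2 ⟨s, h1, h2, h3⟩
      have hcut := hB u w s h1 h2 h3
      rw [h3]
      by_cases h : (u : Fin n) < w ∧ H.Adj u w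
      · have hw : w ∈ (H.connectedComponentMk v).supp := by
          have hu := u.2
          rw [SimpleGraph.ConnectedComponent.mem_supp_iff] at hu ⊢
          rw [← hu]
          exact SimpleGraph.ConnectedComponent.eq.2 h.2.symm.reachable
        have h0 : σ.nat 26 s = 0 := by
          by_contra hne
          exact (hHadj.1 h.2).2 (hcut.1 hne)
        rw [dif_pos hw, if_pos h, if_pos ⟨h0, h.1⟩, hy u]
        have := hy ⟨w, hw⟩
        rw [show y (w : ℕ) = x ⟨w, hw⟩ from this]
        exact edge_table hin h1 h2 h3 h.1 _ _
      · rw [if_neg]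
        · simp only [if_neg h, dite_eq_ite, ite_self]
        · rintro ⟨h0, hlt⟩
          refine h ⟨hlt, hHadj.2 ⟨hadj, fun hmem => hcut.2 hmem h0⟩⟩

/-- The assignment number `c` of a component. -/
def assignment (hq : 0 < q) {m : ℕ} {S : Set (Fin n)} (e : Fin m ≃ S) (c : ℕ) (w : S) : Fin q :=
  ⟨c / q ^ (e.symm w : ℕ) % q, Nat.mod_lt _ hq⟩

/-- Writing numbers below `q ^ m` in base `q` is a bijection to the assignments, once the vertices
of the component are numbered by their positions in the segment. -/
theorem ZOn_eq_sum_range (M : PairwiseMRF n q) (hq : 0 < q) (H : SimpleGraph (Fin n)) {m : ℕ}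
    {S : Set (Fin n)} (e : Fin m ≃ S) : M.ZOn H S =
      ∑ c ∈ Finset.range (q ^ m), Real.exp (componentEnergy M H S (assignment hq e c)) := by
  classical
  rw [← Fin.sum_univ_eq_sum_range
    (fun c => Real.exp (componentEnergy M H S (assignment hq e c)))]
  unfold PairwiseMRF.ZOn
  change ∑ x : S → Fin q, Real.exp (componentEnergy M H S x) = _
  rw [← (e.arrowCongr (Equiv.refl (Fin q))).sum_comp, ← finFunctionFinEquiv.symm.sum_comp]
  refine Finset.sum_congr rfl fun c _ => ?_
  congr 2

open scoped Classical in
-- A component with `m ≤ s` vertices costs `q ^ m ≤ q ^ s` evaluations, each linear in its vertices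
-- and cells. Summing over the segments leaves `q ^ s` times the size of the graph.
theorem runs_enumProg (hin : Input M r Λ σ) (hq : 0 < q) {B : Set (Sym2 (Fin n))}
    (hB : CutMarks n σ B)
    (R : SearchData.Result n Λ (natAdj (M.graph.deleteEdges B)) σ.search (σ.nat 27) (σ.nat 28))
    {s : ℕ} (hs : ∀ c : (M.graph.deleteEdges B).ConnectedComponent, c.supp.ncard ≤ s) :
    Runs enumProg σ fun σ' t => (σ'.real 2 0 = σ.real 2 0 + M.sumLogZ B ∧
      σ'.real 2 1 = σ.real 2 1 + M.sumLogZ B) ∧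
      t ≤ q ^ s * (6 * σ.nat 1 n + 34 * n) + 4 * n + 2 := by
  set H := M.graph.deleteEdges B with hH
  set f : ℕ → ℝ := fun v => if h : v < n then (if σ.nat 24 v = v then
    Real.log (M.ZOn H (H.connectedComponentMk ⟨v, h⟩).supp) else 0) else 0 with hf
  have hsum : M.sumLogZ B = ∑ v ∈ Finset.range n, f v := by
    rw [← Fin.sum_univ_eq_sum_range]
    refine (R.sum_components fun c => Real.log (M.ZOn H c.supp)).trans ?_
    refine Finset.sum_congr rfl fun v _ => ?_
    simp only [hf, v.2, dif_pos]
    rfl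
  rw [hsum]
  -- The constants absorb lower order terms by `1 ≤ q ^ s`: the first `17` is `13` per vertex and
  -- assignment plus `4` per vertex for the setup, the second is the overhead `9` per assignment
  -- plus `8` per component.
  set T : ℕ → ℕ := fun v => q ^ s * (if σ.nat 24 v = v then
    ∑ k ∈ Finset.Ico (σ.nat 27 v) (σ.nat 28 v), (6 * σ.deg (σ.nat 21 k) + 17) else 0) +
      17 * q ^ s + 2 with hT
  unfold enumProg
  have hqs : 0 < q ^ s := pow_pos hq s
  refine (runs_for_sum (fun v σ' => σ'.real 2 0 = σ.real 2 0 + ∑ u ∈ Finset.range v, f u ∧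
      σ'.real 2 1 = σ.real 2 1 + ∑ u ∈ Finset.range v, f u)
      T (a := 0) (b := n) rfl
      (Nat.zero_le _) ?_ rfl ?_ ?_ ?_).mono ?_
  · intro σ' hag
    simp only [NExp.val]
    rw [hag.nat 0 rfl]; exact hin.size_n
  · intro k σ' x h; exact h
  · intro v σ' _ hv hag hvar hI
    have hin' : Input M r Λ σ' := hin.of_agree hag rfl rfl rfl rfl rfl
    have e24 : σ'.nat 24 = σ.nat 24 := hag.nat 24 rfl
    by_cases hr : σ.nat 24 v = v
    · rw [runs_cond_of_true (by simp [Test.Holds, NExp.val, hvar, e24, hr])]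
      have e27 : σ'.nat 27 = σ.nat 27 := hag.nat 27 rfl
      have e28 : σ'.nat 28 = σ.nat 28 := hag.nat 28 rfl
      have e21 : σ'.nat 21 = σ.nat 21 := hag.nat 21 rfl
      have e1 : σ'.nat 1 = σ.nat 1 := hag.nat 1 rfl
      have hdeg : ∀ u, σ'.deg u = σ.deg u := fun u => by unfold State.deg; rw [e1]
      obtain ⟨hle, hn, -⟩ := R.seg v hv hr
      set v' : Fin n := ⟨v, hv⟩ with hv'
      have hr' : σ.search.root v' = v' := hr
      set e := R.segmentEquiv hr' with he
      have hm : σ.nat 28 v - σ.nat 27 v ≤ s :=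
        (R.segment_length hr').le.trans (hs _)
      refine (runs_compProg hin' hq hvar (by rw [e27, e28]; exact hle)
        (by rw [e28, e21]; exact fun k _ h => R.queue_lt k (by omega))
        (by
          rw [e27, e28, e21]
          exact fun i j _ hi _ hj h => R.queue_inj i (by omega) j (by omega) h)
        (W := fun c => componentEnergy M H _ (assignment hq e c)) ?_).mono ?_
      · rw [e27, e28, e21]
        intro c y hy
        simp only [vertexEnergy_congr (hag.real 0 rfl) (hag.real 1 rfl) e1 (hag.nat 2 rfl)
          (hag.nat 26 rfl)]
        refine sum_vertexEnergy hin hB hH R hr (assignment hq e c) fun w => ?_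
        obtain ⟨j, rfl⟩ := e.surjective w
        have hj := j.2
        have h1 := hy (σ.nat 27 v + j) (Nat.le_add_right _ _) (by simp only [hv'] at hj; omega)
        rw [Nat.add_sub_cancel_left] at h1
        change _ = c / q ^ (e.symm (e j) : ℕ) % q
        rw [Equiv.symm_apply_apply]
        exact h1
      · rintro σ'' t - ⟨⟨a1, a2⟩, a3⟩
        rw [e27, e28] at a1 a2 a3
        have hZ := ZOn_eq_sum_range M hq H e
        have hfv : f v = Real.log (∑ c ∈ Finset.range (q ^ (σ.nat 28 v - σ.nat 27 v)),
            Real.exp (componentEnergy M H _ (assignment hq e c))) := by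
          simp only [hf, hv, dif_pos, hr, if_true]
          exact congrArg Real.log hZ
        refine ⟨⟨?_, ?_⟩, ?_⟩
        · rw [a1, hI.1, Finset.sum_range_succ, hfv, add_assoc]
        · rw [a2, hI.2, Finset.sum_range_succ, hfv, add_assoc]
        · simp only [hT, hr, if_true]
          unfold assignCost at a3
          simp only [e27, e28, e21, hdeg] at a3
          set m := σ.nat 28 v - σ.nat 27 v with hmdef
          have hpow : q ^ m ≤ q ^ s := Nat.pow_le_pow_right hq hm
          simp only [Finset.sum_add_distrib, Finset.sum_const, Nat.card_Ico, smul_eq_mul,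
            ← hmdef] at a3 ⊢
          set S := ∑ k ∈ Finset.Ico (σ.nat 27 v) (σ.nat 28 v), 6 * σ.deg (σ.nat 21 k)
          nlinarith [Nat.mul_le_mul_right (S + m * 6 + 7 * m + 7 + 2) hpow,
            Nat.mul_le_mul_right (4 * m + 8) (show 1 ≤ q ^ s from hqs)]
    · rw [runs_cond_of_false (by simp [Test.Holds, NExp.val, hvar, e24, hr]), runs_skip]
      have hfv : f v = 0 := by simp [hf, hv, hr]
      refine ⟨⟨?_, ?_⟩, by simp only [hT]; omega⟩
      · rw [hI.1, Finset.sum_range_succ, hfv, add_zero]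
      · rw [hI.2, Finset.sum_range_succ, hfv, add_zero]
  · simp
  · rintro σ' t - ⟨a1, a2⟩
    refine ⟨a1, a2.trans ?_⟩
    have hseg := R.sum_segments_le fun w => 6 * σ.deg w + 17
    have hdeg : ∑ w ∈ Finset.range n, (6 * σ.deg w + 17) = 6 * σ.nat 1 n + 17 * n := by
      rw [Finset.sum_add_distrib, ← Finset.mul_sum, hin.off_eq_sum le_rfl]
      simp [State.deg, mul_comm]
    rw [hdeg] at hseg
    have hT' : ∑ v ∈ Finset.Ico 0 n, (T v + 2) = q ^ s * (∑ v ∈ Finset.range n,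
        if σ.nat 24 v = v then ∑ k ∈ Finset.Ico (σ.nat 27 v) (σ.nat 28 v),
          (6 * σ.deg (σ.nat 21 k) + 17) else 0) + 17 * q ^ s * n + 4 * n := by
      simp only [hT, Nat.Ico_zero_eq_range, Finset.sum_add_distrib, ← Finset.mul_sum,
        Finset.sum_const, Finset.card_range, smul_eq_mul]
      ring
    rw [hT']
    have := Nat.mul_le_mul_left (q ^ s) hseg
    have e : q ^ s * (6 * σ.nat 1 n + 34 * n) =
      q ^ s * (6 * σ.nat 1 n + 17 * n) + 17 * q ^ s * n := by ring
    rw [e]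
    have h' : q ^ s * (∑ v ∈ Finset.range n,
        if σ.nat 24 v = v then ∑ k ∈ Finset.Ico (σ.nat 27 v) (σ.nat 28 v),
          (6 * σ.deg (σ.nat 21 k) + 17) else 0) ≤ q ^ s * (6 * σ.nat 1 n + 17 * n) := this
    omega

end RAM

namespace RAM

variable {n q : ℕ} {M : PairwiseMRF n q} {r Λ : ℕ} {σ : State}

/-! ## The program -/

/-- Log Partition with Minor-e. -/
def logPartition : Prog :=
  .seq decompProg <| .seq clearProg <| .seq sweepProg <| .seq boundsProg enumProg

open scoped Classical in
theorem Input.off_eq_sum_degree (hin : Input M r Λ σ) : σ.nat 1 n = ∑ v, M.graph.degree v := by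
  rw [hin.off_eq_sum le_rfl, ← Fin.sum_univ_eq_sum_range (fun v => σ.nat 1 (v + 1) - σ.nat 1 v)]
  refine Finset.sum_congr rfl fun v _ => ?_
  rw [hin.off_succ, Nat.add_sub_cancel_left, Set.ncard_eq_toFinset_card',
    ← SimpleGraph.card_neighborFinset_eq_degree]
  rfl

open scoped Classical in
-- The last search recomputes the components of the final graph, and the roots and queue segments it
-- leaves drive the enumeration. The exponent is at least `2` because reading the table of a removed
-- edge takes about `q²` steps.
theorem runs_logPartition {L : Draws n r Λ} (henc : Encodes M r Λ L σ) (hn : 0 < n) (hq : 0 < q)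
    (hΛ : 0 < Λ) {s : ℕ}
    (hs : ∀ c : (M.graph.deleteEdges (minorE M.graph r Λ (minRoot n) L)).ConnectedComponent,
      c.supp.ncard ≤ s) :
    Runs logPartition σ fun σ' t =>
      (σ'.real 2 0 = M.logLB (minorE M.graph r Λ (minRoot n) L) ∧
        σ'.real 2 1 = M.logUB (minorE M.graph r Λ (minRoot n) L)) ∧
      t ≤ 80 * (r + 1) * (n + ∑ v, M.graph.degree v) * q ^ max 2 s := by
  have hin := henc.input
  set B := minorE M.graph r Λ (minRoot n) L with hBdef
  have hsub : B ⊆ M.graph.edgeSet := minorEIter_subset r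
  unfold logPartition
  rw [runs_seq]
  refine (runs_decompProg hin hΛ (henc.nat_zero 26 (by norm_num)) henc.random).mono ?_
  rintro σ₁ t₁ hag₁ ⟨hB₁, ht₁⟩
  have hin₁ := hin.of_agree hag₁ rfl rfl rfl rfl rfl
  rw [runs_seq]
  refine (runs_clearProg hin₁).mono ?_
  rintro σ₂ t₂ hag₂ ⟨hv, ht₂⟩
  have hin₂ := hin₁.of_agree hag₂ rfl rfl rfl rfl rfl
  have hB₂ : CutMarks n σ₂ B := hB₁.congr (hag₂.nat 1 rfl) (hag₂.nat 2 rfl) (hag₂.nat 26 rfl)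
  rw [runs_seq]
  refine (runs_sweepProg hin₂ hΛ hB₂ hv).mono ?_
  rintro σ₃ t₃ hag₃ ⟨R, ht₃⟩
  have hin₃ := hin₂.of_agree hag₃ rfl rfl rfl rfl rfl
  have hB₃ : CutMarks n σ₃ B := hB₂.congr (hag₃.nat 1 rfl) (hag₃.nat 2 rfl) (hag₃.nat 26 rfl)
  rw [runs_seq]
  refine (runs_boundsProg hin₃ hq).mono ?_
  rintro σ₄ t₄ hag₄ ⟨⟨hL, hU⟩, ht₄⟩
  rw [sum_cellLower hin₃ hB₃ hsub] at hL
  rw [sum_cellUpper hin₃ hB₃ hsub] at hU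
  have hin₄ := hin₃.of_agree hag₄ rfl rfl rfl rfl rfl
  have hB₄ : CutMarks n σ₄ B := hB₃.congr (hag₄.nat 1 rfl) (hag₄.nat 2 rfl) (hag₄.nat 26 rfl)
  have hsearch : σ₄.search = σ₃.search := by
    unfold State.search
    rw [hag₄.nat 20 rfl, hag₄.nat 21 rfl, hag₄.nat 22 rfl, hag₄.nat 23 rfl, hag₄.nat 24 rfl]
  rw [← hsearch, ← hag₄.nat 27 rfl, ← hag₄.nat 28 rfl] at R
  refine (runs_enumProg hin₄ hq hB₄ R hs).mono ?_
  rintro σ₅ t₅ - ⟨⟨hL₅, hU₅⟩, ht₅⟩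
  have hz : ∀ i, σ₃.real 2 i = 0 := fun i => by
    rw [hag₃.real 2 rfl, hag₂.real 2 rfl, hag₁.real 2 rfl]
    exact henc.real_zero 2 le_rfl i
  refine ⟨⟨?_, ?_⟩, ?_⟩
  · rw [hL₅, hL, hz, zero_add, add_comm]; rfl
  · rw [hU₅, hU, hz, zero_add, add_comm]; rfl
  · rw [← hin.off_eq_sum_degree]
    have e₂ : σ₂.nat 1 = σ.nat 1 := (hag₂.nat 1 rfl).trans (hag₁.nat 1 rfl)
    have e₃ : σ₃.nat 1 = σ.nat 1 := (hag₃.nat 1 rfl).trans e₂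
    have e₄ : σ₄.nat 1 = σ.nat 1 := (hag₄.nat 1 rfl).trans e₃
    rw [e₂] at ht₃
    rw [e₃] at ht₄
    rw [e₄] at ht₅
    set m := σ.nat 1 n
    set W := q ^ max 2 s
    have hW1 : 1 ≤ W := Nat.one_le_pow _ _ hq
    have hW2 : q * q ≤ W := by
      rw [← sq]; exact Nat.pow_le_pow_right hq (le_max_left _ _)
    have hWs : q ^ s ≤ W := Nat.pow_le_pow_right hq (le_max_right _ _)
    have h1 : t₁ ≤ r * (18 * m + 42 * n) * W + 2 * n * W := by
      have a : r * (18 * m + 30 * n + 12) ≤ r * (18 * m + 42 * n) := Nat.mul_le_mul_left _ (by omega)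
      have b := Nat.le_mul_of_pos_right (r * (18 * m + 42 * n)) hW1
      have c := Nat.le_mul_of_pos_right (2 * n) hW1
      omega
    have h4 : (6 * (q * q) + 12) * m ≤ 18 * m * W := by
      calc (6 * (q * q) + 12) * m ≤ (6 * W + 12 * W) * m := by
            apply Nat.mul_le_mul_right; omega
        _ = 18 * m * W := by ring
    have h5 : q ^ s * (6 * m + 34 * n) ≤ (6 * m + 34 * n) * W := by
      rw [mul_comm]; exact Nat.mul_le_mul_left _ hWs
    have h6 : t₂ + t₃ + 4 * n + 2 + 4 * n + 2 ≤ (11 * m + 41 * n) * W :=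
      le_trans (by omega) (Nat.le_mul_of_pos_right (11 * m + 41 * n) hW1)
    calc _ ≤ r * (18 * m + 42 * n) * W + 2 * n * W + 18 * m * W + (6 * m + 34 * n) * W +
          (11 * m + 41 * n) * W := by omega
      _ = (18 * r * m + 42 * r * n + 77 * n + 35 * m) * W := by ring
      _ ≤ _ := by
        apply Nat.mul_le_mul_right
        nlinarith [Nat.zero_le (r * m), Nat.zero_le (r * n)]

/-! ## The number of steps -/

open scoped Classical in
theorem degree_le_maxDeg (M : PairwiseMRF n q) (v : Fin n) : M.graph.degree v ≤ M.maxDeg :=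
  M.graph.degree_le_maxDegree v

theorem ncard_supp_minorE_le (M : PairwiseMRF n q) (hΛ : 0 < Λ) (hG : ExcludesKrr r M.graph)
    (L : Draws n r Λ)
    (c : (M.graph.deleteEdges (minorE M.graph r Λ (minRoot n) L)).ConnectedComponent) :
    c.supp.ncard ≤ 2 * max M.maxDeg 1 ^ (40 * r ^ 2 * Λ) :=
  ncard_supp_minorEIter_le (minRoot_valid n) (extendDraws_lt hΛ L) hG
    (fun v => (degree_le_maxDeg M v).trans (le_max_left _ _)) (le_max_right _ _) c

open scoped Classical in
-- One constant has to serve twice, as a factor and in the exponent. It is the sum of `160 (r + 1)`,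
-- from the step count with at most `n D` cells, and `40 r²`, from the bound on the components.
theorem runs_logPartition_steps_le {L : Draws n r Λ} (henc : Encodes M r Λ L σ) (hn : 0 < n)
    (hq : 0 < q) (hΛ : 0 < Λ) (hG : ExcludesKrr r M.graph) :
    Runs logPartition σ fun σ' t =>
      (σ'.real 2 0 = M.logLB (minorE M.graph r Λ (minRoot n) L) ∧
        σ'.real 2 1 = M.logUB (minorE M.graph r Λ (minRoot n) L)) ∧
      t ≤ (160 * (r + 1) + 40 * r ^ 2) * n * max M.maxDeg 1 *
        q ^ (2 * max M.maxDeg 1 ^ ((160 * (r + 1) + 40 * r ^ 2) * Λ)) := by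
  refine (runs_logPartition henc hn hq hΛ (ncard_supp_minorE_le M hΛ hG L)).mono ?_
  rintro σ' t - ⟨h, ht⟩
  refine ⟨h, ht.trans ?_⟩
  set D := max M.maxDeg 1 with hD
  have hD1 : 1 ≤ D := le_max_right _ _
  have hdeg : ∑ v, M.graph.degree v ≤ n * D := by
    calc ∑ v, M.graph.degree v ≤ ∑ _v : Fin n, D :=
          Finset.sum_le_sum fun v _ => (degree_le_maxDeg M v).trans (le_max_left _ _)
      _ = n * D := by simp
  have hexp : max 2 (2 * D ^ (40 * r ^ 2 * Λ)) ≤ 2 * D ^ ((160 * (r + 1) + 40 * r ^ 2) * Λ) := by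
    have h1 : 1 ≤ D ^ (40 * r ^ 2 * Λ) := Nat.one_le_pow _ _ hD1
    rw [max_eq_right (by omega)]
    exact Nat.mul_le_mul_left _ (Nat.pow_le_pow_right hD1 (Nat.mul_le_mul_right _ (by omega)))
  refine Nat.mul_le_mul ?_ (Nat.pow_le_pow_right hq hexp)
  calc 80 * (r + 1) * (n + ∑ v, M.graph.degree v) ≤ 80 * (r + 1) * (n * D + n * D) := by
        apply Nat.mul_le_mul_left
        have := Nat.le_mul_of_pos_right n hD1
        omega
    _ = 160 * (r + 1) * n * D := by ring
    _ ≤ _ := by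
        apply Nat.mul_le_mul_right
        apply Nat.mul_le_mul_right
        omega

/-- A bound for the number of steps in terms of `ε⁻¹ d* log d*`. -/
theorem steps_le {ε : ℝ} (hΛdef : Λ = levelParam M r ε) {L : Draws n r Λ} {σ' : State} {T : ℕ}
    (henc : Encodes M r Λ L σ) (hn : 0 < n) (hq : 0 < q) (hε : 0 < ε)
    (hG : ExcludesKrr r M.graph) (hT : Exec logPartition σ σ' T) :
    (T : ℝ) ≤ 80 * (r + 1) * (1 + 2 ^ (2 * r)) * n * (q : ℝ) ^ (2 *
      Real.exp (120 * r ^ 3 * (ε⁻¹ * (M.maxDeg : ℝ) * Real.log (M.maxDeg : ℝ)))) := by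
  classical
  have hr := r_pos_of_excludesKrr hG
  have hΛ : 0 < Λ := hΛdef ▸ levelParam_pos M hr hε
  set x : ℝ := ε⁻¹ * (M.maxDeg : ℝ) * Real.log (M.maxDeg : ℝ) with hx
  have hx0 : 0 ≤ x := mul_nonneg (by positivity) (Real.log_natCast_nonneg _)
  have hexp1 : 1 ≤ Real.exp (120 * r ^ 3 * x) := Real.one_le_exp (by positivity)
  -- The size bound comes from three cases. For `d* ≤ 1` components have at most two vertices; for
  -- `Λ = 1` they are single vertices; otherwise `Λ` is at most `3 r ε⁻¹ d*`.
  obtain ⟨s, hs, hs2⟩ : ∃ s : ℕ, (∀ c : (M.graph.deleteEdges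
      (minorE M.graph r Λ (minRoot n) L)).ConnectedComponent, c.supp.ncard ≤ s) ∧
      (s : ℝ) ≤ 2 * Real.exp (120 * r ^ 3 * x) := by
    rcases Nat.lt_or_ge M.maxDeg 2 with hd | hd
    · refine ⟨2, fun c => ?_, by push_cast; linarith⟩
      have h1 := ncard_supp_minorE_le M hΛ hG L c
      rw [max_eq_right (by omega)] at h1
      simpa using h1
    rcases Nat.lt_or_ge Λ 2 with hΛ2 | hΛ2
    · refine ⟨1, fun c => ?_, by push_cast; linarith⟩
      obtain rfl : Λ = 1 := by omega
      exact ncard_supp_bot_le _ (minorEIter_one_eq (extendDraws_lt one_pos L) hr) c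
    · refine ⟨_, ncard_supp_minorE_le M hΛ hG L, ?_⟩
      rw [max_eq_left (by omega)]
      push_cast
      have hd' : (2 : ℝ) ≤ M.maxDeg := by exact_mod_cast hd
      have hd0 : (0 : ℝ) < M.maxDeg := by linarith
      have hr' : (0 : ℝ) < r := by exact_mod_cast hr
      have hlog : 0 ≤ Real.log (M.maxDeg : ℝ) := Real.log_natCast_nonneg _
      -- As `Λ ≥ 2`, the number that was rounded up exceeds `1`, so rounding at most doubles it.
      -- Together with `2 (d* + 1) ≤ 3 d*` this gives the factor `3`.
      have hy : 1 < (r : ℝ) * ((M.maxDeg : ℝ) + 1) / ε := by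
        by_contra! h
        have : Λ ≤ 1 := hΛdef ▸ Nat.ceil_le.2 (by exact_mod_cast h)
        omega
      have hΛle : (Λ : ℝ) ≤ 3 * r * (ε⁻¹ * M.maxDeg) := by
        have h1 : (Λ : ℝ) < (r : ℝ) * ((M.maxDeg : ℝ) + 1) / ε + 1 :=
          hΛdef ▸ Nat.ceil_lt_add_one (by positivity)
        have h2 : 2 * ((r : ℝ) * ((M.maxDeg : ℝ) + 1) / ε) ≤ 3 * r * (ε⁻¹ * M.maxDeg) := by
          have e1 : 2 * ((r : ℝ) * ((M.maxDeg : ℝ) + 1) / ε) =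
            r * ε⁻¹ * (2 * (M.maxDeg : ℝ) + 2) := by field_simp
          have e2 : 3 * r * (ε⁻¹ * (M.maxDeg : ℝ)) = r * ε⁻¹ * (3 * (M.maxDeg : ℝ)) := by ring
          rw [e1, e2]
          gcongr
          linarith
        linarith
      have hpow : (M.maxDeg : ℝ) ^ (40 * r ^ 2 * Λ) =
          Real.exp (40 * r ^ 2 * Λ * Real.log (M.maxDeg : ℝ)) := by
        have : (40 * (r : ℝ) ^ 2 * Λ * Real.log (M.maxDeg : ℝ)) =
          ((40 * r ^ 2 * Λ : ℕ) : ℝ) * Real.log (M.maxDeg : ℝ) := by push_cast; ring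
        rw [this, Real.exp_nat_mul, Real.exp_log hd0]
      rw [hpow]
      refine mul_le_mul_of_nonneg_left (Real.exp_le_exp.2 ?_) zero_le_two
      calc 40 * (r : ℝ) ^ 2 * Λ * Real.log (M.maxDeg : ℝ)
          ≤ 40 * (r : ℝ) ^ 2 * (3 * r * (ε⁻¹ * M.maxDeg)) * Real.log (M.maxDeg : ℝ) := by gcongr
        _ = 120 * r ^ 3 * x := by rw [hx]; ring
  obtain ⟨σ'', t, hexec, -, ht⟩ := runs_logPartition henc hn hq hΛ hs
  obtain ⟨-, rfl⟩ := hT.deterministic hexec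
  -- A factor `d*` for the number of cells would be too large here: `ε` may grow, so the hypothesis
  -- on `ε⁻¹ d* log d*` alone does not bound `d*` suitably. Sparsity of the graph replaces it by a
  -- constant depending on `r`.
  have hsum := sum_degree_le_of_excludesKrr (G := M.graph) hG
  rw [Fintype.card_fin] at hsum
  have hT' : T ≤ 80 * (r + 1) * (1 + 2 ^ (2 * r)) * n * q ^ max 2 s := by
    refine ht.trans (Nat.mul_le_mul_right _ ?_)
    calc 80 * (r + 1) * (n + ∑ v, M.graph.degree v)
        ≤ 80 * (r + 1) * (n + 2 ^ (2 * r) * n) := Nat.mul_le_mul_left _ (by omega)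
      _ = _ := by ring
  have hq1 : (1 : ℝ) ≤ q := by exact_mod_cast hq
  calc (T : ℝ) ≤ 80 * (r + 1) * (1 + 2 ^ (2 * r)) * n * (q : ℝ) ^ max 2 s := by exact_mod_cast hT'
    _ ≤ _ := by
      rw [← Real.rpow_natCast (q : ℝ) (max 2 s)]
      gcongr
      rw [Nat.cast_max]
      exact max_le (by push_cast; linarith) hs2

end RAM

/-! ## The almost linear running time -/

/-- In the exponent, `a √(log n)` is eventually far below `δ log n`, since the difference is `√(log
n)` times a quantity that tends to infinity. -/
theorem isLittleO_exp_sqrt_log {n : ℕ → ℕ} (hn : Tendsto n atTop atTop) (a : ℝ) {δ : ℝ}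
    (hδ : 0 < δ) :
    (fun k => (n k : ℝ) * Real.exp (a * √(Real.log (n k)))) =o[atTop]
      fun k => (n k : ℝ) ^ (1 + δ) := by
  have hn' : Tendsto (fun k => (n k : ℝ)) atTop atTop := tendsto_natCast_atTop_atTop.comp hn
  have hℓ : Tendsto (fun k => √(Real.log (n k))) atTop atTop :=
    Real.tendsto_sqrt_atTop.comp (Real.tendsto_log_atTop.comp hn')
  have h1 : (fun k => Real.exp (a * √(Real.log (n k)))) =o[atTop]
      fun k => Real.exp (δ * Real.log (n k)) := by
    rw [Real.isLittleO_exp_comp_exp_comp]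
    have h2 : Tendsto (fun k => √(Real.log (n k)) * (δ * √(Real.log (n k)) + -a)) atTop atTop :=
      hℓ.atTop_mul_atTop₀ (tendsto_atTop_add_const_right _ _ (hℓ.const_mul_atTop hδ))
    refine h2.congr fun k => ?_
    have := Real.mul_self_sqrt (Real.log_natCast_nonneg (n k))
    linear_combination δ * this
  have h3 := (isBigO_refl (fun k => (n k : ℝ)) atTop).mul_isLittleO h1
  refine h3.congr' EventuallyEq.rfl ?_
  filter_upwards [hn'.eventually_gt_atTop 0] with k hk
  rw [Real.rpow_add hk, Real.rpow_one, Real.rpow_def_of_pos hk, mul_comm δ]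

/-- From `x = o(log log n)` it follows that `exp (B x) ≤ √(log n)` eventually, so the power of `q`
is at most `exp (2 log q √(log n))`. -/
theorem isLittleO_of_steps_le {n T : ℕ → ℕ} {x : ℕ → ℝ} {q : ℕ} {A B : ℝ} (hq : 0 < q) (hA : 0 ≤ A)
    (hB : 0 ≤ B) (hn : Tendsto n atTop atTop)
    (hT : ∀ k, 0 < n k → (T k : ℝ) ≤ A * n k * (q : ℝ) ^ (2 * Real.exp (B * x k)))
    (hx : x =o[atTop] fun k => Real.log (Real.log (n k))) {δ : ℝ} (hδ : 0 < δ) :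
    (fun k => (T k : ℝ)) =o[atTop] fun k => (n k : ℝ) ^ (1 + δ) := by
  have hn' : Tendsto (fun k => (n k : ℝ)) atTop atTop := tendsto_natCast_atTop_atTop.comp hn
  have hlog : Tendsto (fun k => Real.log (n k)) atTop atTop := Real.tendsto_log_atTop.comp hn'
  have hq0 : (0 : ℝ) < q := by exact_mod_cast hq
  refine IsBigO.trans_isLittleO ?_ (isLittleO_exp_sqrt_log hn (2 * Real.log q) hδ)
  refine IsBigO.of_bound A ?_
  -- This constant makes `B x` at most half of `log log n`; the added `1` covers `B = 0`.
  have hc : 0 < 1 / (2 * (B + 1)) := by positivity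
  filter_upwards [hx.bound hc, hn'.eventually_gt_atTop 0,
    hlog.eventually_ge_atTop 1] with k hk hnk hlk
  have hll : 0 ≤ Real.log (Real.log (n k)) := Real.log_nonneg hlk
  rw [Real.norm_of_nonneg (by positivity), Real.norm_of_nonneg (by positivity)]
  have hBx : B * x k ≤ Real.log (Real.log (n k)) / 2 := by
    have h1 : x k ≤ 1 / (2 * (B + 1)) * Real.log (Real.log (n k)) := by
      rw [Real.norm_of_nonneg hll] at hk
      exact (le_abs_self _).trans hk
    calc B * x k ≤ B * (1 / (2 * (B + 1)) * Real.log (Real.log (n k))) := by gcongr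
      _ = B / (B + 1) * (Real.log (Real.log (n k)) / 2) := by field_simp
      _ ≤ 1 * (Real.log (Real.log (n k)) / 2) := by
        gcongr
        rw [div_le_one (by positivity)]
        linarith
      _ = _ := one_mul _
  have hexp : Real.exp (B * x k) ≤ √(Real.log (n k)) := by
    rw [Real.sqrt_eq_rpow, Real.rpow_def_of_pos (by linarith)]
    apply Real.exp_le_exp.2
    linarith
  have hlq : 0 ≤ Real.log q := Real.log_natCast_nonneg q
  calc (T k : ℝ) ≤ A * n k * (q : ℝ) ^ (2 * Real.exp (B * x k)) := hT k (by exact_mod_cast hnk)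
    _ = A * (n k * Real.exp (2 * Real.log q * Real.exp (B * x k))) := by
      rw [Real.rpow_def_of_pos hq0]
      have : Real.log q * (2 * Real.exp (B * x k)) = 2 * Real.log q * Real.exp (B * x k) := by ring
      rw [this]; ring
    _ ≤ _ := by gcongr

theorem mainTheorem2 :
    -- validity of the bounds, and the expected gap, for every way of picking the nodes
    (∀ (r n q : ℕ) (M : PairwiseMRF n q) (ε : ℝ) (root : RootRule (Fin n)),
      0 < q → 0 < ε → ExcludesKrr r M.graph → root.Valid →
        (∀ L : Draws n r (levelParam M r ε),
          M.logLB (minorE M.graph r (levelParam M r ε) root L) ≤ Real.log M.Z ∧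
          Real.log M.Z ≤ M.logUB (minorE M.graph r (levelParam M r ε) root L)) ∧
        (𝔼 L : Draws n r (levelParam M r ε),
          (M.logUB (minorE M.graph r (levelParam M r ε) root L) -
            M.logLB (minorE M.graph r (levelParam M r ε) root L))) ≤ ε * Real.log M.Z) ∧
    -- the running time: one program for all inputs
    ∃ P : RAM.Prog,
      (∀ r : ℕ, ∃ C : ℕ, ∀ (n q : ℕ) (M : PairwiseMRF n q) (ε : ℝ),
        0 < n → 0 < q → 0 < ε → ExcludesKrr r M.graph →
          ∃ root : RootRule (Fin n), root.Valid ∧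
            ∀ (L : Draws n r (levelParam M r ε)) (σ : RAM.State),
              RAM.Encodes M r (levelParam M r ε) L σ →
                ∃ (σ' : RAM.State) (t : ℕ), RAM.Exec P σ σ' t ∧
                  σ'.real 2 0 = M.logLB (minorE M.graph r (levelParam M r ε) root L) ∧
                  σ'.real 2 1 = M.logUB (minorE M.graph r (levelParam M r ε) root L) ∧
                  t ≤ C * n * max M.maxDeg 1 *
                    q ^ (2 * max M.maxDeg 1 ^ (C * levelParam M r ε))) ∧
      (∀ (r q : ℕ) (n : ℕ → ℕ) (M : (k : ℕ) → PairwiseMRF (n k) q) (ε : ℕ → ℝ)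
          (L : (k : ℕ) → Draws (n k) r (levelParam (M k) r (ε k)))
          (σ σ' : ℕ → RAM.State) (T : ℕ → ℕ),
        0 < q → (∀ k, 0 < ε k) → (∀ k, ExcludesKrr r (M k).graph) →
        (∀ k, RAM.Encodes (M k) r (levelParam (M k) r (ε k)) (L k) (σ k)) →
        (∀ k, RAM.Exec P (σ k) (σ' k) (T k)) →
        Tendsto n atTop atTop →
        (fun k => (ε k)⁻¹ * ((M k).maxDeg : ℝ) * Real.log ((M k).maxDeg : ℝ))
          =o[atTop] (fun k => Real.log (Real.log (n k : ℝ))) →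
        ∀ δ : ℝ, 0 < δ →
          (fun k => (T k : ℝ)) =o[atTop] (fun k => (n k : ℝ) ^ (1 + δ))) := by
  refine ⟨?_, RAM.logPartition, ?_, ?_⟩
  · intro r n q M ε root hq hε hG _
    exact ⟨fun L => ⟨M.logLB_le_log_Z hq (minorEIter_subset r),
      M.log_Z_le_logUB hq (minorEIter_subset r)⟩,
      expect_gap_le M ε root hq hε (r_pos_of_excludesKrr hG)⟩
  · intro r
    refine ⟨160 * (r + 1) + 40 * r ^ 2, fun n q M ε hn hq hε hG => ⟨minRoot n, minRoot_valid n,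
      fun L σ henc => ?_⟩⟩
    obtain ⟨σ', t, hexec, ⟨hL, hU⟩, ht⟩ := RAM.runs_logPartition_steps_le henc hn hq
      (levelParam_pos M (r_pos_of_excludesKrr hG) hε) hG
    exact ⟨σ', t, hexec, hL, hU, ht⟩
  · intro r q n M ε L σ σ' T hq hε hG henc hexec hn hx δ hδ
    exact isLittleO_of_steps_le hq (A := 80 * (r + 1) * (1 + 2 ^ (2 * r))) (B := 120 * r ^ 3)
      (by positivity) (by positivity) hn
      (fun k hk => RAM.steps_le rfl (henc k) hk hq (hε k) (hG k) (hexec k)) hx hδ
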